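/- **Theorem (Summability).** Let $q\in\mathbb C$, $|q|>1$, $E_q=\mathbb C^*/q^{\mathbb Z}$, $[\lambda]=\lambda q^{\mathbb Z}$ and $\sigma_qf(z)=f(qz)$. *Divisors and theta functions.* A divisor is a finite sum $\Lambda=\sum_i\nu_i[\lambda_i]$ with $\nu_i\in\mathbb N^*$ and distinct spirals $[\lambda_i]$; we write $\nu_\lambda(\Lambda)$ for the coefficient of $[\lambda]$, $|\Lambda|=\sum\nu_i$, and $\Vert\Lambda\Vert=(-1)^{|\Lambda|}\prod\lambda_i^{\nu_i}\bmod q^{\mathbb Z}\in E_q$. Put $d_q(z,\Lambda)=\prod_i\bigl(\inf_{\xi\in[\lambda_i]}|1-z/\xi|\bigr)^{\nu_i}$ and $S(\Lambda,\epsilon;R)=\{z\in\mathbb C^*: d_q(z,\Lambda)>\epsilon,\ |z|<R\}$. Let $\theta(z;q)=\sum_{n\in\mathbb Z}q^{-n(n-1)/2}z^n=\prod_{n\ge0}(1-q^{-n-1})(1+q^{-n}z)(1+q^{-n-1}/z)$, $e(z)=\theta(|z|;|q|)$ and $\theta_\Lambda(z)=\prod_i\theta(-z/\lambda_i;q)^{\nu_i}$.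 *Growth.* A sequence $(a_n)_{n\gg0}$ is $q$-Gevrey of order $s$ if $|a_n|\le CA^n|q|^{sn^2/2}$ for large $n$ and some $C,A>0$. A function $F$ analytic on a punctured disk $\Omega=\{0<|z|<R\}$ has $q$-Gevrey order $k$ at $0$ if for every compact $W$ with $\bigcup_{n\ge0}q^{-n}W\subset\Omega$ there are $C,\mu>0$ with $|F(z)|\le C\,e(\mu z)^k$ on $\bigcup_{n\ge0}q^{-n}W$. For divisors $\Lambda'\le\Lambda$ it has $q$-Gevrey order $s$ over $\Lambda/\Lambda'$ at $0$ if, for every $\lambda\in\mathbb C^*$ and $\nu_\lambda(\Lambda')\le j<\nu_\lambda(\Lambda)$, the sequence $(F^{(j)}(\lambda q^{-n}))_{n\gg0}$ is $q$-Gevrey of order $s$. *Multisummable functions.* Let $(M_1,\dots,M_p)$ be nonzero divisors with sum $M$, and $M_{\ge s}=\sum_{t\ge s}M_t$. Let $\mathbb E^{M}_{(M_1,\dots,M_p)}$ be the set of functions analytic in a punctured neighbourhood of $0$, of $q$-Gevrey order $|M|$ at $0$ and, for $s=1,\dots,p$, of $q$-Gevrey order $|M_{\ge s+1}|$ over $M_{\ge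 s}/M_{\ge s+1}$ at $0$. Let $\mathbb B^M$ be the set of functions analytic on some $S(M,0;R)$, $R>0$, and bounded on $S(M,\epsilon;r)$ for all $\epsilon>0$, $0<r<R$. Functions in $\mathbb B^M$ are considered as germs at $0$ out of $M$, i.e. two of them are identified if they agree on some $S(M,0;R')$, $R'>0$. The set of multisummable functions with respect to $(M_1,\dots,M_p)$ is $\mathbb O^{M}_{(M_1,\dots,M_p)}=\bigl(\theta_M^{-1}\,\mathbb E^{M}_{(M_1,\dots,M_p)}\bigr)\cap\mathbb B^M$. *The equation.* Let $k\ge1$, $\mu_1<\dots<\mu_k$ be integers, $A_i\in GL_{r_i}(\mathbb C)$ and $A_0=\operatorname{diag}(z^{\mu_1}A_1,\dots,z^{\mu_k}A_k)$. Let $A$ be in Birkhoff–Guenther normal form over $A_0$: $A$ is block upper triangular with diagonal blocks $z^{\mu_i}A_i$ and blocks $U_{i,j}$ ($i<j$) whose entries lie in $\sum_{n=\mu_i}^{\mu_j-1}\mathbb Cz^n$. Let $\mathcal G$ be the group of block upper triangular matrices with identity diagonal blocks (for the block sizes $r_1,\dots,r_k$). *Genericity.* Let $\Lambda=\Lambda_1+\dots+\Lambda_{k-1}$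 be a divisor together with a partition, and put $\Lambda_{i,j}=\sum_{\ell=i}^{j-1}\Lambda_\ell$ for $i<j$. Assume that the partition is generic for $A_0$: $|\Lambda_i|=\mu_{i+1}-\mu_i$ for $1\le i\le k-1$, and for all $i<j$ and all eigenvalues $\alpha_i$ of $A_i$ and $\alpha_j$ of $A_j$, $\Vert\Lambda_{i,j}\Vert\not\equiv\alpha_i/\alpha_j\pmod{q^{\mathbb Z}}$. Then the conjugacy equation $(\sigma_qF)A_0=AF$ has a unique solution $F=(F_{i,j})\in\mathcal G$, with entries germs at $0$ of functions out of $\Lambda$, such that for all $i<j$ the entries of $F_{i,j}$ belong to the space of multisummable functions $\mathbb O^{\Lambda_{i,j}}_{(\Lambda_{j-1},\Lambda_{j-2},\dots,\Lambda_i)}$. -/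

import Mathlib

open Filter Topology

noncomputable section

namespace QDiff

/-! ### Divisors on the elliptic curve `ℂˣ / q^ℤ` -/

/-- The complex torus `E_q = ℂˣ / q^ℤ`. A point of it is the same as a `q`-spiral `[λ] = λ q^ℤ`. -/
abbrev Torus (q : ℂˣ) : Type := ℂˣ ⧸ Subgroup.zpowers q

/-- (Effective) divisors `∑ ν_i [λ_i]` on `E_q`. -/
abbrev Divisor (q : ℂˣ) : Type := Torus q →₀ ℕ

/-- A base point `λ` of the spiral `x = [λ]`. It enters below in `thetaDiv` and in `GevreyOver`,
in notions which do not depend on it: replacing `λ` by `q^k λ` shifts the sequences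
`n ↦ F^{(j)}(λ q^{-n})` and multiplies the theta function by a nonzero monomial in `z`. -/
def base {q : ℂˣ} (x : Torus q) : ℂˣ := Quotient.out x

/-- The degree `|Λ| = ∑ ν_i`. -/
def degree {q : ℂˣ} (Λ : Divisor q) : ℕ := Λ.sum fun _ ν => ν

/-- The weight `‖Λ‖ = (-1)^{|Λ|} ∏ λ_i^{ν_i} mod q^ℤ`, an element of `E_q`. -/
def weight {q : ℂˣ} (Λ : Divisor q) : Torus q :=
  ((-1 : ℂˣ) : Torus q) ^ degree Λ * Λ.prod fun x ν => x ^ ν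

/-- `d_q(z,[λ]) = inf_{ξ ∈ [λ]} |1 - z/ξ|`. -/
def distSpiral {q : ℂˣ} (z : ℂ) (x : Torus q) : ℝ :=
  ⨅ ξ : {ξ : ℂˣ // (ξ : Torus q) = x}, ‖1 - z / (ξ : ℂˣ)‖

/-- `d_q(z,Λ) = ∏ d_q(z,[λ_i])^{ν_i}`. -/
def distDiv {q : ℂˣ} (z : ℂ) (Λ : Divisor q) : ℝ :=
  Λ.prod fun x ν => distSpiral z x ^ ν

/-- The sector `S(Λ,ε) = {z ∈ ℂ^* | d_q(z,Λ) > ε}`. -/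
def sector {q : ℂˣ} (Λ : Divisor q) (ε : ℝ) : Set ℂ :=
  {z | z ≠ 0 ∧ ε < distDiv z Λ}

/-- The germ of sector `S(Λ,ε;R) = {z ∈ ℂ^* | d_q(z,Λ) > ε, |z| < R}`. -/
def germSector {q : ℂˣ} (Λ : Divisor q) (ε R : ℝ) : Set ℂ :=
  {z | z ∈ sector Λ ε ∧ ‖z‖ < R}

/-! ### Theta functions and `q`-Gevrey conditions -/

/-- Jacobi's theta function
`θ(z;q) = ∑_{n ∈ ℤ} q^{-n(n-1)/2} z^n = ∏_{n ≥ 0} (1 - q^{-n-1}) (1 + q^{-n} z) (1 + q^{-n-1}/z)`,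
in its product form. -/
def theta {𝕜 : Type*} [NormedField 𝕜] (q z : 𝕜) : 𝕜 :=
  ∏' n : ℕ, (1 - (q ^ (n + 1))⁻¹) * (1 + (q ^ n)⁻¹ * z) * (1 + (q ^ (n + 1))⁻¹ / z)

/-- `e(z) = θ(|z|;|q|)`. -/
def expTheta (q : ℂˣ) (z : ℂ) : ℝ := theta ‖(q : ℂ)‖ ‖z‖

/-- `θ_Λ(z) = ∏ θ(-z/λ_i)^{ν_i}`. -/
def thetaDiv {q : ℂˣ} (Λ : Divisor q) (z : ℂ) : ℂ :=
  Λ.prod fun x ν => theta (q : ℂ) (-z / (base x : ℂ)) ^ ν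

/-- A sequence (given for large `n`) is `q`-Gevrey of order `s` if it is dominated by
`C A^n |q|^{s n²/2}`. -/
def IsGevreySeq (q : ℂˣ) (s : ℝ) (a : ℕ → ℂ) : Prop :=
  ∃ C > 0, ∃ A > 0, ∀ᶠ n : ℕ in atTop,
    ‖a n‖ ≤ C * A ^ n * ‖(q : ℂ)‖ ^ (s * (n : ℝ) ^ 2 / 2)

/-- `q`-exponential growth of order (at most) `k` at `0` over `Ω`: for every compact `W` such that
`W_(0) = ⋃_{n ≥ 0} q^{-n} W ⊆ Ω`, one has `|F(z)| ≤ C e(μz)^k` on `W_(0)` for some `C, μ > 0`. -/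
def HasExpGrowthAtZero (q : ℂˣ) (k : ℕ) (Ω : Set ℂ) (F : ℂ → ℂ) : Prop :=
  ∀ W : Set ℂ, IsCompact W → (∀ z ∈ W, ∀ n : ℕ, z / (q : ℂ) ^ n ∈ Ω) →
    ∃ C > 0, ∃ μ : ℝ, 0 < μ ∧ ∀ z ∈ W, ∀ n : ℕ,
      ‖F (z / (q : ℂ) ^ n)‖ ≤ C * expTheta q (μ * (z / (q : ℂ) ^ n)) ^ k

/-- `F` has `q`-Gevrey order `s` over the relative divisor `Λ/Λ'` at `0`: all its values
`(F^{(j)}(λ_i q^{-n}))_{n ≫ 0}`, `ν'_i ≤ j < ν_i`, are `q`-Gevrey sequences of order `s`. -/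
def GevreyOver {q : ℂˣ} (s : ℝ) (Λ Λ' : Divisor q) (F : ℂ → ℂ) : Prop :=
  ∀ (x : Torus q) (j : ℕ), Λ' x ≤ j → j < Λ x →
    IsGevreySeq q s fun n => iteratedDeriv j F ((base x : ℂ) / (q : ℂ) ^ n)

/-! ### Multisummable functions -/

/-- The space `𝔼^Λ_{(Λ_1,…,Λ_m)}` for `L = [Λ_1,…,Λ_m]` and `Λ = Λ_1 + ⋯ + Λ_m`: the functions
that are analytic in a punctured neighbourhood of `0`, have `q`-Gevrey order `|Λ|` at `0` and, for
every `i`, have `q`-Gevrey order `|Λ_{≥ i+1}|` over `Λ_{≥ i}/Λ_{≥ i+1}` at `0`.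
(`L` is indexed from `0` in the code.) -/
def EE {q : ℂˣ} (L : List (Divisor q)) : Set (ℂ → ℂ) :=
  {F | (∃ R > 0, AnalyticOnNhd ℂ F {z | 0 < ‖z‖ ∧ ‖z‖ < R} ∧
        HasExpGrowthAtZero q (degree L.sum) {z | 0 < ‖z‖ ∧ ‖z‖ < R} F) ∧
      ∀ i < L.length,
        GevreyOver (degree (L.drop (i + 1)).sum : ℝ) (L.drop i).sum (L.drop (i + 1)).sum F}

/-- The space `𝔹^Λ` of bounded analytic functions at `0` out of `Λ`: analytic on some `S(Λ,0;R)`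
and bounded on `S(Λ,ε;r)` for all `ε > 0` and `0 < r < R`. -/
def BB {q : ℂˣ} (Λ : Divisor q) : Set (ℂ → ℂ) :=
  {f | ∃ R > 0, AnalyticOnNhd ℂ f (germSector Λ 0 R) ∧
      ∀ ε > 0, ∀ r, 0 < r → r < R → ∃ C : ℝ, ∀ z ∈ germSector Λ ε r, ‖f z‖ ≤ C}

/-- The filter of the sets containing some `S(Λ,0;R)`, `R > 0`. Germs along it are germs at `0` of
functions defined out of `Λ`. -/
def out {q : ℂˣ} (Λ : Divisor q) : Filter ℂ := 𝓝[sector Λ 0] 0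

/-- The set `𝕆^Λ_{(Λ_1,…,Λ_m)} = (θ_Λ⁻¹ 𝔼^Λ_{(Λ_1,…,Λ_m)}) ∩ 𝔹^Λ` of multisummable functions at
`0` with respect to the partition `L = [Λ_1,…,Λ_m]` of `Λ = Λ_1 + ⋯ + Λ_m`. -/
def OO {q : ℂˣ} (L : List (Divisor q)) : Set (ℂ → ℂ) :=
  {f | f ∈ BB L.sum ∧ ∃ F ∈ EE L, ∀ᶠ z in out L.sum, f z = F z / thetaDiv L.sum z}

/-- The ring of germs at `0` of functions out of `Λ`. -/
abbrev GermOut {q : ℂˣ} (Λ : Divisor q) : Type := Germ (out Λ) ℂ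

/-- The elements of `𝕆^{Λ'}_{(Λ_1,…,Λ_m)}`, for a partition `L` of some `Λ' ≤ Λ`, seen as germs at
`0` out of the larger divisor `Λ` (by restriction). -/
def OOGerm {q : ℂˣ} (Λ : Divisor q) (L : List (Divisor q)) : Set (GermOut Λ) :=
  {φ | ∃ f ∈ OO L, φ = (f : GermOut Λ)}

/-! ### The operator `σ_q` -/

theorem distSpiral_mul {q : ℂˣ} (z : ℂ) (x : Torus q) :
    distSpiral ((q : ℂ) * z) x = distSpiral z x := by
  have h1 (ξ : ℂˣ) : ((q * ξ : ℂˣ) : Torus q) = ξ :=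
    QuotientGroup.eq.2 (by simp)
  have h2 (ξ : ℂˣ) : ((q⁻¹ * ξ : ℂˣ) : Torus q) = ξ :=
    QuotientGroup.eq.2 (by simp)
  let e : {ξ : ℂˣ // (ξ : Torus q) = x} ≃ {ξ : ℂˣ // (ξ : Torus q) = x} :=
    { toFun := fun ξ => ⟨q * ξ, (h1 ξ).trans ξ.2⟩
      invFun := fun ξ => ⟨q⁻¹ * ξ, (h2 ξ).trans ξ.2⟩
      left_inv := fun ξ => by simp
      right_inv := fun ξ => by simp }
  refine (Equiv.iInf_congr e fun ξ => ?_).symm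
  simp only [e, Equiv.coe_fn_mk, Units.val_mul]
  rw [mul_div_mul_left _ _ q.ne_zero]

theorem tendsto_out {q : ℂˣ} (Λ : Divisor q) :
    Tendsto (fun z : ℂ => (q : ℂ) * z) (out Λ) (out Λ) := by
  refine tendsto_nhdsWithin_of_tendsto_nhds_of_eventually_within _ ?_ ?_
  · have h : Tendsto (fun z : ℂ => (q : ℂ) * z) (𝓝 0) (𝓝 ((q : ℂ) * 0)) :=
      (continuous_const.mul continuous_id).tendsto 0
    rw [mul_zero] at h
    exact h.mono_left nhdsWithin_le_nhds
  · filter_upwards [self_mem_nhdsWithin] with z hz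
    refine ⟨mul_ne_zero q.ne_zero hz.1, ?_⟩
    have : distDiv ((q : ℂ) * z) Λ = distDiv z Λ := by
      simp only [distDiv, distSpiral_mul]
    rw [this]
    exact hz.2

/-- The dilatation operator `σ_q f(z) = f(qz)` on germs at `0` out of `Λ`. -/
def sigmaQ {q : ℂˣ} (Λ : Divisor q) (φ : GermOut Λ) : GermOut Λ :=
  φ.compTendsto (fun z : ℂ => (q : ℂ) * z) (tendsto_out Λ)

/-! ### Block matrices and the normal form -/

section Blocks

variable {k : ℕ} {r : Fin k → ℕ}

/-- The block `F_{i,j}`, of size `r_i × r_j`, of a square matrix of size `r_1 + ⋯ + r_k`. -/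
def block {R : Type*} (F : Matrix (Σ i, Fin (r i)) (Σ i, Fin (r i)) R) (i j : Fin k) :
    Matrix (Fin (r i)) (Fin (r j)) R :=
  F.submatrix (fun a => ⟨i, a⟩) (fun b => ⟨j, b⟩)

/-- The unipotent group `𝒢(R)`: block upper triangular matrices with identity diagonal blocks. -/
def unipotentBlock (r : Fin k → ℕ) (R : Type*) [Zero R] [One R] :
    Set (Matrix (Σ i, Fin (r i)) (Σ i, Fin (r i)) R) :=
  {F | (∀ i, block F i i = 1) ∧ ∀ i j, j < i → block F i j = 0}

/-- The block `z^{μ_i} A_i`. -/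
def pureBlock {m : ℕ} (μ : ℤ) (B : GL (Fin m) ℂ) : Matrix (Fin m) (Fin m) (ℂ → ℂ) :=
  (B : Matrix (Fin m) (Fin m) ℂ).map fun c z => z ^ μ * c

/-- The block diagonal matrix `A_0 = diag(z^{μ_1} A_1, …, z^{μ_k} A_k)`. -/
def diagForm (μ : Fin k → ℤ) (B : ∀ i, GL (Fin (r i)) ℂ) :
    Matrix (Σ i, Fin (r i)) (Σ i, Fin (r i)) (ℂ → ℂ) :=
  Matrix.blockDiagonal' fun i => pureBlock (μ i) (B i)

/-- The space `K_{μ,ν} = ∑_{n=μ}^{ν-1} ℂ z^n`. -/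
def normalSpace (μ ν : ℤ) : Submodule ℂ (ℂ → ℂ) :=
  Submodule.span ℂ ((fun (n : ℤ) (z : ℂ) => z ^ n) '' Set.Ico μ ν)

/-- The matrices in Birkhoff–Guenther normal form over `A_0`: block upper triangular, with diagonal
blocks `z^{μ_i} A_i` and with blocks `U_{i,j} ∈ Mat_{r_i,r_j}(K_{μ_i,μ_j})` for `i < j`. -/
def birkhoffGuenther (μ : Fin k → ℤ) (B : ∀ i, GL (Fin (r i)) ℂ) :
    Set (Matrix (Σ i, Fin (r i)) (Σ i, Fin (r i)) (ℂ → ℂ)) :=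
  {A | (∀ i, block A i i = pureBlock (μ i) (B i)) ∧
      (∀ i j, j < i → block A i j = 0) ∧
      ∀ i j, i < j → ∀ a b, block A i j a b ∈ normalSpace (μ i) (μ j)}

/-- A matrix of functions, seen as a matrix of germs at `0` out of `Λ`. -/
def toGerm {q : ℂˣ} (Λ : Divisor q) (A : Matrix (Σ i, Fin (r i)) (Σ i, Fin (r i)) (ℂ → ℂ)) :
    Matrix (Σ i, Fin (r i)) (Σ i, Fin (r i)) (GermOut Λ) :=
  A.map fun f => (f : GermOut Λ)

end Blocks

/-! ### Generic partitions -/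

section Partitions

variable {q : ℂˣ} {m : ℕ}

/-- The list `[Λ_i, …, Λ_{j-1}]`. (The number of slopes is `k = m + 1`. The slopes are indexed by
`Fin (m + 1)`, the divisors `Λ_1, …, Λ_{k-1}` by `Fin m`.) -/
def segment (P : Fin m → Divisor q) (i j : Fin (m + 1)) : List (Divisor q) :=
  ((List.finRange m).filter fun l => i ≤ l.castSucc ∧ l.castSucc < j).map P

/-- `Λ_{i,j} = ∑_{l=i}^{j-1} Λ_l`. -/
def segmentSum (P : Fin m → Divisor q) (i j : Fin (m + 1)) : Divisor q :=
  (segment P i j).sum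

/-- `(Λ_1, …, Λ_{k-1})` is a partition of `Λ` that is generic for
`A_0 = diag(z^{μ_1} A_1, …, z^{μ_k} A_k)`. -/
structure IsGenericPartition {r : Fin (m + 1) → ℕ} (μ : Fin (m + 1) → ℤ)
    (B : ∀ i, GL (Fin (r i)) ℂ) (Λ : Divisor q) (P : Fin m → Divisor q) : Prop where
  sum_eq : ∑ l, P l = Λ
  compatible : ∀ l : Fin m, (degree (P l) : ℤ) = μ l.succ - μ l.castSucc
  /-- `‖Λ_{i,j}‖ ≢ α_i/α_j (mod q^ℤ)` for all eigenvalues `α_i` of `A_i` and `α_j` of `A_j`. -/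
  nonresonant : ∀ i j : Fin (m + 1), i < j → ∀ α β : ℂˣ,
    (α : ℂ) ∈ spectrum ℂ (B i : Matrix (Fin (r i)) (Fin (r i)) ℂ) →
    (β : ℂ) ∈ spectrum ℂ (B j : Matrix (Fin (r j)) (Fin (r j)) ℂ) →
    weight (segmentSum P i j) ≠ ((α / β : ℂˣ) : Torus q)

end Partitions

end QDiff

end

/-! For i < j put X = F_{i,j} and d = |Λ_{i,j}| = μ_j - μ_i. Divided by z^{μ_i}, the (i,j) block of
the conjugacy equation reads z^d X(qz) A_j = A_i X(z) + W(z), where W = ∑_{i<l≤j} z^{-μ_i} U_{i,l}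
F_{l,j} involves only lower blocks of the same column, with polynomial coefficients. Each column is
therefore solved upwards from its identity block (`exists_column`).

Write X = G/θ with θ = θ_{Λ_{i,j}}. Since θ(qz) = κ z^d θ(z), the power of z disappears and the
equation becomes S G(qz) - G(z) = K(z), with S v = κ⁻¹ A_i⁻¹ v A_j and K = A_i⁻¹ θ W. On Laurent
coefficients it is (q^n S - 1) G_n = K_n. The weight ‖Λ_{i,j}‖ is the class of κ⁻¹, so by genericity
and Sylvester's theorem every q^n S - 1 is invertible. A bound on the inverses that is uniform in n
gives G analytic on ℂ^* (`exists_solution`).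

Read as G(z q^{-n-1}) = S G(z q^{-n}) - K(z q^{-n-1}), the equation is a linear recursion along
spirals, so q-Gevrey bounds of order s ≥ 0 pass from K to G, and likewise for derivatives
(`IsGevreyAlong.of_equation`). That K satisfies them is due to theta functions: F_{l,j} comes with
the partition (Λ_{j-1},…,Λ_l), and lengthening it to (Λ_{j-1},…,Λ_i) multiplies the numerator by
theta functions whose growth and zeros are exactly what the longer partition asks for
(`IsGevreyAlong.theta_smul`). Boundedness of X follows from X(z) = z^d A_i⁻¹ X(qz) A_j - A_i⁻¹ W(z),
a contraction near 0 because d ≥ 1 (`isBoundedOut_of_equation`).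

For uniqueness, the difference of two solutions satisfies the homogeneous equation once the lower
blocks agree. Its numerator is analytic in a punctured disk, and all its Laurent coefficients vanish
by invertibility of q^n S - 1 (`block_unique`). -/

open Filter Topology

noncomputable section

namespace QDiff

/-! ### The theta function -/

section ThetaProduct

variable {𝕜 : Type*} [NormedField 𝕜]

/-- The half product `∏ (1 + q^{-n} z)`. -/
def halfTheta (q z : 𝕜) : 𝕜 := ∏' n : ℕ, (1 + (q ^ n)⁻¹ * z)

theorem summable_norm_halfTheta {q : 𝕜} (hq : 1 < ‖q‖) (z : 𝕜) :
    Summable fun n : ℕ => ‖(q ^ n)⁻¹ * z‖ := by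
  simp only [norm_mul, norm_inv, norm_pow]
  simp only [← inv_pow]
  exact (summable_geometric_of_lt_one (by positivity) (inv_lt_one_of_one_lt₀ hq)).mul_right _

theorem halfTheta_neg_pow (q : 𝕜) (hq0 : q ≠ 0) (n : ℕ) : halfTheta q (-q ^ n) = 0 := by
  refine tprod_of_exists_eq_zero ⟨n, ?_⟩
  field_simp
  ring

variable [CompleteSpace 𝕜]

theorem multipliable_halfTheta {q : 𝕜} (hq : 1 < ‖q‖) (z : 𝕜) :
    Multipliable fun n : ℕ => 1 + (q ^ n)⁻¹ * z :=
  multipliable_one_add_of_summable (summable_norm_halfTheta hq z)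

theorem halfTheta_mul {q : 𝕜} (hq : 1 < ‖q‖) (z : 𝕜) :
    halfTheta q (q * z) = (1 + q * z) * halfTheta q z := by
  have hq0 : q ≠ 0 := norm_pos_iff.1 (zero_lt_one.trans hq)
  have h (n : ℕ) : 1 + (q ^ (n + 1))⁻¹ * (q * z) = 1 + (q ^ n)⁻¹ * z := by
    field_simp
    ring
  have hm : Multipliable fun n : ℕ => 1 + (q ^ (n + 1))⁻¹ * (q * z) := by
    simpa only [h] using multipliable_halfTheta hq z
  rw [halfTheta, tprod_eq_zero_mul' (f := fun n : ℕ => 1 + (q ^ n)⁻¹ * (q * z)) hm]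
  simp only [h, halfTheta, pow_zero, inv_one, one_mul]

theorem halfTheta_ne_zero {q : 𝕜} (hq : 1 < ‖q‖) {z : 𝕜} (h : ∀ n : ℕ, z ≠ -q ^ n) :
    halfTheta q z ≠ 0 := by
  have hq0 : q ≠ 0 := norm_pos_iff.1 (zero_lt_one.trans hq)
  refine tprod_one_add_ne_zero_of_summable (fun n h0 => h n ?_) (summable_norm_halfTheta hq z)
  field_simp at h0
  linear_combination h0

theorem theta_eq_mul {q : 𝕜} (hq : 1 < ‖q‖) (z : 𝕜) :
    theta q z = halfTheta q (-q⁻¹) * halfTheta q z * halfTheta q (q⁻¹ / z) := by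
  have h1 := multipliable_halfTheta hq (-q⁻¹)
  have h2 := multipliable_halfTheta hq z
  have h3 := multipliable_halfTheta hq (q⁻¹ / z)
  rw [halfTheta, halfTheta, halfTheta, ← h1.tprod_mul h2, ← (h1.mul h2).tprod_mul h3, theta]
  refine tprod_congr fun n => ?_
  congr 1
  · congr 1
    rw [pow_succ, mul_inv]; ring
  · rw [pow_succ, mul_inv]; ring

/-- Passing from z to qz, the first half product gains the factor 1 + qz and the second loses 1 +
1/(qz); the ratio of the two is qz. -/
theorem theta_mul {q : 𝕜} (hq : 1 < ‖q‖) {z : 𝕜} (hz : z ≠ 0) :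
    theta q (q * z) = q * z * theta q z := by
  have hq0 : q ≠ 0 := norm_pos_iff.1 (zero_lt_one.trans hq)
  have h : q⁻¹ / z = q * (q⁻¹ / (q * z)) := by field_simp
  rw [theta_eq_mul hq, theta_eq_mul hq, halfTheta_mul hq z, h, halfTheta_mul hq, ← h]
  field_simp
  ring

theorem theta_ne_zero {q : 𝕜} (hq : 1 < ‖q‖) {z : 𝕜} (hz : z ≠ 0) (h : ∀ n : ℤ, z ≠ -q ^ n) :
    theta q z ≠ 0 := by
  have hq0 : q ≠ 0 := norm_pos_iff.1 (zero_lt_one.trans hq)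
  rw [theta_eq_mul hq]
  refine mul_ne_zero (mul_ne_zero ?_ ?_) ?_
  · refine halfTheta_ne_zero hq fun n hn => ?_
    have h1 := congrArg norm hn
    rw [norm_neg, norm_neg, norm_inv, norm_pow] at h1
    have h2 : ‖q‖⁻¹ < 1 := inv_lt_one_of_one_lt₀ hq
    have h3 : 1 ≤ ‖q‖ ^ n := one_le_pow₀ hq.le
    linarith
  · exact halfTheta_ne_zero hq fun n => by simpa using h n
  · refine halfTheta_ne_zero hq fun n hn => h (-(n + 1 : ℤ)) ?_
    have hp : q ^ n ≠ 0 := pow_ne_zero n hq0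
    rw [zpow_neg, zpow_add₀ hq0, zpow_natCast, zpow_one]
    field_simp at hn ⊢
    linear_combination hn

/-- These are the zeros met along λ q^{-n}, n ≥ 0. The vanishing factor lies in the first half
product for n = 0 and in the second for n ≥ 1. -/
theorem theta_neg_inv_pow {q : 𝕜} (hq : 1 < ‖q‖) (n : ℕ) : theta q (-(q ^ n)⁻¹) = 0 := by
  have hq0 : q ≠ 0 := norm_pos_iff.1 (zero_lt_one.trans hq)
  rw [theta_eq_mul hq]
  rcases n with _ | n
  · have := halfTheta_neg_pow q hq0 0
    rw [pow_zero] at this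
    simp [this]
  · have : q⁻¹ / -(q ^ (n + 1))⁻¹ = -q ^ n := by
      rw [pow_succ]; field_simp
    rw [this, halfTheta_neg_pow q hq0, mul_zero]

end ThetaProduct

/-- On the ball of radius |z| + 1 the terms are dominated by their norms at the point |z| + 1, so
the product converges locally uniformly. -/
theorem differentiable_halfTheta {q : ℂ} (hq : 1 < ‖q‖) : Differentiable ℂ (halfTheta q) := by
  have hq0 : q ≠ 0 := norm_pos_iff.1 (zero_lt_one.trans hq)
  intro z
  have ho : IsOpen (Metric.ball (0 : ℂ) (‖z‖ + 1)) := Metric.isOpen_ball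
  have h := Summable.hasProdLocallyUniformlyOn_nat_one_add (R := ℂ) (f := fun n x => (q ^ n)⁻¹ * x) ho
    (summable_norm_halfTheta hq ((‖z‖ + 1 : ℝ) : ℂ))
    (.of_forall fun n x hx => by
      rw [norm_mul, norm_mul]
      gcongr
      rw [Complex.norm_real, Real.norm_of_nonneg (by positivity)]
      exact (mem_ball_zero_iff.1 hx).le)
    (fun n => by fun_prop)
  have hd : DifferentiableOn ℂ (halfTheta q) (Metric.ball (0 : ℂ) (‖z‖ + 1)) := by
    refine h.tendstoLocallyUniformlyOn_finsetRange.differentiableOn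
      (.of_forall fun n => ?_) ho
    fun_prop
  exact hd.differentiableAt (ho.mem_nhds (by simp))

theorem differentiableOn_theta {q : ℂ} (hq : 1 < ‖q‖) : DifferentiableOn ℂ (theta q) {0}ᶜ := by
  have h : theta q = fun z => halfTheta q (-q⁻¹) * halfTheta q z * halfTheta q (q⁻¹ / z) :=
    funext (theta_eq_mul hq)
  rw [h]
  have hd := differentiable_halfTheta hq
  refine (hd.const_mul _).differentiableOn.mul ?_
  refine hd.comp_differentiableOn ?_
  exact fun z (hz : z ≠ 0) => ((differentiableAt_const _).div differentiableAt_id hz).differentiableWithinAt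

/-- For x > 0 the two half products that depend on x have all factors at least 1; the constant c is
the remaining product ∏ (1 - Q^{-n-1}), which is positive. -/
theorem exists_le_theta {Q : ℝ} (hQ : 1 < Q) : ∃ c > 0, ∀ x > 0, c ≤ theta Q x := by
  have hQ' : 1 < ‖Q‖ := by rwa [Real.norm_of_nonneg (by linarith)]
  have h1 (x : ℝ) (hx : 0 ≤ x) : 1 ≤ halfTheta Q x := by
    refine ge_of_tendsto (multipliable_halfTheta hQ' x).hasProd (.of_forall fun s => ?_)
    refine Finset.prod_induction _ (fun y : ℝ => 1 ≤ y) (fun a b ha hb => one_le_mul_of_one_le_of_one_le ha hb)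
      le_rfl fun n _ => ?_
    have : 0 ≤ (Q ^ n)⁻¹ * x := by positivity
    linarith
  have h2 : 0 ≤ halfTheta Q (-Q⁻¹) := by
    refine ge_of_tendsto (multipliable_halfTheta hQ' _).hasProd (.of_forall fun s => ?_)
    refine Finset.prod_nonneg fun n _ => ?_
    have h3 : (Q ^ n)⁻¹ ≤ 1 := inv_le_one_of_one_le₀ (one_le_pow₀ hQ.le)
    have h4 : Q⁻¹ ≤ 1 := (inv_lt_one_of_one_lt₀ hQ).le
    have h5 : 0 ≤ Q⁻¹ := by positivity
    nlinarith [mul_le_one₀ h3 h5 h4]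
  have h3 : halfTheta Q (-Q⁻¹) ≠ 0 := by
    refine halfTheta_ne_zero hQ' fun n hn => ?_
    have h3 : 1 ≤ Q ^ n := one_le_pow₀ hQ.le
    have h4 : Q⁻¹ < 1 := inv_lt_one_of_one_lt₀ hQ
    linarith
  have h4 := lt_of_le_of_ne h2 h3.symm
  refine ⟨_, h4, fun x hx => ?_⟩
  rw [theta_eq_mul hQ', mul_assoc]
  exact le_mul_of_one_le_right h2 (one_le_mul_of_one_le_of_one_le (h1 x hx.le) (h1 _ (by positivity)))

/-! ### Distances to spirals and sectors -/

section Sectors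

variable {q : ℂˣ}

theorem coe_base (x : Torus q) : ((base x : ℂˣ) : Torus q) = x := Quotient.out_eq x

theorem torus_coe_eq_iff {u v : ℂˣ} : (u : Torus q) = v ↔ ∃ n : ℤ, v = u * q ^ n := by
  rw [QuotientGroup.eq, Subgroup.mem_zpowers_iff]
  exact exists_congr fun n => by rw [eq_inv_mul_iff_mul_eq, eq_comm]

theorem bddBelow_distSpiral (z : ℂ) (x : Torus q) :
    BddBelow (Set.range fun ξ : {ξ : ℂˣ // (ξ : Torus q) = x} => ‖1 - z / (ξ : ℂˣ)‖) :=
  ⟨0, by rintro _ ⟨ξ, rfl⟩; exact norm_nonneg _⟩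

theorem distSpiral_nonneg (z : ℂ) (x : Torus q) : 0 ≤ distSpiral z x :=
  Real.iInf_nonneg fun _ => norm_nonneg _

theorem distSpiral_le (z : ℂ) {x : Torus q} {ξ : ℂˣ} (h : (ξ : Torus q) = x) :
    distSpiral z x ≤ ‖1 - z / ξ‖ :=
  ciInf_le (bddBelow_distSpiral z x) ⟨ξ, h⟩

theorem distSpiral_coe (z : ℂˣ) : distSpiral (z : ℂ) (z : Torus q) = 0 :=
  le_antisymm (by simpa using distSpiral_le (z : ℂ) (rfl : (z : Torus q) = z))
    (distSpiral_nonneg _ _)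

theorem distDiv_add (z : ℂ) (Λ Λ' : Divisor q) :
    distDiv z (Λ + Λ') = distDiv z Λ * distDiv z Λ' :=
  Finsupp.prod_add_index' (fun _ => pow_zero _) fun _ _ _ => pow_add _ _ _

theorem distDiv_nonneg (z : ℂ) (Λ : Divisor q) : 0 ≤ distDiv z Λ :=
  Finset.prod_nonneg fun _ _ => pow_nonneg (distSpiral_nonneg _ _) _

theorem distSpiral_pos_of_mem_sector {Λ : Divisor q} {z : ℂ} (hz : z ∈ sector Λ 0) {x : Torus q}
    (hx : x ∈ Λ.support) : 0 < distSpiral z x := by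
  refine lt_of_le_of_ne (distSpiral_nonneg _ _) fun h => hz.2.ne' ?_
  refine Finset.prod_eq_zero hx ?_
  simp only [← h]
  exact zero_pow (Finsupp.mem_support_iff.1 hx)

theorem coe_ne_of_mem_sector {Λ : Divisor q} {z : ℂˣ} (hz : (z : ℂ) ∈ sector Λ 0) {x : Torus q}
    (hx : x ∈ Λ.support) : (z : Torus q) ≠ x := by
  rintro rfl
  exact (distSpiral_pos_of_mem_sector hz hx).ne' (distSpiral_coe z)

theorem mul_mem_sector {Λ : Divisor q} {ε : ℝ} {z : ℂ} (hz : z ∈ sector Λ ε) :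
    (q : ℂ) * z ∈ sector Λ ε := by
  refine ⟨mul_ne_zero q.ne_zero hz.1, ?_⟩
  have : distDiv ((q : ℂ) * z) Λ = distDiv z Λ := by
    simp only [distDiv, distSpiral_mul]
  rw [this]
  exact hz.2

theorem sector_subset_sector {Λ : Divisor q} {ε ε' : ℝ} (h : ε ≤ ε') :
    sector Λ ε' ⊆ sector Λ ε := fun _ hz => ⟨hz.1, h.trans_lt hz.2⟩

/-! ### Discreteness of spirals and monotonicity of sectors, for |q| > 1. -/

section

variable (hq : 1 < ‖(q : ℂ)‖)
include hq

theorem tendsto_pow_inv_atTop : Tendsto (fun n : ℕ => ((q : ℂ) ^ n)⁻¹) atTop (𝓝 0) := by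
  simp only [← inv_pow]
  refine tendsto_pow_atTop_nhds_zero_of_norm_lt_one ?_
  rw [norm_inv]
  exact inv_lt_one_of_one_lt₀ hq

theorem tendsto_zpow_norm_atTop : Tendsto (fun k : ℤ => ‖(q : ℂ)‖ ^ k) atTop atTop := by
  refine tendsto_atTop.2 fun b => ?_
  obtain ⟨n, hn⟩ := pow_unbounded_of_one_lt b hq
  filter_upwards [eventually_ge_atTop (n : ℤ)] with k hk
  exact hn.le.trans (by rw [← zpow_natCast]; exact zpow_le_zpow_right₀ hq.le hk)

/-- The points λ q^n tend to infinity, so |1 - z/ξ| comes arbitrarily close to 1 along the spiral.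
Consequently d_q(z,Λ) decreases as Λ grows, and sectors shrink. -/
theorem distSpiral_le_one (z : ℂ) (x : Torus q) : distSpiral z x ≤ 1 := by
  have h : Tendsto (fun n : ℕ => ‖1 - z / (base x * q ^ n : ℂˣ)‖) atTop (𝓝 1) := by
    have := (((tendsto_pow_inv_atTop hq).const_mul (z / base x)).const_sub 1).norm
    simp only [mul_zero, sub_zero, norm_one] at this
    refine this.congr fun n => ?_
    push_cast
    congr 2
    field_simp
  refine ge_of_tendsto h (.of_forall fun n => distSpiral_le z ?_)
  conv_rhs => rw [← coe_base x]
  exact (torus_coe_eq_iff.2 ⟨n, by simp⟩).symm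

theorem distDiv_le_one (z : ℂ) (Λ : Divisor q) : distDiv z Λ ≤ 1 :=
  Finset.prod_le_one (fun _ _ => pow_nonneg (distSpiral_nonneg _ _) _)
    fun _ _ => pow_le_one₀ (distSpiral_nonneg _ _) (distSpiral_le_one hq _ _)

theorem sector_add_subset_left (Λ Λ' : Divisor q) (ε : ℝ) : sector (Λ + Λ') ε ⊆ sector Λ ε := by
  refine fun z hz => ⟨hz.1, hz.2.trans_le ?_⟩
  rw [distDiv_add]
  exact mul_le_of_le_one_right (distDiv_nonneg _ _) (distDiv_le_one hq _ _)

theorem sector_add_subset_right (Λ Λ' : Divisor q) (ε : ℝ) : sector (Λ + Λ') ε ⊆ sector Λ' ε := by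
  rw [add_comm]
  exact sector_add_subset_left hq _ _ _

theorem lt_distSpiral_of_mem_sector {Λ : Divisor q} {ε : ℝ} {z : ℂ} (hz : z ∈ sector Λ ε)
    {x : Torus q} (hx : x ∈ Λ.support) : ε < distSpiral z x := by
  refine hz.2.trans_le ?_
  rw [distDiv, Finsupp.prod, ← Finset.mul_prod_erase _ _ hx]
  refine (mul_le_of_le_one_right (pow_nonneg (distSpiral_nonneg _ _) _) ?_).trans
    (pow_le_of_le_one (distSpiral_nonneg _ _) (distSpiral_le_one hq _ _)
      (Finsupp.mem_support_iff.1 hx))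
  exact Finset.prod_le_one (fun _ _ => pow_nonneg (distSpiral_nonneg _ _) _)
    fun _ _ => pow_le_one₀ (distSpiral_nonneg _ _) (distSpiral_le_one hq _ _)

/-- The ratio z/(λ q^k) is large as k → -∞ and small as k → ∞, so |1 - z/(λ q^k)| ≥ 1/2 for all but
finitely many k. An infimum equal to 0 is then attained. -/
theorem coe_eq_of_distSpiral_eq_zero {z : ℂˣ} {x : Torus q} (h : distSpiral (z : ℂ) x = 0) :
    (z : Torus q) = x := by
  by_contra hne
  have hne' (k : ℤ) : 0 < ‖1 - (z : ℂ) / (base x * q ^ k : ℂˣ)‖ := by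
    rw [norm_pos_iff, sub_ne_zero]
    intro h1
    rw [← Units.val_div_eq_div_val, eq_comm, Units.val_eq_one, div_eq_one] at h1
    exact hne (by rw [← coe_base x]; exact (torus_coe_eq_iff.2 ⟨k, h1⟩).symm)
  have hrw (k : ℤ) : (z : ℂ) / (base x * q ^ k : ℂˣ) = z / base x * ((q : ℂ) ^ k)⁻¹ := by
    push_cast
    field_simp
  have hz : 0 < ‖(z : ℂ) / base x‖ := by
    rw [← Units.val_div_eq_div_val]; exact norm_pos_iff.2 (Units.ne_zero _)
  have hev : ∀ᶠ k : ℤ in cofinite, 1 / 2 ≤ ‖1 - (z : ℂ) / (base x * q ^ k : ℂˣ)‖ := by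
    rw [Int.cofinite_eq, eventually_sup]
    constructor
    · have h1 : Tendsto (fun k : ℤ => ‖(z : ℂ) / base x‖ * ‖(q : ℂ)‖ ^ (-k)) atBot atTop :=
        ((tendsto_zpow_norm_atTop hq).comp tendsto_neg_atBot_atTop).const_mul_atTop hz
      filter_upwards [h1.eventually_ge_atTop 2] with k hk
      rw [hrw, norm_sub_rev]
      refine le_trans ?_ (norm_sub_norm_le _ _)
      rw [norm_mul, norm_inv, norm_zpow, ← zpow_neg, norm_one]
      linarith
    · have h1 : Tendsto (fun k : ℤ => ‖(z : ℂ) / base x‖ * (‖(q : ℂ)‖ ^ k)⁻¹) atTop (𝓝 0) := by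
        simpa using (tendsto_inv_atTop_zero.comp (tendsto_zpow_norm_atTop hq)).const_mul
          ‖(z : ℂ) / base x‖
      filter_upwards [h1.eventually_le_const (show (0 : ℝ) < 1 / 2 by norm_num)] with k hk
      rw [hrw]
      refine le_trans ?_ (norm_sub_norm_le _ _)
      rw [norm_mul, norm_inv, norm_zpow, norm_one]
      linarith
  have hfin := hev
  rw [eventually_cofinite] at hfin
  obtain ⟨δ, hδ, hle⟩ : ∃ δ > 0, ∀ k ∈ hfin.toFinset,
      δ ≤ ‖1 - (z : ℂ) / (base x * q ^ k : ℂˣ)‖ := by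
    rcases hfin.toFinset.eq_empty_or_nonempty with he | he
    · exact ⟨1, one_pos, fun k hk => absurd hk (by rw [he]; exact Finset.notMem_empty k)⟩
    · obtain ⟨k0, _, hk⟩ := Finset.exists_min_image hfin.toFinset
        (fun k : ℤ => ‖1 - (z : ℂ) / (base x * q ^ k : ℂˣ)‖) he
      exact ⟨_, hne' k0, hk⟩
  have : Nonempty {ξ : ℂˣ // (ξ : Torus q) = x} := ⟨⟨base x, coe_base x⟩⟩
  have hlb : min δ (1 / 2) ≤ distSpiral (z : ℂ) x := by
    refine le_ciInf fun ⟨ξ, hξ⟩ => ?_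
    rw [← coe_base x, eq_comm, torus_coe_eq_iff] at hξ
    obtain ⟨k, rfl⟩ := hξ
    by_cases hk : k ∈ hfin.toFinset
    · exact (min_le_left _ _).trans (hle k hk)
    · simp only [Set.Finite.mem_toFinset, Set.mem_ofPred_eq, not_not] at hk
      exact (min_le_right _ _).trans hk
  rw [h] at hlb
  exact absurd hlb (not_le.2 (lt_min hδ (by norm_num)))

/-- Countability makes the sector dense, which allows identities between continuous functions to be
extended across the spirals. -/
theorem countable_compl_sector (Λ : Divisor q) : (sector Λ 0)ᶜ.Countable := by
  have h : (sector Λ 0)ᶜ ⊆ {0} ∪ ⋃ x ∈ Λ.support,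
      Set.range fun k : ℤ => ((base x * q ^ k : ℂˣ) : ℂ) := by
    intro z hz
    by_cases h0 : z = 0
    · exact Or.inl h0
    right
    have h1 : distDiv z Λ = 0 :=
      le_antisymm (not_lt.1 fun h => hz ⟨h0, h⟩) (distDiv_nonneg _ _)
    rw [distDiv, Finsupp.prod, Finset.prod_eq_zero_iff] at h1
    obtain ⟨x, hx, hx0⟩ := h1
    have h2 : ((Units.mk0 z h0 : ℂˣ) : Torus q) = x :=
      coe_eq_of_distSpiral_eq_zero hq (eq_zero_of_pow_eq_zero hx0)
    rw [← coe_base x, eq_comm, torus_coe_eq_iff] at h2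
    obtain ⟨k, hk⟩ := h2
    exact Set.mem_biUnion hx ⟨k, (congrArg Units.val hk).symm⟩
  refine Set.Countable.mono h ((Set.countable_singleton 0).union ?_)
  exact Λ.support.countable_toSet.biUnion fun x _ => Set.countable_range _

/-- A function continuous on the complement of the spirals is bounded on compact annuli away from
the spirals. -/
theorem exists_bound_on_annulus {V : Type*} [NormedAddCommGroup V] {Λ : Divisor q} {f : ℂ → V}
    (hf : ContinuousOn f (sector Λ 0)) {ε : ℝ} (hε : 0 < ε) {a : ℝ} (ha : 0 < a) (b : ℝ) :
    ∃ C : ℝ, ∀ z ∈ sector Λ ε, a ≤ ‖z‖ → ‖z‖ ≤ b → ‖f z‖ ≤ C := by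
  -- The bound is imposed for each ξ separately, so that closedness requires no continuity of the
  -- infimum in z.
  let s : Set ℂ := (Metric.closedBall 0 b ∩ {z | a ≤ ‖z‖}) ∩
    ⋂ x ∈ Λ.support, ⋂ ξ : {ξ : ℂˣ // (ξ : Torus q) = x}, {z | ε ≤ ‖1 - z / (ξ : ℂˣ)‖}
  have hs : IsCompact s := by
    refine ((isCompact_closedBall 0 b).inter_right
      (isClosed_le continuous_const continuous_norm)).inter_right ?_
    refine isClosed_biInter fun x _ => isClosed_iInter fun ξ => ?_
    exact isClosed_le continuous_const (by fun_prop)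
  have hsub : s ⊆ sector Λ 0 := by
    rintro z ⟨⟨-, hz⟩, hx⟩
    refine ⟨norm_pos_iff.1 (ha.trans_le hz), Finset.prod_pos fun x hxs => pow_pos ?_ _⟩
    have : Nonempty {ξ : ℂˣ // (ξ : Torus q) = x} := ⟨⟨base x, coe_base x⟩⟩
    simp only [Set.mem_iInter] at hx
    exact hε.trans_le (le_ciInf fun ξ => hx x hxs ξ)
  obtain ⟨C, hC⟩ := hs.exists_bound_of_continuousOn (hf.mono hsub)
  refine ⟨C, fun z hz h1 h2 => hC z ⟨⟨mem_closedBall_zero_iff.2 h2, h1⟩, ?_⟩⟩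
  simp only [Set.mem_iInter]
  exact fun x hx ξ => (lt_distSpiral_of_mem_sector hq hz hx).le.trans (distSpiral_le z ξ.2)

end

end Sectors

/-! ### Theta functions of divisors -/

section ThetaDivisor

variable {q : ℂˣ}

theorem degree_add (Λ Λ' : Divisor q) : degree (Λ + Λ') = degree Λ + degree Λ' :=
  Finsupp.sum_add_index' (fun _ => rfl) fun _ _ _ => rfl

theorem degree_zero : degree (0 : Divisor q) = 0 := Finsupp.sum_zero_index

theorem thetaDiv_add (Λ Λ' : Divisor q) (z : ℂ) :
    thetaDiv (Λ + Λ') z = thetaDiv Λ z * thetaDiv Λ' z :=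
  Finsupp.prod_add_index' (fun _ => pow_zero _) fun _ _ _ => pow_add _ _ _

theorem thetaDiv_zero (z : ℂ) : thetaDiv (0 : Divisor q) z = 1 := Finsupp.prod_zero_index

/-- The constant `κ` in `θ_Λ(qz) = κ z^{|Λ|} θ_Λ(z)`. -/
def thetaMultiplier (Λ : Divisor q) : ℂˣ := Λ.prod fun x ν => (-q * (base x)⁻¹) ^ ν

/-- The inverse multiplier is ∏ (-λ_i/q)^{ν_i}, which differs from (-1)^{|Λ|} ∏ λ_i^{ν_i} by
q^{-|Λ|}. This turns the genericity condition into one on the operator S. -/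
theorem weight_eq (Λ : Divisor q) : weight Λ = (((thetaMultiplier Λ)⁻¹ : ℂˣ) : Torus q) := by
  have h1 : (Λ.prod fun x ν => x ^ ν) =
      ((Λ.prod fun x ν => base x ^ ν : ℂˣ) : Torus q) := by
    rw [Finsupp.prod, Finsupp.prod, ← QuotientGroup.mk'_apply, map_prod]
    refine Finset.prod_congr rfl fun x _ => ?_
    rw [map_pow, QuotientGroup.mk'_apply, coe_base]
  rw [weight, h1, ← QuotientGroup.mk_pow, ← QuotientGroup.mk_mul]
  refine torus_coe_eq_iff.2 ⟨-degree Λ, ?_⟩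
  rw [zpow_neg, zpow_natCast, degree, thetaMultiplier, Finsupp.sum, Finsupp.prod, Finsupp.prod,
    ← Finset.prod_pow_eq_pow_sum, ← Finset.prod_pow_eq_pow_sum, ← Finset.prod_mul_distrib,
    ← Finset.prod_inv_distrib, ← Finset.prod_inv_distrib, ← Finset.prod_mul_distrib]
  refine Finset.prod_congr rfl fun x _ => ?_
  rw [← inv_pow, ← inv_pow, ← mul_pow, ← mul_pow]
  congr 1
  refine Units.ext ?_
  push_cast
  field_simp

variable (hq : 1 < ‖(q : ℂ)‖)
include hq

theorem thetaDiv_mul (Λ : Divisor q) {z : ℂ} (hz : z ≠ 0) :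
    thetaDiv Λ ((q : ℂ) * z) = thetaMultiplier Λ * z ^ degree Λ * thetaDiv Λ z := by
  rw [thetaDiv, thetaDiv, thetaMultiplier, degree, Finsupp.prod, Finsupp.prod, Finsupp.prod,
    Finsupp.sum, ← Finset.prod_pow_eq_pow_sum, Units.coe_prod, ← Finset.prod_mul_distrib,
    ← Finset.prod_mul_distrib]
  refine Finset.prod_congr rfl fun x _ => ?_
  have h : -((q : ℂ) * z) / base x = q * (-z / base x) := by ring
  rw [h, theta_mul hq (div_ne_zero (neg_ne_zero.2 hz) (Units.ne_zero _))]
  push_cast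
  rw [← mul_pow, ← mul_pow]
  congr 1
  ring

theorem thetaDiv_ne_zero {Λ : Divisor q} {z : ℂ} (hz : z ∈ sector Λ 0) : thetaDiv Λ z ≠ 0 := by
  refine Finset.prod_ne_zero_iff.2 fun x hx => pow_ne_zero _ ?_
  refine theta_ne_zero hq (div_ne_zero (neg_ne_zero.2 hz.1) (Units.ne_zero _)) fun n hn => ?_
  refine coe_ne_of_mem_sector (z := Units.mk0 z hz.1) hz hx ?_
  rw [← coe_base x, eq_comm]
  refine torus_coe_eq_iff.2 ⟨n, Units.ext ?_⟩
  have h0 : (base x : ℂ) ≠ 0 := Units.ne_zero _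
  rw [div_eq_iff h0] at hn
  push_cast
  rw [Units.val_mk0]
  linear_combination -hn

theorem differentiableOn_thetaDiv (Λ : Divisor q) : DifferentiableOn ℂ (thetaDiv Λ) {0}ᶜ := by
  have h : thetaDiv Λ = fun z => ∏ x ∈ Λ.support, theta (q : ℂ) (-z / base x) ^ Λ x := rfl
  rw [h]
  refine DifferentiableOn.fun_finsetProd fun x _ => DifferentiableOn.fun_pow ?_ _
  refine (differentiableOn_theta hq).comp (by fun_prop) fun z hz => ?_
  exact div_ne_zero (neg_ne_zero.2 hz) (Units.ne_zero _)

/-- The factor θ(-z/λ) vanishes at λ q^{-n} and occurs with exponent Λ x, so θ_Λ has at least that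
order of vanishing there. -/
theorem iteratedDeriv_thetaDiv_eq_zero (Λ : Divisor q) (x : Torus q) {j : ℕ} (hj : j < Λ x)
    (n : ℕ) : iteratedDeriv j (thetaDiv Λ) ((base x : ℂ) / (q : ℂ) ^ n) = 0 := by
  set p : ℂ := (base x : ℂ) / (q : ℂ) ^ n with hp
  have hp0 : p ≠ 0 := div_ne_zero (Units.ne_zero _) (pow_ne_zero _ q.ne_zero)
  have hopen : IsOpen ({0}ᶜ : Set ℂ) := isOpen_compl_singleton
  have han : AnalyticAt ℂ (thetaDiv Λ) p :=
    (differentiableOn_thetaDiv hq Λ).analyticAt (hopen.mem_nhds hp0)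
  refine (natCast_le_analyticOrderAt_iff_iteratedDeriv_eq_zero han).1 ?_ j hj
  have hsplit : thetaDiv Λ = (fun z => theta (q : ℂ) (-z / base x)) ^ (Λ x) *
      thetaDiv (Λ.erase x) := by
    funext z
    have hx : x ∈ Λ.support := Finsupp.mem_support_iff.2 (by omega)
    exact (Finsupp.mul_prod_erase Λ x (fun x ν => theta (q : ℂ) (-z / (base x : ℂ)) ^ ν) hx).symm
  have h1 : AnalyticAt ℂ (fun z => theta (q : ℂ) (-z / base x)) p := by
    refine DifferentiableOn.analyticAt (s := {0}ᶜ) ?_ (hopen.mem_nhds hp0)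
    refine (differentiableOn_theta hq).comp (by fun_prop) fun z hz => ?_
    exact div_ne_zero (neg_ne_zero.2 hz) (Units.ne_zero _)
  have h2 : AnalyticAt ℂ (thetaDiv (Λ.erase x)) p :=
    (differentiableOn_thetaDiv hq _).analyticAt (hopen.mem_nhds hp0)
  rw [hsplit, analyticOrderAt_mul (h1.pow _) h2, analyticOrderAt_pow h1]
  refine le_add_right ?_
  have h3 : (1 : ℕ∞) ≤ analyticOrderAt (fun z => theta (q : ℂ) (-z / base x)) p := by
    rw [Order.one_le_iff_ne_zero, h1.analyticOrderAt_ne_zero]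
    have : -p / (base x : ℂ) = -((q : ℂ) ^ n)⁻¹ := by
      rw [hp]; field_simp
    rw [this, theta_neg_inv_pow hq]
  calc ((Λ x : ℕ) : ℕ∞) = (Λ x) • (1 : ℕ∞) := by simp
    _ ≤ _ := nsmul_le_nsmul_right h3 _

end ThetaDivisor

/-! ### Uniform `q`-Gevrey estimates -/

section Gevrey

variable {ι V V' : Type*} [NormedAddCommGroup V] [NormedSpace ℂ V]
  [NormedAddCommGroup V'] [NormedSpace ℂ V']

/-- A family of sequences is uniformly `q`-Gevrey of order `s`. -/
def IsGevreyFamily (q : ℂˣ) (s : ℝ) (a : ι → ℕ → V) : Prop :=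
  ∃ C > 0, ∃ A > 0, ∀ i n, ‖a i n‖ ≤ C * A ^ n * ‖(q : ℂ)‖ ^ (s * (n : ℝ) ^ 2 / 2)

/-- The values of `F` on `q^{-n} W` are uniformly `q`-Gevrey, for all compact `W ⊆ ℂ^*`. -/
def IsGevreyOnCompacts (q : ℂˣ) (s : ℝ) (F : ℂ → V) : Prop :=
  ∀ W : Set ℂ, IsCompact W → (0 : ℂ) ∉ W →
    IsGevreyFamily q s fun (z : W) (n : ℕ) => F ((z : ℂ) / (q : ℂ) ^ n)

variable {q : ℂˣ} {s t : ℝ}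

omit [NormedSpace ℂ V] in
theorem isGevreyFamily_zero : IsGevreyFamily q s fun (_ : ι) (_ : ℕ) => (0 : V) :=
  ⟨1, one_pos, 1, one_pos, fun i n => by
    rw [norm_zero, one_pow]; have := norm_nonneg (q : ℂ); positivity⟩

omit [NormedSpace ℂ V] in
theorem IsGevreyFamily.add {a b : ι → ℕ → V} (ha : IsGevreyFamily q s a)
    (hb : IsGevreyFamily q s b) : IsGevreyFamily q s fun i n => a i n + b i n := by
  obtain ⟨C, hC, A, hA, h⟩ := ha
  obtain ⟨C', hC', A', hA', h'⟩ := hb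
  refine ⟨C + C', by positivity, max A A', by positivity, fun i n => ?_⟩
  have hQ : 0 ≤ ‖(q : ℂ)‖ ^ (s * (n : ℝ) ^ 2 / 2) := Real.rpow_nonneg (norm_nonneg _) _
  calc ‖a i n + b i n‖ ≤ ‖a i n‖ + ‖b i n‖ := norm_add_le _ _
    _ ≤ C * A ^ n * ‖(q : ℂ)‖ ^ (s * (n : ℝ) ^ 2 / 2)
        + C' * A' ^ n * ‖(q : ℂ)‖ ^ (s * (n : ℝ) ^ 2 / 2) := add_le_add (h i n) (h' i n)
    _ ≤ C * max A A' ^ n * ‖(q : ℂ)‖ ^ (s * (n : ℝ) ^ 2 / 2)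
        + C' * max A A' ^ n * ‖(q : ℂ)‖ ^ (s * (n : ℝ) ^ 2 / 2) := by
      gcongr
      · exact le_max_left _ _
      · exact le_max_right _ _
    _ = _ := by ring

omit [NormedSpace ℂ V] in
theorem IsGevreyFamily.sum {κ : Type*} (u : Finset κ) {a : κ → ι → ℕ → V}
    (ha : ∀ k ∈ u, IsGevreyFamily q s (a k)) :
    IsGevreyFamily q s fun i n => ∑ k ∈ u, a k i n := by
  classical
  induction u using Finset.induction_on with
  | empty => simpa using isGevreyFamily_zero
  | insert k u hk ih =>
    simp only [Finset.sum_insert hk]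
    exact (ha k (Finset.mem_insert_self _ _)).add
      (ih fun l hl => ha l (Finset.mem_insert_of_mem hl))

omit [NormedSpace ℂ V] [NormedSpace ℂ V'] in
theorem IsGevreyFamily.of_le {a : ι → ℕ → V} {b : ι → ℕ → V'} (ha : IsGevreyFamily q s a)
    {D : ℝ} (hD : 0 < D) (h : ∀ i n, ‖b i n‖ ≤ D * ‖a i n‖) : IsGevreyFamily q s b := by
  obtain ⟨C, hC, A, hA, h'⟩ := ha
  refine ⟨D * C, by positivity, A, hA, fun i n => (h i n).trans ?_⟩
  calc D * ‖a i n‖ ≤ D * (C * A ^ n * ‖(q : ℂ)‖ ^ (s * (n : ℝ) ^ 2 / 2)) := by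
        gcongr; exact h' i n
    _ = _ := by ring

theorem IsGevreyFamily.clm {a : ι → ℕ → V} (ha : IsGevreyFamily q s a) (T : V →L[ℂ] V') :
    IsGevreyFamily q s fun i n => T (a i n) := by
  refine ha.of_le (D := ‖T‖ + 1) (by positivity) fun i n => (T.le_opNorm _).trans ?_
  gcongr
  linarith

section

variable (hq : 1 < ‖(q : ℂ)‖)
include hq

theorem IsGevreyFamily.smul {g : ι → ℕ → ℂ} {a : ι → ℕ → V} (hg : IsGevreyFamily q s g)
    (ha : IsGevreyFamily q t a) : IsGevreyFamily q (s + t) fun i n => g i n • a i n := by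
  obtain ⟨C, hC, A, hA, h⟩ := hg
  obtain ⟨C', hC', A', hA', h'⟩ := ha
  have hq0 : 0 < ‖(q : ℂ)‖ := zero_lt_one.trans hq
  refine ⟨C * C', by positivity, A * A', by positivity, fun i n => ?_⟩
  rw [norm_smul]
  refine (mul_le_mul (h i n) (h' i n) (norm_nonneg _) (by positivity)).trans (le_of_eq ?_)
  rw [add_mul, add_div, Real.rpow_add hq0, mul_pow]
  ring

/-- Solutions of a linear recursion with `q`-Gevrey right hand side are `q`-Gevrey. -/
theorem IsGevreyFamily.of_recursion (hs : 0 ≤ s) {a b : ι → ℕ → V} (hb : IsGevreyFamily q s b)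
    (T : V →L[ℂ] V) {C₀ : ℝ} (h0 : ∀ i, ‖a i 0‖ ≤ C₀)
    (h : ∀ i n, a i (n + 1) = T (a i n) - b i (n + 1)) : IsGevreyFamily q s a := by
  obtain ⟨C, hC, A, hA, hb⟩ := hb
  -- With M = max C C₀ and rate ‖T‖ + A, the two terms of the recursion are at most ‖T‖ M (‖T‖ +
  -- A)^n and M (‖T‖ + A)^n A times the power of |q| at n + 1, and they add up to the next bound.
  -- Here s ≥ 0 is needed for that power to increase with n.
  refine ⟨max C C₀, lt_max_of_lt_left hC, ‖T‖ + A, by positivity, fun i n => ?_⟩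
  induction n with
  | zero => simpa using Or.inr (h0 i)
  | succ n ih =>
    have hmono : ‖(q : ℂ)‖ ^ (s * (n : ℝ) ^ 2 / 2) ≤ ‖(q : ℂ)‖ ^ (s * ((n + 1 : ℕ) : ℝ) ^ 2 / 2) := by
      refine Real.rpow_le_rpow_of_exponent_le hq.le ?_
      push_cast
      gcongr
      linarith
    set X := ‖(q : ℂ)‖ ^ (s * (n : ℝ) ^ 2 / 2) with hX
    set Y := ‖(q : ℂ)‖ ^ (s * ((n + 1 : ℕ) : ℝ) ^ 2 / 2) with hY
    have hX0 : 0 ≤ X := Real.rpow_nonneg (norm_nonneg _) _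
    have hY0 : 0 ≤ Y := hX0.trans hmono
    rw [h]
    calc ‖T (a i n) - b i (n + 1)‖ ≤ ‖T‖ * ‖a i n‖ + ‖b i (n + 1)‖ :=
          (norm_sub_le _ _).trans (add_le_add (T.le_opNorm _) le_rfl)
      _ ≤ ‖T‖ * (max C C₀ * (‖T‖ + A) ^ n * Y) + max C C₀ * ((‖T‖ + A) ^ n * A) * Y := by
        gcongr
        · exact ih.trans (by gcongr)
        · refine (hb i (n + 1)).trans ?_
          rw [pow_succ]
          gcongr
          · exact le_max_left _ _
          · linarith [norm_nonneg T]
      _ = _ := by rw [pow_succ]; ring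

end

theorem IsGevreyOnCompacts.clm {F : ℂ → V} (hF : IsGevreyOnCompacts q s F) (T : V →L[ℂ] V') :
    IsGevreyOnCompacts q s fun z => T (F z) := fun W hW h0 => (hF W hW h0).clm T

omit [NormedSpace ℂ V] in
theorem IsGevreyOnCompacts.add {F G : ℂ → V} (hF : IsGevreyOnCompacts q s F)
    (hG : IsGevreyOnCompacts q s G) : IsGevreyOnCompacts q s fun z => F z + G z :=
  fun W hW h0 => (hF W hW h0).add (hG W hW h0)

/-! ### Derivatives on the punctured plane -/

section Derivatives

variable [CompleteSpace V]

theorem contDiffAt_of_differentiableOn_compl {F : ℂ → V} (hF : DifferentiableOn ℂ F {0}ᶜ) {z : ℂ}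
    (hz : z ≠ 0) (n : WithTop ℕ∞) : ContDiffAt ℂ n F z :=
  (hF.contDiffOn isOpen_compl_singleton).contDiffAt (isOpen_compl_singleton.mem_nhds hz)

theorem iteratedDeriv_smul_eq {g : ℂ → ℂ} {F : ℂ → V} (hg : DifferentiableOn ℂ g {0}ᶜ)
    (hF : DifferentiableOn ℂ F {0}ᶜ) {z : ℂ} (hz : z ≠ 0) (n : ℕ) :
    iteratedDeriv n (fun z => g z • F z) z = ∑ i ∈ Finset.range (n + 1),
      n.choose i • iteratedDeriv i g z • iteratedDeriv (n - i) F z := by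
  simpa using! iteratedDerivWithin_smul (Set.mem_univ z) uniqueDiffOn_univ
    (contDiffAt_of_differentiableOn_compl hg hz n).contDiffWithinAt
    (contDiffAt_of_differentiableOn_compl hF hz n).contDiffWithinAt

theorem iteratedDeriv_clm_comp {F : ℂ → V} (hF : DifferentiableOn ℂ F {0}ᶜ) (T : V →L[ℂ] V')
    {z : ℂ} (hz : z ≠ 0) (n : ℕ) :
    iteratedDeriv n (fun z => T (F z)) z = T (iteratedDeriv n F z) := by
  rw [iteratedDeriv_eq_iteratedFDeriv, iteratedDeriv_eq_iteratedFDeriv]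
  have := T.iteratedFDeriv_comp_left (contDiffAt_of_differentiableOn_compl hF hz n) le_rfl
  rw [Function.comp_def] at this
  rw [this]
  rfl

theorem iteratedDeriv_dilation {F : ℂ → V} (hF : DifferentiableOn ℂ F {0}ᶜ) {c : ℂ} (hc : c ≠ 0)
    {z : ℂ} (hz : z ≠ 0) (n : ℕ) :
    iteratedDeriv n (fun z => F (c * z)) z = c ^ n • iteratedDeriv n F (c * z) := by
  have hopen : IsOpen ({0}ᶜ : Set ℂ) := isOpen_compl_singleton
  have h := iteratedDerivWithin_comp_const_smul (s := {0}ᶜ) (n := n) (x := z) hz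
    hopen.uniqueDiffOn (hF.contDiffOn hopen) c fun w hw => mul_ne_zero hc hw
  rwa [iteratedDerivWithin_of_isOpen hopen hz,
    iteratedDerivWithin_of_isOpen hopen (show c * z ∈ ({0}ᶜ : Set ℂ) from mul_ne_zero hc hz)] at h

/-- Cauchy's estimates for functions that are `q`-Gevrey on compacts. -/
theorem IsGevreyOnCompacts.iteratedDeriv {F : ℂ → V} (hF : DifferentiableOn ℂ F {0}ᶜ)
    (h : IsGevreyOnCompacts q s F) {w : ℂ} (hw : w ≠ 0) (j : ℕ) :
    IsGevreyFamily q s fun (_ : Unit) (n : ℕ) => iteratedDeriv j F (w / (q : ℂ) ^ n) := by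
  have hw' : 0 < ‖w‖ := norm_pos_iff.2 hw
  obtain ⟨C, hC, A, hA, h⟩ := h (Metric.sphere w (‖w‖ / 2)) (isCompact_sphere _ _) (by
    rw [mem_sphere_iff_norm, zero_sub, norm_neg]; linarith)
  have hq0 : 0 < ‖(q : ℂ)‖ := norm_pos_iff.2 q.ne_zero
  -- The circle of radius |w|/2 about w, scaled by q^{-n}, has radius |w|/(2|q|^n). Cauchy's
  -- estimate thus costs |q|^{jn}, a geometric factor absorbed into A.
  refine ⟨j.factorial * C / (‖w‖ / 2) ^ j, by positivity, A * ‖(q : ℂ)‖ ^ j, by positivity,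
    fun _ n => ?_⟩
  have hqn : 0 < ‖(q : ℂ)‖ ^ n := by positivity
  have hR : 0 < ‖w‖ / 2 / ‖(q : ℂ)‖ ^ n := by positivity
  have hcl : closure (Metric.ball (w / (q : ℂ) ^ n) (‖w‖ / 2 / ‖(q : ℂ)‖ ^ n)) ⊆ {0}ᶜ := by
    refine Metric.closure_ball_subset_closedBall.trans fun z hz h0 => ?_
    rw [Set.mem_singleton_iff] at h0
    rw [h0, mem_closedBall_iff_norm, zero_sub, norm_neg, norm_div, norm_pow,
      div_le_div_iff_of_pos_right hqn] at hz
    linarith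
  refine (Complex.norm_iteratedDeriv_le_of_forall_mem_sphere_norm_le
    (C := C * A ^ n * ‖(q : ℂ)‖ ^ (s * (n : ℝ) ^ 2 / 2)) j hR
    (hF.mono hcl).diffContOnCl fun z hz => ?_).trans (le_of_eq ?_)
  · have hz' : (q : ℂ) ^ n * z ∈ Metric.sphere w (‖w‖ / 2) := by
      rw [mem_sphere_iff_norm] at hz ⊢
      have : (q : ℂ) ^ n * z - w = (q : ℂ) ^ n * (z - w / (q : ℂ) ^ n) := by
        have := pow_ne_zero n q.ne_zero
        field_simp
      rw [this, norm_mul, hz, norm_pow]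
      field_simp
    have h1 := h ⟨_, hz'⟩ n
    have h2 : (q : ℂ) ^ n * z / (q : ℂ) ^ n = z := mul_div_cancel_left₀ _ (pow_ne_zero n q.ne_zero)
    simpa only [h2] using h1
  · rw [div_pow _ (‖(q : ℂ)‖ ^ n), mul_pow, ← pow_mul, ← pow_mul, mul_comm n j]
    field_simp

end Derivatives

end Gevrey

/-! ### Functions on `ℂ^*` with `q`-Gevrey conditions -/

section GevreySpaces

variable {V V' : Type*} [NormedAddCommGroup V] [NormedSpace ℂ V]
  [NormedAddCommGroup V'] [NormedSpace ℂ V'] {q : ℂˣ}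

/-- Vector valued analytic functions on `ℂ^*` satisfying the conditions that define `EE L`, with
the growth at `0` expressed by uniform `q`-Gevrey estimates. -/
structure IsGevreyAlong (L : List (Divisor q)) (F : ℂ → V) : Prop where
  diff : DifferentiableOn ℂ F {0}ᶜ
  growth : IsGevreyOnCompacts q (degree L.sum) F
  derivs : ∀ i < L.length, ∀ x, ∀ l < (L.drop i).sum x,
    IsGevreyFamily q (degree (L.drop (i + 1)).sum) fun (_ : Unit) (n : ℕ) =>
      iteratedDeriv l F ((base x : ℂ) / (q : ℂ) ^ n)

theorem base_div_pow_ne_zero (x : Torus q) (n : ℕ) : (base x : ℂ) / (q : ℂ) ^ n ≠ 0 :=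
  div_ne_zero (Units.ne_zero _) (pow_ne_zero _ q.ne_zero)

/-! ### Linear operations preserving the q-Gevrey conditions. -/

section Closure

variable [CompleteSpace V] {L : List (Divisor q)}

theorem IsGevreyAlong.clm {F : ℂ → V} (hF : IsGevreyAlong L F) (T : V →L[ℂ] V') :
    IsGevreyAlong L fun z => T (F z) where
  diff := T.differentiable.comp_differentiableOn hF.diff
  growth := hF.growth.clm T
  derivs i hi x l hl := by
    simp only [iteratedDeriv_clm_comp hF.diff T (base_div_pow_ne_zero x _)]
    exact (hF.derivs i hi x l hl).clm T

theorem IsGevreyAlong.add {F G : ℂ → V} (hF : IsGevreyAlong L F) (hG : IsGevreyAlong L G) :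
    IsGevreyAlong L fun z => F z + G z where
  diff := hF.diff.add hG.diff
  growth := hF.growth.add hG.growth
  derivs i hi x l hl := by
    have h (n : ℕ) := iteratedDeriv_fun_add (n := l)
      (contDiffAt_of_differentiableOn_compl hF.diff (base_div_pow_ne_zero x n) l)
      (contDiffAt_of_differentiableOn_compl hG.diff (base_div_pow_ne_zero x n) l)
    simp only [h]
    exact (hF.derivs i hi x l hl).add (hG.derivs i hi x l hl)

omit [CompleteSpace V] in
theorem IsGevreyAlong.zero : IsGevreyAlong L fun _ => (0 : V) where
  diff := differentiableOn_const _
  growth _ _ _ := isGevreyFamily_zero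
  derivs i hi x l hl := by
    have h (z : ℂ) : iteratedDeriv l (fun _ : ℂ => (0 : V)) z = 0 := by
      rw [iteratedDeriv_const]; split_ifs <;> rfl
    simp only [h]
    exact isGevreyFamily_zero

omit [CompleteSpace V] in
theorem IsGevreyAlong.const (v : V) : IsGevreyAlong ([] : List (Divisor q)) fun _ => v where
  diff := differentiableOn_const _
  growth _ _ _ := ⟨‖v‖ + 1, by positivity, 1, one_pos, fun _ _ => by
    simp [degree_zero]⟩
  derivs i hi := absurd hi (Nat.not_lt_zero i)

end Closure

/-! ### Multiplication by monomials and theta functions, and transfer along the q-difference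
equation. -/

section Multipliers

variable (hq : 1 < ‖(q : ℂ)‖)
include hq

/-- Solutions of `g(qz) = κ z^N g(z)` have `q`-Gevrey order `N`. -/
theorem isGevreyOnCompacts_of_mul_eq {g : ℂ → ℂ} (hg : ContinuousOn g {0}ᶜ) {κ : ℂ} (hκ : κ ≠ 0)
    (N : ℕ) (h : ∀ z ≠ 0, g ((q : ℂ) * z) = κ * z ^ N * g z) : IsGevreyOnCompacts q N g := by
  intro W hW h0
  have hsub : W ⊆ {0}ᶜ := fun z hz hz0 => h0 (by rwa [← Set.mem_singleton_iff.1 hz0])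
  obtain ⟨C, hC⟩ := hW.exists_bound_of_continuousOn (hg.mono hsub)
  obtain ⟨B, hB⟩ := hW.exists_bound_of_continuousOn (f := fun z : ℂ => z⁻¹)
    (continuousOn_inv₀.mono hsub)
  have hq0 : 0 < ‖(q : ℂ)‖ := zero_lt_one.trans hq
  -- Going from z q^{-k+1} to z q^{-k} multiplies the modulus by |κ|⁻¹ |z|^{-N} |q|^{kN}. The
  -- product of the |q|^{kN} for k ≤ n is |q|^{Nn²/2} times (|q|^{N/2})^n, whence the last factor of
  -- A.
  set A : ℝ := ‖κ‖⁻¹ * (|B| + 1) ^ N * ‖(q : ℂ)‖ ^ ((N : ℝ) / 2) with hA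
  have hκ' : 0 < ‖κ‖ := norm_pos_iff.2 hκ
  refine ⟨|C| + 1, by positivity, A, by positivity, fun ⟨z, hz⟩ n => ?_⟩
  have hz0 : z ≠ 0 := hsub hz
  induction n with
  | zero =>
    simp only [pow_zero, div_one, mul_one]
    simpa using (hC z hz).trans ((le_abs_self C).trans (by linarith))
  | succ n ih =>
    simp only at ih ⊢
    have hqn : (q : ℂ) ^ n ≠ 0 := pow_ne_zero _ q.ne_zero
    have hz1 : z / (q : ℂ) ^ (n + 1) ≠ 0 := div_ne_zero hz0 (pow_ne_zero _ q.ne_zero)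
    have h1 := h _ hz1
    have h2 : (q : ℂ) * (z / (q : ℂ) ^ (n + 1)) = z / (q : ℂ) ^ n := by
      rw [pow_succ]; field_simp
    rw [h2] at h1
    have h3 : g (z / (q : ℂ) ^ (n + 1)) =
        κ⁻¹ * z⁻¹ ^ N * ((q : ℂ) ^ (n + 1)) ^ N * g (z / (q : ℂ) ^ n) := by
      rw [h1, div_pow, inv_pow]
      field_simp
    have h4 : ‖(q : ℂ)‖ ^ ((N : ℝ) / 2) * ‖(q : ℂ)‖ ^ (N * ((n + 1 : ℕ) : ℝ) ^ 2 / 2) =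
        (‖(q : ℂ)‖ ^ (n + 1)) ^ N * ‖(q : ℂ)‖ ^ (N * (n : ℝ) ^ 2 / 2) := by
      rw [← pow_mul, ← Real.rpow_natCast ‖(q : ℂ)‖ ((n + 1) * N), ← Real.rpow_add hq0, ← Real.rpow_add hq0]
      congr 1
      push_cast
      ring
    rw [h3, norm_mul, norm_mul, norm_mul, norm_inv, norm_pow, norm_pow, norm_pow]
    calc ‖κ‖⁻¹ * ‖z⁻¹‖ ^ N * (‖(q : ℂ)‖ ^ (n + 1)) ^ N * ‖g (z / (q : ℂ) ^ n)‖
        ≤ ‖κ‖⁻¹ * (|B| + 1) ^ N * (‖(q : ℂ)‖ ^ (n + 1)) ^ N *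
          ((|C| + 1) * A ^ n * ‖(q : ℂ)‖ ^ (N * (n : ℝ) ^ 2 / 2)) := by
          gcongr
          exact (hB z hz).trans ((le_abs_self B).trans (by linarith))
      _ = ‖κ‖⁻¹ * (|B| + 1) ^ N * (|C| + 1) * A ^ n *
          ((‖(q : ℂ)‖ ^ (n + 1)) ^ N * ‖(q : ℂ)‖ ^ (N * (n : ℝ) ^ 2 / 2)) := by ring
      _ = (|C| + 1) * (A ^ n * (‖κ‖⁻¹ * (|B| + 1) ^ N * ‖(q : ℂ)‖ ^ ((N : ℝ) / 2))) *
          ‖(q : ℂ)‖ ^ (N * ((n + 1 : ℕ) : ℝ) ^ 2 / 2) := by rw [← h4]; ring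
      _ = _ := by rw [← hA, pow_succ A n]

theorem isGevreyOnCompacts_thetaDiv (D : Divisor q) :
    IsGevreyOnCompacts q (degree D) (thetaDiv D) :=
  isGevreyOnCompacts_of_mul_eq hq (differentiableOn_thetaDiv hq D).continuousOn
    (thetaMultiplier D).ne_zero _ fun _ hz => thetaDiv_mul hq D hz

theorem isGevreyOnCompacts_zpow (k : ℤ) : IsGevreyOnCompacts q (0 : ℕ) fun z : ℂ => z ^ k :=
  isGevreyOnCompacts_of_mul_eq hq (continuousOn_zpow₀ k) (zpow_ne_zero k q.ne_zero) _
    fun z _ => by simp [mul_zpow]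

variable [CompleteSpace V] {L : List (Divisor q)}

/-- In Leibniz' formula the terms with j < D x vanish, and in the others l - j is below the
multiplicity of x in the tail of L. Since l - j may be arbitrarily small, `IsGevreyAlong` asks for
bounds on all derivatives below that multiplicity, without the lower limit present in `GevreyOver`.
-/
theorem over_smul {D : Divisor q} {g : ℂ → ℂ} (hg : DifferentiableOn ℂ g {0}ᶜ)
    (hg1 : IsGevreyOnCompacts q (degree D) g)
    (hg2 : ∀ x, ∀ j < D x, ∀ n : ℕ, iteratedDeriv j g ((base x : ℂ) / (q : ℂ) ^ n) = 0)
    {F : ℂ → V} (hF : IsGevreyAlong L F) {i : ℕ} {x : Torus q} {l : ℕ}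
    (hl : l < (L.drop i).sum x + D x) :
    IsGevreyFamily q (degree D + degree (L.drop (i + 1)).sum : ℕ) fun (_ : Unit) (n : ℕ) =>
      iteratedDeriv l (fun z => g z • F z) ((base x : ℂ) / (q : ℂ) ^ n) := by
  simp only [iteratedDeriv_smul_eq hg hF.diff (base_div_pow_ne_zero x _)]
  refine IsGevreyFamily.sum _ fun j hj => ?_
  have hj : j ≤ l := Nat.lt_succ_iff.1 (Finset.mem_range.1 hj)
  rcases lt_or_ge j (D x) with hjD | hjD
  · simp only [hg2 x j hjD, zero_smul, smul_zero]
    exact isGevreyFamily_zero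
  · have hi : i < L.length := by
      by_contra hi
      rw [List.drop_eq_nil_of_le (not_lt.1 hi)] at hl
      simp at hl
      omega
    have h1 := IsGevreyFamily.smul hq (hg1.iteratedDeriv hg (Units.ne_zero (base x)) j)
      (hF.derivs i hi x (l - j) (by omega))
    push_cast
    refine h1.of_le (D := l.choose j + 1) (by positivity) fun _ n => ?_
    rw [← Nat.cast_smul_eq_nsmul ℂ, norm_smul, Complex.norm_natCast]
    gcongr
    linarith

theorem IsGevreyAlong.zpow_smul {F : ℂ → V} (hF : IsGevreyAlong L F) (k : ℤ) :
    IsGevreyAlong L fun z => z ^ k • F z where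
  diff := DifferentiableOn.smul
    (fun _ hz => (differentiableAt_zpow.2 (Or.inl hz)).differentiableWithinAt) hF.diff
  growth W hW h0 := by
    have := (isGevreyOnCompacts_zpow hq k W hW h0).smul hq (hF.growth W hW h0)
    simpa using this
  derivs i hi x l hl := by
    -- A monomial has order 0 and no prescribed zeros: it is the case of the zero divisor.
    have h := over_smul hq (D := 0) (g := fun z => z ^ k)
      (fun _ hz => (differentiableAt_zpow.2 (Or.inl hz)).differentiableWithinAt)
      (by simpa [degree_zero] using isGevreyOnCompacts_zpow hq k)
      (fun x j hj => absurd hj (Nat.not_lt_zero j)) hF (i := i) (x := x) (l := l) (by simpa using hl)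
    simpa [degree_zero] using h

/-- Appending D raises by |D| the order allowed at the old indices, which is the order of θ_D. The
new last index demands order 0 over D, and there the derivatives vanish because θ_D vanishes to
order D x. -/
theorem IsGevreyAlong.theta_smul {F : ℂ → V} (hF : IsGevreyAlong L F) (D : Divisor q) :
    IsGevreyAlong (L ++ [D]) fun z => thetaDiv D z • F z where
  diff := (differentiableOn_thetaDiv hq D).smul hF.diff
  growth W hW h0 := by
    have := (isGevreyOnCompacts_thetaDiv hq D W hW h0).smul hq (hF.growth W hW h0)
    simpa [degree_add, add_comm] using this
  derivs i hi x l hl := by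
    have hi : i ≤ L.length := by simpa [Nat.lt_succ_iff] using hi
    have hl' : l < (L.drop i).sum x + D x := by
      rwa [List.drop_append_of_le_length hi, List.sum_append, List.sum_singleton,
        Finsupp.add_apply] at hl
    rcases hi.lt_or_eq with hi | hi
    · have h := over_smul hq (differentiableOn_thetaDiv hq D) (isGevreyOnCompacts_thetaDiv hq D)
        (fun x j hj => iteratedDeriv_thetaDiv_eq_zero hq D x hj) hF hl'
      rw [List.drop_append_of_le_length (Nat.succ_le_of_lt hi), List.sum_append,
        List.sum_singleton, degree_add, add_comm]
      exact h
    · have hl2 : l < D x := by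
        rw [hi, List.drop_length] at hl'
        simpa using hl'
      have h (n : ℕ) : iteratedDeriv l (fun z => thetaDiv D z • F z)
          ((base x : ℂ) / (q : ℂ) ^ n) = 0 := by
        rw [iteratedDeriv_smul_eq (differentiableOn_thetaDiv hq D) hF.diff
          (base_div_pow_ne_zero x _)]
        refine Finset.sum_eq_zero fun j hj => ?_
        have hj : j ≤ l := Nat.lt_succ_iff.1 (Finset.mem_range.1 hj)
        rw [iteratedDeriv_thetaDiv_eq_zero hq D x (by omega), zero_smul, smul_zero]
      simp only [h]
      exact isGevreyFamily_zero

theorem IsGevreyAlong.theta_sum_smul {F : ℂ → V} (hF : IsGevreyAlong L F)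
    (L' : List (Divisor q)) : IsGevreyAlong (L ++ L') fun z => thetaDiv L'.sum z • F z := by
  induction L' using List.reverseRecOn with
  | nil => simpa [thetaDiv_zero] using hF
  | append_singleton L' D ih =>
    rw [← List.append_assoc]
    convert ih.theta_smul hq D using 2 with z
    rw [List.sum_append, List.sum_singleton, thetaDiv_add, smul_smul, mul_comm]

/-- Solutions of `T G(qz) - G(z) = K(z)` inherit the `q`-Gevrey conditions of `K`. -/
theorem IsGevreyAlong.of_equation {K G : ℂ → V} (hK : IsGevreyAlong L K)
    (hG : DifferentiableOn ℂ G {0}ᶜ) (T : V →L[ℂ] V)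
    (h : ∀ z ≠ 0, T (G ((q : ℂ) * z)) - G z = K z) : IsGevreyAlong L G where
  diff := hG
  growth W hW h0 := by
    have hsub : W ⊆ {0}ᶜ := fun z hz hz0 => h0 (by rwa [← Set.mem_singleton_iff.1 hz0])
    obtain ⟨C, hC⟩ := hW.exists_bound_of_continuousOn (hG.continuousOn.mono hsub)
    -- The equation at z q^{-n-1} expresses G(z q^{-n-1}) as T G(z q^{-n}) - K(z q^{-n-1}).
    refine (hK.growth W hW h0).of_recursion hq (Nat.cast_nonneg _) T (C₀ := C)
      (fun z => by simpa using hC z z.2) fun z n => ?_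
    have hz1 : (z : ℂ) / (q : ℂ) ^ (n + 1) ≠ 0 :=
      div_ne_zero (hsub z.2) (pow_ne_zero _ q.ne_zero)
    have h2 : (q : ℂ) * (z / (q : ℂ) ^ (n + 1)) = z / (q : ℂ) ^ n := by
      have : (q : ℂ) ^ n ≠ 0 := pow_ne_zero _ q.ne_zero
      rw [pow_succ]; field_simp
    rw [← h _ hz1, h2]
    abel
  derivs i hi x l hl := by
    -- Differentiating G(qz) l times produces q^l, so the recursion for the l-th derivatives is
    -- driven by q^l T.
    refine (hK.derivs i hi x l hl).of_recursion hq (Nat.cast_nonneg _) ((q : ℂ) ^ l • T)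
      (C₀ := ‖iteratedDeriv l G (base x)‖) (fun _ => by simp) fun _ n => ?_
    have hz1 := base_div_pow_ne_zero x (n + 1)
    have h2 : (q : ℂ) * (base x / (q : ℂ) ^ (n + 1)) = base x / (q : ℂ) ^ n := by
      have : (q : ℂ) ^ n ≠ 0 := pow_ne_zero _ q.ne_zero
      rw [pow_succ]; field_simp
    have hdil : DifferentiableOn ℂ (fun z => G ((q : ℂ) * z)) {0}ᶜ :=
      hG.comp (by fun_prop) fun z hz => mul_ne_zero q.ne_zero hz
    have hTd : DifferentiableOn ℂ (fun z => T (G ((q : ℂ) * z))) {0}ᶜ :=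
      T.differentiable.comp_differentiableOn hdil
    have h3 : iteratedDeriv l K (base x / (q : ℂ) ^ (n + 1)) =
        iteratedDeriv l (fun z => T (G ((q : ℂ) * z)) - G z) (base x / (q : ℂ) ^ (n + 1)) :=
      (show Set.EqOn K (fun z => T (G ((q : ℂ) * z)) - G z) {0}ᶜ from
        fun z hz => (h z hz).symm).iteratedDeriv_of_isOpen isOpen_compl_singleton l hz1
    have h4 := iteratedDeriv_fun_sub (n := l)
      (contDiffAt_of_differentiableOn_compl hTd hz1 l)
      (contDiffAt_of_differentiableOn_compl hG hz1 l)
    rw [h3, h4, iteratedDeriv_clm_comp hdil T hz1, iteratedDeriv_dilation hG q.ne_zero hz1, h2,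
      map_smul]
    simp

end Multipliers

/-! ### Comparison with theta functions -/

/-- Iterating the functional equation gives the exact growth of theta along q^{-n}; for p = |q| it
measures e(μ z q^{-n}) from below. -/
theorem theta_div_pow {𝕜 : Type*} [NormedField 𝕜] [CompleteSpace 𝕜] {p : 𝕜} (hp : 1 < ‖p‖)
    {x : 𝕜} (hx : x ≠ 0) (n : ℕ) : theta p (x / p ^ n) * x ^ n = theta p x * p ^ n.choose 2 := by
  have hp0 : p ≠ 0 := norm_pos_iff.1 (zero_lt_one.trans hp)
  induction n with
  | zero => simp
  | succ n ih =>
    have hpn : p ^ n ≠ 0 := pow_ne_zero _ hp0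
    have h2 : p * (x / p ^ (n + 1)) = x / p ^ n := by
      rw [pow_succ]; field_simp
    have h1 := theta_mul hp (div_ne_zero hx (pow_ne_zero (n + 1) hp0))
    rw [h2] at h1
    rw [h1] at ih
    have h3 : p ^ (n + 1).choose 2 = p ^ n.choose 2 * p ^ n := by
      rw [Nat.choose_succ_succ' n 1, Nat.choose_one_right, add_comm, pow_add]
    rw [h3, ← mul_assoc, ← ih, pow_succ x]
    field_simp

theorem IsGevreyOnCompacts.hasExpGrowthAtZero (hq : 1 < ‖(q : ℂ)‖) {k : ℕ} (hk : 1 ≤ k)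
    {F : ℂ → ℂ} (hF : IsGevreyOnCompacts q k F) {Ω : Set ℂ} (hΩ : (0 : ℂ) ∉ Ω) :
    HasExpGrowthAtZero q k Ω F := by
  intro W hW hWΩ
  have h0 : (0 : ℂ) ∉ W := fun h => hΩ (by simpa using hWΩ 0 h 0)
  obtain ⟨C, hC, A, hA, hF⟩ := hF W hW h0
  obtain ⟨b, hb0, hb⟩ : ∃ b > 0, ∀ z ∈ W, ‖z‖ ≤ b := by
    obtain ⟨b, hb⟩ := hW.exists_bound_of_continuousOn continuousOn_id
    exact ⟨|b| + 1, by positivity, fun z hz => (hb z hz).trans ((le_abs_self b).trans (by linarith))⟩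
  obtain ⟨c, hc, hcθ⟩ := exists_le_theta hq
  have hQ0 : 0 < ‖(q : ℂ)‖ := zero_lt_one.trans hq
  set Q := ‖(q : ℂ)‖ with hQ
  set A' := max A 1 with hA'
  have hA'0 : 0 < A' := lt_max_of_lt_left hA
  -- Chosen so that A' μ |z| ≤ Q^{-1/2} on W: the factor (μ|z|)^{-n} in theta then beats A'^n, and
  -- Q^{1/2} makes up for the difference between n(n-1)/2 and n²/2.
  set μ : ℝ := (Q ^ (1 / 2 : ℝ) * b * A')⁻¹ with hμ
  have hμ0 : 0 < μ := by positivity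
  refine ⟨C / c ^ k, by positivity, μ, hμ0, fun z hz n => ?_⟩
  have hz0 : 0 < ‖z‖ := norm_pos_iff.2 fun h => h0 (h ▸ hz)
  have he : expTheta q (μ * (z / (q : ℂ) ^ n)) = theta Q (μ * ‖z‖ / Q ^ n) := by
    rw [expTheta, norm_mul, norm_div, norm_pow, Complex.norm_real, Real.norm_of_nonneg hμ0.le,
      mul_div_assoc]
  have hx0 : 0 < μ * ‖z‖ := by positivity
  have hlow : c * (A' ^ n * Q ^ ((n : ℝ) ^ 2 / 2)) ≤ theta Q (μ * ‖z‖ / Q ^ n) := by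
    have h1 := theta_div_pow (p := Q) (by rwa [Real.norm_of_nonneg hQ0.le]) hx0.ne' n
    rw [eq_comm, ← div_eq_iff (pow_pos hx0 n).ne'] at h1
    rw [← h1, mul_div_assoc]
    refine mul_le_mul (hcθ _ hx0) ?_ (by positivity) (hc.le.trans (hcθ _ hx0))
    rw [le_div_iff₀ (pow_pos hx0 n)]
    have h2 : Q ^ n.choose 2 = Q ^ ((n : ℝ) ^ 2 / 2) * (Q ^ (1 / 2 : ℝ))⁻¹ ^ n := by
      rw [← Real.rpow_neg hQ0.le, ← Real.rpow_natCast Q, ← Real.rpow_natCast (Q ^ _), ← Real.rpow_mul hQ0.le,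
        ← Real.rpow_add hQ0, Nat.cast_choose_two]
      congr 1
      ring
    have h3 : A' * (μ * ‖z‖) ≤ (Q ^ (1 / 2 : ℝ))⁻¹ := by
      calc A' * (μ * ‖z‖) ≤ A' * (μ * b) := by gcongr; exact hb z hz
        _ = (Q ^ (1 / 2 : ℝ))⁻¹ := by rw [hμ]; field_simp
    rw [h2]
    calc A' ^ n * Q ^ ((n : ℝ) ^ 2 / 2) * (μ * ‖z‖) ^ n
        = Q ^ ((n : ℝ) ^ 2 / 2) * (A' * (μ * ‖z‖)) ^ n := by ring
      _ ≤ _ := by gcongr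
  rw [he]
  calc ‖F (z / (q : ℂ) ^ n)‖ ≤ C * A ^ n * Q ^ (k * (n : ℝ) ^ 2 / 2) := hF ⟨z, hz⟩ n
    -- Since A' ≥ 1 and k ≥ 1, replacing A^n by (A'^n)^k only enlarges the bound and makes it a k-th
    -- power.
    _ ≤ C * (A' ^ n) ^ k * Q ^ (k * (n : ℝ) ^ 2 / 2) := by
      gcongr
      refine (pow_le_pow_left₀ hA.le (le_max_left A 1) n).trans ?_
      exact le_self_pow₀ (one_le_pow₀ (le_max_right A 1)) (by omega)
    _ = C / c ^ k * (c * (A' ^ n * Q ^ ((n : ℝ) ^ 2 / 2))) ^ k := by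
      have : Q ^ (k * (n : ℝ) ^ 2 / 2) = (Q ^ ((n : ℝ) ^ 2 / 2)) ^ k := by
        rw [← Real.rpow_natCast (Q ^ _), ← Real.rpow_mul hQ0.le]
        congr 1
        ring
      rw [this, mul_pow c, mul_pow (A' ^ n)]
      field_simp
    _ ≤ _ := by gcongr

theorem IsGevreyAlong.mem_EE (hq : 1 < ‖(q : ℂ)‖) {L : List (Divisor q)} (hL : 1 ≤ degree L.sum)
    {F : ℂ → ℂ} (hF : IsGevreyAlong L F) : F ∈ EE L := by
  refine ⟨⟨1, one_pos, fun z hz => ?_, hF.growth.hasExpGrowthAtZero hq hL (by simp)⟩,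
    fun i hi x j _ hj => ?_⟩
  · exact hF.diff.analyticAt (isOpen_compl_singleton.mem_nhds (norm_pos_iff.1 hz.1))
  · obtain ⟨C, hC, A, hA, h⟩ := hF.derivs i hi x j hj
    exact ⟨C, hC, A, hA, .of_forall fun n => h () n⟩

end GevreySpaces

/-! ### Laurent expansions -/

section Laurent

open Complex

variable {V : Type*} [NormedAddCommGroup V] [NormedSpace ℂ V]

/-- The punctured disk of radius `R`. -/
def puncturedDisk (R : ℝ) : Set ℂ := {z | 0 < ‖z‖ ∧ ‖z‖ < R}

theorem isOpen_puncturedDisk (R : ℝ) : IsOpen (puncturedDisk R) :=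
  (isOpen_lt continuous_const continuous_norm).inter (isOpen_lt continuous_norm continuous_const)

theorem sphere_subset_puncturedDisk {ρ R : ℝ} (hρ : 0 < ρ) (hR : ρ < R) :
    Metric.sphere 0 ρ ⊆ puncturedDisk R := fun z hz => by
  rw [mem_sphere_zero_iff_norm] at hz
  exact ⟨hz ▸ hρ, hz ▸ hR⟩

/-- The Laurent coefficients of `f`, computed on the circle of radius `ρ`. -/
def laurentCoeff (f : ℂ → V) (ρ : ℝ) (n : ℤ) : V :=
  (2 * Real.pi * I : ℂ)⁻¹ • ∮ z in C(0, ρ), (z - 0)⁻¹ • z ^ (-n) • f z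

/-- Coefficients with the growth of those of a Laurent series converging on `puncturedDisk R`. -/
def IsLaurentSeq (R : ℝ) (a : ℤ → V) : Prop :=
  ∀ ρ, 0 < ρ → ρ < R → ∃ M : ℝ, ∀ n, ‖a n‖ ≤ M * ρ ^ (-n)

theorem summable_pow_natAbs {t : ℝ} (h0 : 0 ≤ t) (h1 : t < 1) :
    Summable fun n : ℤ => t ^ n.natAbs :=
  .of_nat_of_neg (by simpa using summable_geometric_of_lt_one h0 h1)
    (by simpa using summable_geometric_of_lt_one h0 h1)

theorem IsLaurentSeq.exists_bound {R : ℝ} {a : ℤ → V} (ha : IsLaurentSeq R a) {r₁ r₂ : ℝ}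
    (h1 : 0 < r₁) (h12 : r₁ ≤ r₂) (h2 : r₂ < R) : ∃ C t : ℝ, 0 ≤ t ∧ t < 1 ∧
      ∀ n : ℤ, ∀ z : ℂ, r₁ ≤ ‖z‖ → ‖z‖ ≤ r₂ → ‖z ^ n • a n‖ ≤ C * t ^ n.natAbs := by
  obtain ⟨ρ₂, hr2, hR⟩ := exists_between h2
  have hr20 : 0 < r₂ := h1.trans_le h12
  have hρ2 : 0 < ρ₂ := hr20.trans hr2
  obtain ⟨M₁, hM₁⟩ := ha (r₁ / 2) (by positivity) (by linarith)
  obtain ⟨M₂, hM₂⟩ := ha ρ₂ hρ2 hR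
  -- Nonnegative powers are compared with the radius ρ₂ > r₂, negative powers with r₁/2; the ratios
  -- are r₂/ρ₂ and at most 1/2.
  refine ⟨max |M₁| |M₂|, max (1 / 2) (r₂ / ρ₂), by positivity,
    max_lt (by norm_num) ((div_lt_one hρ2).2 hr2), fun n z hz1 hz2 => ?_⟩
  have hz : 0 < ‖z‖ := h1.trans_le hz1
  rw [norm_smul, norm_zpow]
  obtain ⟨k, rfl | rfl⟩ := n.eq_nat_or_neg
  · calc ‖z‖ ^ (k : ℤ) * ‖a k‖ ≤ ‖z‖ ^ (k : ℤ) * (|M₂| * ρ₂ ^ (-(k : ℤ))) := by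
          gcongr
          exact (hM₂ k).trans (by gcongr; exact le_abs_self _)
      _ = |M₂| * (‖z‖ / ρ₂) ^ k := by
          rw [zpow_neg, zpow_natCast, zpow_natCast, div_pow]; ring
      _ ≤ max |M₁| |M₂| * (max (1 / 2) (r₂ / ρ₂)) ^ k := by
          gcongr
          · exact le_max_right _ _
          · exact le_max_of_le_right (by gcongr)
      _ = _ := by simp
  · calc ‖z‖ ^ (-(k : ℤ)) * ‖a (-k)‖ ≤ ‖z‖ ^ (-(k : ℤ)) * (|M₁| * (r₁ / 2) ^ (-(-(k : ℤ)))) := by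
          gcongr
          exact (hM₁ _).trans (by gcongr; exact le_abs_self _)
      _ = |M₁| * (r₁ / 2 / ‖z‖) ^ k := by
          rw [neg_neg, zpow_neg, zpow_natCast, zpow_natCast, ← inv_pow, mul_left_comm, ← mul_pow,
            inv_mul_eq_div]
      _ ≤ max |M₁| |M₂| * (max (1 / 2) (r₂ / ρ₂)) ^ k := by
          gcongr
          · exact le_max_left _ _
          · refine le_max_of_le_left ?_
            rw [div_le_iff₀ hz]
            linarith
      _ = _ := by simp

theorem IsLaurentSeq.summable {R : ℝ} {a : ℤ → V} (ha : IsLaurentSeq R a) {z : ℂ}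
    (hz : z ∈ puncturedDisk R) : Summable fun n : ℤ => ‖z ^ n • a n‖ := by
  obtain ⟨C, t, h0, h1, h⟩ := ha.exists_bound hz.1 le_rfl hz.2
  exact .of_nonneg_of_le (fun _ => norm_nonneg _) (fun n => h n z le_rfl le_rfl)
    ((summable_pow_natAbs h0 h1).mul_left C)

theorem laurentCoeff_eq {f : ℂ → V} {R : ℝ} (hf : DifferentiableOn ℂ f (puncturedDisk R))
    {ρ ρ' : ℝ} (h0 : 0 < ρ) (h0' : 0 < ρ') (h : ρ < R) (h' : ρ' < R) (n : ℤ) :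
    laurentCoeff f ρ n = laurentCoeff f ρ' n := by
  wlog hle : ρ ≤ ρ' generalizing ρ ρ'
  · exact (this h0' h0 h' h (le_of_not_ge hle)).symm
  have hd : DifferentiableOn ℂ (fun z => z ^ (-n) • f z) (puncturedDisk R) :=
    DifferentiableOn.smul (fun z hz => (differentiableAt_zpow.2
      (Or.inl (norm_pos_iff.1 hz.1))).differentiableWithinAt) hf
  unfold laurentCoeff
  congr 1
  refine (circleIntegral_sub_center_inv_smul_eq_of_differentiable_on_annulus_off_countable
    h0 hle Set.countable_empty (hd.continuousOn.mono ?_) fun z hz => ?_).symm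
  · rintro z ⟨hz1, hz2⟩
    rw [mem_closedBall_zero_iff] at hz1
    rw [mem_ball_zero_iff, not_lt] at hz2
    exact ⟨h0.trans_le hz2, hz1.trans_lt h'⟩
  · obtain ⟨⟨hz1, hz2⟩, -⟩ := hz
    rw [mem_ball_zero_iff] at hz1
    rw [mem_closedBall_zero_iff, not_le] at hz2
    exact hd.differentiableAt ((isOpen_puncturedDisk R).mem_nhds ⟨h0.trans hz2, hz1.trans h'⟩)

theorem laurentCoeff_eq_integral (f : ℂ → V) {ρ : ℝ} (hρ : 0 < ρ) (n : ℤ) :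
    laurentCoeff f ρ n = (2 * Real.pi : ℂ)⁻¹ • ∫ θ in (0 : ℝ)..2 * Real.pi,
      circleMap 0 ρ θ ^ (-n) • f (circleMap 0 ρ θ) := by
  have h (θ : ℝ) : circleMap 0 ρ θ ≠ 0 := by simp [circleMap, hρ.ne']
  have : (fun θ : ℝ => deriv (circleMap 0 ρ) θ •
      (circleMap 0 ρ θ - 0)⁻¹ • circleMap 0 ρ θ ^ (-n) • f (circleMap 0 ρ θ)) =
      fun θ => I • circleMap 0 ρ θ ^ (-n) • f (circleMap 0 ρ θ) := by
    funext θ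
    rw [deriv_circleMap, sub_zero, smul_smul]
    congr 1
    have := h θ
    field_simp
  rw [laurentCoeff, circleIntegral, this, intervalIntegral.integral_smul, smul_smul]
  congr 1
  field_simp

variable [CompleteSpace V]

theorem IsLaurentSeq.differentiableOn {R : ℝ} {a : ℤ → V} (ha : IsLaurentSeq R a) :
    DifferentiableOn ℂ (fun z => ∑' n : ℤ, z ^ n • a n) (puncturedDisk R) := by
  intro z hz
  obtain ⟨ρ, hρ1, hρ2⟩ := exists_between hz.2
  have hz2 : ‖z‖ / 2 < ‖z‖ := by linarith [hz.1]
  obtain ⟨C, t, h0, h1, h⟩ := ha.exists_bound (half_pos hz.1) (hz2.trans hρ1).le hρ2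
  have ho : IsOpen {w : ℂ | ‖z‖ / 2 < ‖w‖ ∧ ‖w‖ < ρ} :=
    (isOpen_lt continuous_const continuous_norm).inter (isOpen_lt continuous_norm continuous_const)
  have hd := differentiableOn_tsum_of_summable_norm (F := fun (n : ℤ) (w : ℂ) => w ^ n • a n)
    ((summable_pow_natAbs h0 h1).mul_left C) (fun n w hw => by
      have hw0 : w ≠ 0 := norm_pos_iff.1 ((half_pos hz.1).trans hw.1)
      exact ((differentiableAt_zpow.2 (Or.inl hw0)).smul_const _).differentiableWithinAt) ho
    (fun n w hw => h n w hw.1.le hw.2.le)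
  exact (hd.differentiableAt (ho.mem_nhds ⟨hz2, hρ1⟩)).differentiableWithinAt

omit [CompleteSpace V] in
-- The contour can be moved to any radius r < R, where the required bound is Cauchy's estimate.
theorem isLaurentSeq_laurentCoeff {f : ℂ → V} {R : ℝ} (hf : DifferentiableOn ℂ f (puncturedDisk R))
    {ρ : ℝ} (h0 : 0 < ρ) (h : ρ < R) : IsLaurentSeq R (laurentCoeff f ρ) := by
  intro r hr hrR
  obtain ⟨M, hM⟩ := (isCompact_sphere (0 : ℂ) r).exists_bound_of_continuousOn
    (hf.continuousOn.mono (sphere_subset_puncturedDisk hr hrR))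
  refine ⟨M, fun n => ?_⟩
  rw [laurentCoeff_eq hf h0 hr h hrR]
  refine (circleIntegral.norm_two_pi_i_inv_smul_integral_le_of_norm_le_const
    (C := r⁻¹ * (r ^ (-n) * M)) hr.le fun z hz => ?_).trans (le_of_eq ?_)
  · have hz' := mem_sphere_zero_iff_norm.1 hz
    rw [norm_smul, norm_smul, norm_inv, norm_zpow, sub_zero, hz']
    gcongr
    exact hM z hz
  · field_simp

/-- On the circle through z, f is a continuous periodic function with Fourier coefficients ρ^n a_n.
These are summable, so the Fourier series converges to f pointwise. -/
theorem hasSum_laurentCoeff_scalar {f : ℂ → ℂ} {R : ℝ}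
    (hf : DifferentiableOn ℂ f (puncturedDisk R)) {z : ℂ} (hz : z ∈ puncturedDisk R) :
    HasSum (fun n : ℤ => z ^ n • laurentCoeff f ‖z‖ n) (f z) := by
  have : Fact (0 < 2 * Real.pi) := ⟨Real.two_pi_pos⟩
  set ρ := ‖z‖ with hρ
  have hc : Continuous fun x : AddCircle (2 * Real.pi) => f (ρ * (AddCircle.toCircle x : ℂ)) := by
    refine hf.continuousOn.comp_continuous (by fun_prop) fun x => ?_
    refine sphere_subset_puncturedDisk hz.1 hz.2 ?_
    rw [mem_sphere_zero_iff_norm, norm_mul, Circle.norm_coe, norm_real, mul_one,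
      Real.norm_of_nonneg hz.1.le]
  let g : C(AddCircle (2 * Real.pi), ℂ) := ⟨_, hc⟩
  have hcm (θ : ℝ) : (ρ : ℂ) * (AddCircle.toCircle (θ : AddCircle (2 * Real.pi)) : ℂ) =
      circleMap 0 ρ θ := by
    rw [AddCircle.toCircle_apply_mk, circleMap, zero_add, div_self Real.two_pi_pos.ne', one_mul,
      Circle.coe_exp]
  have hρ0 : (ρ : ℂ) ≠ 0 := by exact_mod_cast hz.1.ne'
  have hcoef (n : ℤ) : fourierCoeff g n = (ρ : ℂ) ^ n * laurentCoeff f ρ n := by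
    rw [fourierCoeff_eq_intervalIntegral _ n 0, laurentCoeff_eq_integral f hz.1, zero_add,
      smul_eq_mul, mul_left_comm, ← intervalIntegral.integral_const_mul, Complex.real_smul]
    congr 1
    · push_cast; simp
    · refine intervalIntegral.integral_congr fun θ _ => ?_
      simp only [smul_eq_mul]
      have h1 : g (θ : AddCircle (2 * Real.pi)) = f (circleMap 0 ρ θ) := by
        rw [← hcm]; rfl
      rw [h1, ← mul_assoc]
      congr 1
      rw [← hcm, mul_zpow, zpow_neg, ← mul_assoc, mul_inv_cancel₀ (zpow_ne_zero _ hρ0), one_mul,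
        fourier_apply, AddCircle.toCircle_zsmul, Circle.coe_zpow]
  obtain ⟨θ, hθ⟩ : ∃ θ : ℝ, z = circleMap 0 ρ θ :=
    ⟨z.arg, by rw [circleMap, zero_add, hρ, norm_mul_exp_arg_mul_I]⟩
  have hterm (n : ℤ) : fourierCoeff g n • (fourier n (θ : AddCircle (2 * Real.pi)) : ℂ) =
      z ^ n • laurentCoeff f ρ n := by
    rw [hcoef, hθ, ← hcm, fourier_apply, AddCircle.toCircle_zsmul, Circle.coe_zpow, mul_zpow,
      smul_eq_mul, smul_eq_mul]
    ring
  have hs : Summable (fourierCoeff g) := by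
    have h1 := (isLaurentSeq_laurentCoeff hf hz.1 hz.2).summable hz
    refine Summable.of_norm (h1.congr fun n => ?_)
    rw [hcoef, norm_smul, norm_mul, norm_zpow, norm_zpow, norm_real, Real.norm_of_nonneg hz.1.le]
  have h2 := has_pointwise_sum_fourier_series_of_summable hs (θ : AddCircle (2 * Real.pi))
  simp only [hterm] at h2
  convert h2 using 1
  rw [hθ, ← hcm]
  rfl

theorem clm_laurentCoeff {f : ℂ → V} {R : ℝ} (hf : DifferentiableOn ℂ f (puncturedDisk R))
    {ρ : ℝ} (h0 : 0 < ρ) (h : ρ < R) (T : V →L[ℂ] ℂ) (n : ℤ) :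
    T (laurentCoeff f ρ n) = laurentCoeff (fun z => T (f z)) ρ n := by
  rw [laurentCoeff_eq_integral _ h0, laurentCoeff_eq_integral _ h0, map_smul,
    ← T.intervalIntegral_comp_comm]
  · simp only [map_smul]
  · have hmem (θ : ℝ) : circleMap 0 ρ θ ∈ puncturedDisk R :=
      sphere_subset_puncturedDisk h0 h (circleMap_mem_sphere _ h0.le _)
    refine Continuous.intervalIntegrable ?_ _ _
    refine Continuous.smul ?_ (hf.continuousOn.comp_continuous (continuous_circleMap _ _) hmem)
    exact (continuous_circleMap _ _).zpow₀ _ fun θ => Or.inl (norm_pos_iff.1 (hmem θ).1)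

/-- The Laurent expansion of an analytic function on a punctured disk. -/
theorem hasSum_laurentCoeff {f : ℂ → V} {R : ℝ} (hf : DifferentiableOn ℂ f (puncturedDisk R))
    {ρ : ℝ} (h0 : 0 < ρ) (h : ρ < R) {z : ℂ} (hz : z ∈ puncturedDisk R) :
    HasSum (fun n : ℤ => z ^ n • laurentCoeff f ρ n) (f z) := by
  have hs := ((isLaurentSeq_laurentCoeff hf h0 h).summable hz).of_norm.hasSum
  convert hs using 1
  -- The series converges absolutely, so its sum can be identified by testing against linear
  -- functionals, which reduces to scalar functions.
  refine (SeparatingDual.eq_iff_forall_dual_eq (R := ℂ)).2 fun T => ?_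
  have h1 := hasSum_laurentCoeff_scalar (T.differentiable.comp_differentiableOn hf) hz
  have h2 (n : ℤ) : z ^ n • laurentCoeff (T ∘ f) ‖z‖ n = T (z ^ n • laurentCoeff f ρ n) := by
    rw [map_smul, laurentCoeff_eq hf h0 hz.1 h hz.2, clm_laurentCoeff hf hz.1 hz.2]
    rfl
  simp only [h2] at h1
  exact h1.unique (T.hasSum hs)

/-- Multiply by z^{-m} and integrate over a circle term by term: only the term n = m survives, and
it is a multiple of a_m. -/
theorem IsLaurentSeq.eq_zero {R : ℝ} (hR : 0 < R) {a : ℤ → V} (ha : IsLaurentSeq R a)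
    (h : ∀ z ∈ puncturedDisk R, HasSum (fun n : ℤ => z ^ n • a n) 0) (m : ℤ) : a m = 0 := by
  obtain ⟨ρ, h0, hρR⟩ := exists_between hR
  obtain ⟨C, t, ht0, ht1, hb⟩ := ha.exists_bound h0 le_rfl hρR
  have hmem (θ : ℝ) : ‖circleMap 0 ρ θ‖ = ρ := by simp [abs_of_pos h0]
  have hne (θ : ℝ) : circleMap 0 ρ θ ≠ 0 := norm_pos_iff.1 ((hmem θ).symm ▸ h0)
  have hterm (n : ℤ) : (∫ θ in (0 : ℝ)..2 * Real.pi,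
      circleMap 0 ρ θ ^ (-m) • circleMap 0 ρ θ ^ n • a n) =
      if n = m then (2 * Real.pi : ℂ) • a m else 0 := by
    have h1 : ∀ θ : ℝ, circleMap 0 ρ θ ^ (-m) • circleMap 0 ρ θ ^ n • a n =
        circleMap 0 ρ θ ^ (n - m) • a n := fun θ => by
      rw [smul_smul, ← zpow_add₀ (hne θ)]; congr 2; ring
    simp only [h1]
    split_ifs with hnm
    · subst hnm
      simp only [sub_self, zpow_zero, one_smul, intervalIntegral.integral_const, sub_zero]
      rw [← Complex.coe_smul]
      push_cast; rfl
    · have h2 := circleIntegral.integral_sub_zpow_of_ne (n := n - m - 1)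
        (by omega) 0 0 ρ
      have h3 : ∀ θ : ℝ, deriv (circleMap 0 ρ) θ • (circleMap 0 ρ θ - 0) ^ (n - m - 1) =
          I * circleMap 0 ρ θ ^ (n - m) := fun θ => by
        rw [deriv_circleMap, sub_zero, zpow_sub_one₀ (hne θ), smul_eq_mul]
        have := hne θ
        field_simp
      rw [circleIntegral] at h2
      simp only [h3] at h2
      rw [intervalIntegral.integral_const_mul, mul_eq_zero, or_iff_right I_ne_zero] at h2
      rw [intervalIntegral.integral_smul_const, h2, zero_smul]
  have hsum : HasSum (fun n : ℤ => ∫ θ in (0 : ℝ)..2 * Real.pi,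
      circleMap 0 ρ θ ^ (-m) • circleMap 0 ρ θ ^ n • a n)
      (∫ θ in (0 : ℝ)..2 * Real.pi, (0 : V)) := by
    refine intervalIntegral.hasSum_integral_of_dominated_convergence
      (fun n _ => ρ ^ (-m) * (C * t ^ n.natAbs)) (fun n => ?_) (fun n => ?_) ?_ ?_ ?_
    · refine Continuous.aestronglyMeasurable ?_
      refine Continuous.smul ?_ (Continuous.smul ?_ continuous_const) <;>
      exact (continuous_circleMap _ _).zpow₀ _ fun θ => Or.inl (hne θ)
    · refine .of_forall fun θ _ => ?_
      rw [norm_smul, norm_zpow, hmem]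
      gcongr
      exact hb n _ (hmem θ).ge (hmem θ).le
    · exact .of_forall fun _ _ => ((summable_pow_natAbs ht0 ht1).mul_left _).mul_left _
    · exact intervalIntegrable_const
    · refine .of_forall fun θ _ => ?_
      have := (h _ ⟨(hmem θ).symm ▸ h0, (hmem θ).symm ▸ hρR⟩).const_smul (circleMap 0 ρ θ ^ (-m))
      simpa using this
  simp only [hterm, intervalIntegral.integral_zero] at hsum
  have := hsum.unique (hasSum_ite_eq m ((2 * Real.pi : ℂ) • a m))
  exact (smul_eq_zero.1 this.symm).resolve_left (by simp [Real.pi_ne_zero])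

end Laurent

/-! ### The equation `S G(qz) - G(z) = K(z)` -/

section Solve

variable {V : Type*} [NormedAddCommGroup V] [NormedSpace ℂ V] [FiniteDimensional ℂ V] {q : ℂˣ}

theorem exists_norm_le_of_injective (T : V →L[ℂ] V) (hT : ∀ v, T v = 0 → v = 0) :
    ∃ c > 0, ∀ v, ‖v‖ ≤ c * ‖T v‖ := by
  obtain ⟨c, hc, h⟩ := (T : V →ₗ[ℂ] V).exists_antilipschitzWith (LinearMap.ker_eq_bot'.2 hT)
  exact ⟨c, hc, fun v => by simpa using h.le_mul_dist v 0⟩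

/-- As n → -∞ the identity dominates q^n S, and as n → ∞ the injective operator q^n S dominates. The
finitely many remaining n are handled by injectivity in finite dimension. -/
theorem exists_uniform_bound (hq : 1 < ‖(q : ℂ)‖) (S : V →L[ℂ] V) (hS : ∀ v, S v = 0 → v = 0)
    (hres : ∀ (n : ℤ) (v : V), (q : ℂ) ^ n • S v - v = 0 → v = 0) :
    ∃ B : ℝ, ∀ (n : ℤ) (v : V), ‖v‖ ≤ B * ‖(q : ℂ) ^ n • S v - v‖ := by
  obtain ⟨c, hc, hcS⟩ := exists_norm_le_of_injective S hS
  have hev : ∀ᶠ n : ℤ in cofinite, ∀ v : V, ‖v‖ ≤ 2 * ‖(q : ℂ) ^ n • S v - v‖ := by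
    rw [Int.cofinite_eq, eventually_sup]
    constructor
    · have h1 : Tendsto (fun k : ℤ => ‖(q : ℂ)‖ ^ (-k)) atBot atTop :=
        (tendsto_zpow_norm_atTop hq).comp tendsto_neg_atBot_atTop
      filter_upwards [h1.eventually_ge_atTop (2 * (‖S‖ + 1))] with n hn v
      have hQ : 0 < ‖(q : ℂ)‖ ^ n := zpow_pos (zero_lt_one.trans hq) n
      rw [zpow_neg, le_inv_comm₀ (by positivity) hQ] at hn
      have h2 : ‖(q : ℂ) ^ n • S v‖ ≤ 1 / 2 * ‖v‖ := by
        rw [norm_smul, norm_zpow]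
        calc ‖(q : ℂ)‖ ^ n * ‖S v‖ ≤ (2 * (‖S‖ + 1))⁻¹ * ((‖S‖ + 1) * ‖v‖) := by
              gcongr
              exact (S.le_opNorm v).trans (by gcongr; linarith)
          _ = 1 / 2 * ‖v‖ := by field_simp
      have h3 := norm_sub_norm_le v ((q : ℂ) ^ n • S v)
      rw [norm_sub_rev] at h3
      linarith
    · filter_upwards [(tendsto_zpow_norm_atTop hq).eventually_ge_atTop (2 * c)] with n hn v
      have h2 : 2 * ‖v‖ ≤ ‖(q : ℂ) ^ n • S v‖ := by
        rw [norm_smul, norm_zpow]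
        calc 2 * ‖v‖ ≤ 2 * (c * ‖S v‖) := by gcongr; exact hcS v
          _ = 2 * c * ‖S v‖ := by ring
          _ ≤ _ := by gcongr
      have h3 := norm_sub_norm_le ((q : ℂ) ^ n • S v) v
      have h4 := norm_nonneg v
      linarith
  have hfin := hev
  rw [eventually_cofinite] at hfin
  have hone (n : ℤ) : ∃ c > 0, ∀ v, ‖v‖ ≤ c * ‖(q : ℂ) ^ n • S v - v‖ :=
    exists_norm_le_of_injective ((q : ℂ) ^ n • S - ContinuousLinearMap.id ℂ V) (hres n)
  choose b hb0 hb using hone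
  refine ⟨2 + ∑ n ∈ hfin.toFinset, b n, fun n v => ?_⟩
  have hsum : 0 ≤ ∑ n ∈ hfin.toFinset, b n := Finset.sum_nonneg fun n _ => (hb0 n).le
  by_cases hn : n ∈ hfin.toFinset
  · refine (hb n v).trans ?_
    gcongr
    have := Finset.single_le_sum (fun n _ => (hb0 n).le) hn
    linarith
  · simp only [Set.Finite.mem_toFinset, Set.mem_ofPred_eq, not_not] at hn
    refine (hn v).trans ?_
    gcongr
    linarith

/-- The coefficients solve (q^n S - 1) b_n = K_n. The uniform bound on the inverses makes b_n grow
no faster than K_n on every circle, so the series converges on all of ℂ^*. -/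
theorem exists_solution (hq : 1 < ‖(q : ℂ)‖) (S : V →L[ℂ] V) (hS : ∀ v, S v = 0 → v = 0)
    (hres : ∀ (n : ℤ) (v : V), (q : ℂ) ^ n • S v - v = 0 → v = 0)
    {K : ℂ → V} (hK : DifferentiableOn ℂ K {0}ᶜ) :
    ∃ G : ℂ → V, DifferentiableOn ℂ G {0}ᶜ ∧ ∀ z ≠ 0, S (G ((q : ℂ) * z)) - G z = K z := by
  have : CompleteSpace V := FiniteDimensional.complete ℂ V
  obtain ⟨B, hB⟩ := exists_uniform_bound hq S hS hres
  have hsub (R : ℝ) : puncturedDisk R ⊆ {0}ᶜ := fun z hz => norm_pos_iff.1 hz.1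
  have hsurj (n : ℤ) (w : V) : ∃ v, (q : ℂ) ^ n • S v - v = w := by
    have hinj : Function.Injective
        (((q : ℂ) ^ n • S - ContinuousLinearMap.id ℂ V : V →L[ℂ] V) : V →ₗ[ℂ] V) :=
      LinearMap.ker_eq_bot.1 (LinearMap.ker_eq_bot'.2 (hres n))
    exact LinearMap.injective_iff_surjective.1 hinj w
  choose b hb using fun n => hsurj n (laurentCoeff K 1 n)
  have hbL (R : ℝ) (hR : 1 < R) : IsLaurentSeq R b := by
    intro ρ hρ hρR
    obtain ⟨M, hM⟩ := isLaurentSeq_laurentCoeff (hK.mono (hsub R)) one_pos hR ρ hρ hρR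
    refine ⟨|B| * M, fun n => (hB n (b n)).trans ?_⟩
    rw [hb]
    calc B * ‖laurentCoeff K 1 n‖ ≤ |B| * (M * ρ ^ (-n)) := by
          gcongr
          · exact le_abs_self B
          · exact hM n
      _ = _ := by ring
  have hsum {z : ℂ} (hz : z ≠ 0) : HasSum (fun n : ℤ => z ^ n • b n) (∑' n : ℤ, z ^ n • b n) :=
    ((hbL (‖z‖ + 2) (by linarith [norm_nonneg z])).summable
      ⟨norm_pos_iff.2 hz, by linarith⟩).of_norm.hasSum
  refine ⟨fun z => ∑' n : ℤ, z ^ n • b n, fun z hz => ?_, fun z hz => ?_⟩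
  · exact ((hbL (‖z‖ + 2) (by linarith [norm_nonneg z])).differentiableOn.differentiableAt
      ((isOpen_puncturedDisk _).mem_nhds
        ⟨norm_pos_iff.2 hz, by linarith⟩)).differentiableWithinAt
  · have h1 := (S.hasSum (hsum (mul_ne_zero q.ne_zero hz))).sub (hsum hz)
    have h2 := hasSum_laurentCoeff (hK.mono (hsub (‖z‖ + 2))) one_pos
      (by linarith [norm_nonneg z]) (z := z) ⟨norm_pos_iff.2 hz, by linarith⟩
    refine h1.unique (h2.congr_fun fun n => ?_)
    rw [map_smul, mul_zpow, mul_comm, mul_smul, ← smul_sub, hb]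

/-- Comparing Laurent coefficients gives q^n S a_n = a_n, hence a_n = 0. The smaller radius R/|q|
keeps qz inside the domain of E. -/
theorem eq_zero_of_homogeneous (hq : 1 < ‖(q : ℂ)‖) (S : V →L[ℂ] V)
    (hres : ∀ (n : ℤ) (v : V), (q : ℂ) ^ n • S v - v = 0 → v = 0)
    {R : ℝ} (hR : 0 < R) {E : ℂ → V} (hE : DifferentiableOn ℂ E (puncturedDisk R))
    (h : ∀ z ∈ puncturedDisk (R / ‖(q : ℂ)‖), S (E ((q : ℂ) * z)) - E z = 0) :
    ∀ z ∈ puncturedDisk R, E z = 0 := by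
  have : CompleteSpace V := FiniteDimensional.complete ℂ V
  have hq0 : 0 < ‖(q : ℂ)‖ := zero_lt_one.trans hq
  obtain ⟨r, hr0, hrR⟩ := exists_between hR
  set a := laurentCoeff E r with ha
  have haL : IsLaurentSeq R a := isLaurentSeq_laurentCoeff hE hr0 hrR
  have hlt {ρ : ℝ} (hρ : ρ < R / ‖(q : ℂ)‖) : ‖(q : ℂ)‖ * ρ < R := by
    rw [lt_div_iff₀ hq0] at hρ
    linarith
  have hle : R / ‖(q : ℂ)‖ ≤ R := div_le_self hR.le hq.le
  have hbL : IsLaurentSeq (R / ‖(q : ℂ)‖) fun n => (q : ℂ) ^ n • S (a n) - a n := by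
    intro ρ hρ hρR
    obtain ⟨M, hM⟩ := haL (‖(q : ℂ)‖ * ρ) (by positivity) (hlt hρR)
    obtain ⟨M', hM'⟩ := haL ρ hρ (hρR.trans_le hle)
    refine ⟨‖S‖ * M + M', fun n => (norm_sub_le _ _).trans ?_⟩
    rw [norm_smul, norm_zpow]
    calc ‖(q : ℂ)‖ ^ n * ‖S (a n)‖ + ‖a n‖
        ≤ ‖(q : ℂ)‖ ^ n * (‖S‖ * (M * (‖(q : ℂ)‖ * ρ) ^ (-n))) + M' * ρ ^ (-n) := by
          gcongr
          · exact (S.le_opNorm _).trans (by gcongr; exact hM n)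
          · exact hM' n
      _ = _ := by
        rw [mul_zpow, zpow_neg ‖(q : ℂ)‖]
        have : ‖(q : ℂ)‖ ^ n ≠ 0 := (zpow_pos hq0 n).ne'
        field_simp
  have hsumE {z : ℂ} (hz : z ∈ puncturedDisk R) : HasSum (fun n : ℤ => z ^ n • a n) (E z) :=
    hasSum_laurentCoeff hE hr0 hrR hz
  have hb0 := hbL.eq_zero (by positivity) fun z hz => by
    have hqz : (q : ℂ) * z ∈ puncturedDisk R := by
      rw [puncturedDisk, Set.mem_ofPred_eq, norm_mul]
      exact ⟨mul_pos hq0 hz.1, hlt hz.2⟩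
    have h1 := (S.hasSum (hsumE hqz)).sub (hsumE ⟨hz.1, hz.2.trans_le hle⟩)
    rw [h z hz] at h1
    refine h1.congr_fun fun n => ?_
    rw [map_smul, mul_zpow, mul_comm, mul_smul, ← smul_sub]
  have ha0 (n : ℤ) : a n = 0 := hres n _ (hb0 n)
  intro z hz
  have := hsumE hz
  simp only [ha0, smul_zero] at this
  exact this.unique hasSum_zero

end Solve

/-! ### Multisummable functions with values in a vector space -/

section Multisummable

variable {V V' : Type*} [NormedAddCommGroup V] [NormedSpace ℂ V]
  [NormedAddCommGroup V'] [NormedSpace ℂ V'] {q : ℂˣ}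

/-- Boundedness on the sectors `S(Λ,ε;r)`. -/
def IsBoundedOut (Λ : Divisor q) (X : ℂ → V) : Prop :=
  ∀ ε > 0, ∀ r : ℝ, ∃ C : ℝ, ∀ z ∈ germSector Λ ε r, ‖X z‖ ≤ C

/-- Global vector valued multisummable functions. -/
def IsMultisummable (L : List (Divisor q)) (X : ℂ → V) : Prop :=
  (∃ G : ℂ → V, IsGevreyAlong L G ∧ ∀ z ∈ sector L.sum 0, X z = (thetaDiv L.sum z)⁻¹ • G z) ∧
    IsBoundedOut L.sum X

omit [NormedSpace ℂ V] in
theorem IsBoundedOut.add {Λ : Divisor q} {X Y : ℂ → V} (hX : IsBoundedOut Λ X)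
    (hY : IsBoundedOut Λ Y) : IsBoundedOut Λ fun z => X z + Y z := fun ε hε r => by
  obtain ⟨C, hC⟩ := hX ε hε r
  obtain ⟨C', hC'⟩ := hY ε hε r
  exact ⟨C + C', fun z hz => (norm_add_le _ _).trans (add_le_add (hC z hz) (hC' z hz))⟩

theorem IsBoundedOut.clm {Λ : Divisor q} {X : ℂ → V} (hX : IsBoundedOut Λ X) (T : V →L[ℂ] V') :
    IsBoundedOut Λ fun z => T (X z) := fun ε hε r => by
  obtain ⟨C, hC⟩ := hX ε hε r
  exact ⟨‖T‖ * C, fun z hz => (T.le_opNorm _).trans (by gcongr; exact hC z hz)⟩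

theorem IsBoundedOut.pow_smul {Λ : Divisor q} {X : ℂ → V} (hX : IsBoundedOut Λ X) (k : ℕ) :
    IsBoundedOut Λ fun z => z ^ k • X z := fun ε hε r => by
  obtain ⟨C, hC⟩ := hX ε hε r
  refine ⟨r ^ k * C, fun z hz => ?_⟩
  have hr : ‖z‖ ≤ r := hz.2.le
  rw [norm_smul, norm_pow]
  exact mul_le_mul (pow_le_pow_left₀ (norm_nonneg z) hr k) (hC z hz) (norm_nonneg _)
    (pow_nonneg ((norm_nonneg z).trans hr) k)

/-! ### Operations on multisummable functions and boundedness from the equation. -/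

section

variable {L : List (Divisor q)} [CompleteSpace V]

omit [CompleteSpace V] in
theorem isMultisummable_const (v : V) : IsMultisummable ([] : List (Divisor q)) fun _ => v :=
  ⟨⟨fun _ => v, .const v, fun z _ => by simp [thetaDiv_zero]⟩,
    fun _ _ _ => ⟨‖v‖, fun _ _ => le_rfl⟩⟩

theorem IsMultisummable.clm {X : ℂ → V} (hX : IsMultisummable L X) (T : V →L[ℂ] V') :
    IsMultisummable L fun z => T (X z) := by
  obtain ⟨⟨G, hG, h⟩, hb⟩ := hX
  exact ⟨⟨fun z => T (G z), hG.clm T, fun z hz => by simp only [h z hz, map_smul]⟩, hb.clm T⟩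

theorem IsMultisummable.sum {κ : Type*} (u : Finset κ) {X : κ → ℂ → V}
    (hX : ∀ k ∈ u, IsMultisummable L (X k)) : IsMultisummable L fun z => ∑ k ∈ u, X k z := by
  classical
  induction u using Finset.induction_on with
  | empty =>
    exact ⟨⟨fun _ => 0, .zero, fun z _ => by simp⟩, fun _ _ _ => ⟨0, fun _ _ => by simp⟩⟩
  | insert k u hk ih =>
    simp only [Finset.sum_insert hk]
    obtain ⟨⟨G, hG, h⟩, hb⟩ := hX k (Finset.mem_insert_self _ _)
    obtain ⟨⟨G', hG', h'⟩, hb'⟩ := ih fun l hl => hX l (Finset.mem_insert_of_mem hl)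
    exact ⟨⟨_, hG.add hG', fun z hz => by
      have h2 := h' z hz
      simp only at h2 ⊢
      rw [h z hz, h2, smul_add]⟩, hb.add hb'⟩

omit [CompleteSpace V] in
theorem IsMultisummable.congr {X Y : ℂ → V} (hX : IsMultisummable L X)
    (h : ∀ z, z ≠ 0 → Y z = X z) : IsMultisummable L Y := by
  obtain ⟨⟨G, hG, h'⟩, hb⟩ := hX
  refine ⟨⟨G, hG, fun z hz => by rw [h z hz.1, h' z hz]⟩, fun ε hε r => ?_⟩
  obtain ⟨C, hC⟩ := hb ε hε r
  exact ⟨C, fun z hz => by rw [h z hz.1.1]; exact hC z hz⟩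

variable (hq : 1 < ‖(q : ℂ)‖)
include hq

theorem IsMultisummable.pow_smul {X : ℂ → V} (hX : IsMultisummable L X) (k : ℕ) :
    IsMultisummable L fun z => z ^ k • X z := by
  obtain ⟨⟨G, hG, h⟩, hb⟩ := hX
  refine ⟨⟨_, hG.zpow_smul hq k, fun z hz => ?_⟩, hb.pow_smul k⟩
  simp only [h z hz, zpow_natCast]
  rw [smul_comm]

/-- G/θ_L is rewritten as θ_{L'} G/θ_{L+L'}; boundedness persists because the sectors only shrink.
-/
theorem IsMultisummable.append {X : ℂ → V} (hX : IsMultisummable L X) (L' : List (Divisor q)) :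
    IsMultisummable (L ++ L') X := by
  obtain ⟨⟨G, hG, h⟩, hb⟩ := hX
  refine ⟨⟨_, hG.theta_sum_smul hq L', fun z hz => ?_⟩, fun ε hε r => ?_⟩
  · rw [List.sum_append] at hz
    have h1 := sector_add_subset_left hq _ _ _ hz
    have h2 := thetaDiv_ne_zero hq (sector_add_subset_right hq _ _ _ hz)
    rw [h z h1, List.sum_append, thetaDiv_add, mul_inv, smul_smul, mul_assoc, inv_mul_cancel₀ h2,
      mul_one]
  · obtain ⟨C, hC⟩ := hb ε hε r
    refine ⟨C, fun z hz => hC z ⟨?_, hz.2⟩⟩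
    have := hz.1
    rw [List.sum_append] at this
    exact sector_add_subset_left hq _ _ _ this

omit [CompleteSpace V] in
/-- Solutions of `X(z) = z^N T X(qz) - W(z)` that are continuous out of `Λ` are bounded at `0`
out of `Λ` if `W` is. -/
theorem isBoundedOut_of_equation {Λ : Divisor q} {X W : ℂ → V} (hX : ContinuousOn X (sector Λ 0))
    (hW : IsBoundedOut Λ W) (T : V →L[ℂ] V) {N : ℕ} (hN : 1 ≤ N)
    (h : ∀ z ∈ sector Λ 0, X z = z ^ N • T (X ((q : ℂ) * z)) - W z) : IsBoundedOut Λ X := by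
  intro ε hε r
  have hq0 : 0 < ‖(q : ℂ)‖ := zero_lt_one.trans hq
  -- For |z| < ρ ≤ 1 and N ≥ 1 the operator z^N T has norm at most 1/2.
  set ρ : ℝ := (2 * (‖T‖ + 1))⁻¹ with hρ
  have hρ0 : 0 < ρ := by positivity
  have hρT : ρ * ‖T‖ ≤ 1 / 2 := by
    rw [hρ, inv_mul_le_iff₀ (by positivity)]
    linarith
  have hρ1 : ρ ≤ 1 := inv_le_one_of_one_le₀ (by linarith [norm_nonneg T])
  -- The radius b is at least |q|ρ, so that qz stays within it whenever |z| < ρ.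
  set b := max r (‖(q : ℂ)‖ * ρ) with hb
  obtain ⟨C₀, hC₀⟩ := exists_bound_on_annulus hq hX hε hρ0 b
  obtain ⟨C₁, hC₁⟩ := hW ε hε (b + 1)
  -- Induction over annuli growing towards 0. The bound M = max C₀ (2 C₁) reproduces itself, since
  -- M/2 + C₁ ≤ M.
  have hmain (n : ℕ) : ∀ z ∈ sector Λ ε, ρ * (‖(q : ℂ)‖ ^ n)⁻¹ ≤ ‖z‖ → ‖z‖ ≤ b →
      ‖X z‖ ≤ max C₀ (2 * C₁) := by
    induction n with
    | zero => exact fun z hz h1 h2 => (hC₀ z hz (by simpa using h1) h2).trans (le_max_left _ _)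
    | succ n ih =>
      intro z hz h1 h2
      rcases le_or_gt ρ ‖z‖ with h3 | h3
      · exact (hC₀ z hz h3 h2).trans (le_max_left _ _)
      have h4 := ih ((q : ℂ) * z) (mul_mem_sector hz) (by
          rw [norm_mul]
          calc ρ * (‖(q : ℂ)‖ ^ n)⁻¹ = ‖(q : ℂ)‖ * (ρ * (‖(q : ℂ)‖ ^ (n + 1))⁻¹) := by
                rw [pow_succ]; field_simp
            _ ≤ _ := by gcongr) (by
          rw [norm_mul]
          exact (mul_le_mul_of_nonneg_left h3.le hq0.le).trans (le_max_right _ _))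
      have h5 := hC₁ z ⟨hz, by linarith⟩
      have h6 : ‖z ^ N • T (X ((q : ℂ) * z))‖ ≤ 1 / 2 * max C₀ (2 * C₁) := by
        rw [norm_smul, norm_pow]
        calc ‖z‖ ^ N * ‖T (X ((q : ℂ) * z))‖ ≤ ρ * (‖T‖ * max C₀ (2 * C₁)) := by
              gcongr
              · exact (pow_le_of_le_one (norm_nonneg z) (h3.le.trans hρ1) (by omega)).trans h3.le
              · exact (T.le_opNorm _).trans (by gcongr)
          _ = ρ * ‖T‖ * max C₀ (2 * C₁) := by ring
          _ ≤ _ := by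
            gcongr
            exact (norm_nonneg _).trans h4
      rw [h z (sector_subset_sector hε.le hz)]
      refine (norm_sub_le _ _).trans ?_
      have h7 : 2 * C₁ ≤ max C₀ (2 * C₁) := le_max_right _ _
      linarith
  refine ⟨max C₀ (2 * C₁), fun z hz => ?_⟩
  have hz0 : 0 < ‖z‖ := norm_pos_iff.2 hz.1.1
  obtain ⟨n, hn⟩ := pow_unbounded_of_one_lt (ρ / ‖z‖) hq
  refine hmain n z hz.1 ?_ (hz.2.le.trans (le_max_left _ _))
  rw [div_lt_iff₀ hz0] at hn
  rw [mul_inv_le_iff₀ (by positivity)]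
  linarith

end

/-- The components of global multisummable functions are germs of multisummable functions. -/
theorem IsMultisummable.germ_mem_OOGerm (hq : 1 < ‖(q : ℂ)‖) {L : List (Divisor q)}
    (hL : 1 ≤ degree L.sum) {Λ : Divisor q} (hΛ : sector Λ 0 ⊆ sector L.sum 0) {f : ℂ → ℂ}
    (hf : IsMultisummable L f) : ((f : ℂ → ℂ) : GermOut Λ) ∈ OOGerm Λ L := by
  obtain ⟨⟨G, hG, h⟩, hb⟩ := hf
  -- The representative is the quotient itself, whose analyticity is inherited from G and θ; it
  -- agrees with f on the sector, hence as a germ.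
  refine ⟨fun z => G z / thetaDiv L.sum z, ⟨⟨1, one_pos, ?_, fun ε hε r _ _ => ?_⟩,
    G, hG.mem_EE hq hL, .of_forall fun _ => rfl⟩, ?_⟩
  · intro z hz
    have hn : ({0}ᶜ : Set ℂ) ∈ 𝓝 z := isOpen_compl_singleton.mem_nhds hz.1.1
    exact (hG.diff.analyticAt hn).div ((differentiableOn_thetaDiv hq _).analyticAt hn)
      (thetaDiv_ne_zero hq hz.1)
  · obtain ⟨C, hC⟩ := hb ε hε r
    refine ⟨C, fun z hz => ?_⟩
    have := hC z hz
    rwa [h z (sector_subset_sector hε.le hz.1), smul_eq_mul, inv_mul_eq_div] at this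
  · refine Germ.coe_eq.2 ?_
    filter_upwards [self_mem_nhdsWithin] with z hz
    rw [h z (hΛ hz), smul_eq_mul, inv_mul_eq_div]

end Multisummable

/-! ### The matrix equation -/

section MatrixEquation

variable {n p : ℕ}

/-- Sylvester's theorem: `A X = c X B` has no nonzero solution if the spectra of `A` and `c B` are
disjoint. -/
theorem sylvester_eq_zero (A : Matrix (Fin n) (Fin n) ℂ) (B : Matrix (Fin p) (Fin p) ℂ) (c : ℂˣ)
    (h : ∀ α ∈ spectrum ℂ A, ∀ β ∈ spectrum ℂ B, α ≠ c * β) (X : Matrix (Fin n) (Fin p) ℂ)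
    (hX : (c : ℂ) • (X * B) = A * X) : X = 0 := by
  have hX' : X * (c • B) = A * X := by
    rw [← hX, Units.smul_def, Matrix.mul_smul]
  -- X intertwines f(cB) and f(A) for every polynomial f. For f the characteristic polynomial of A,
  -- f(A) = 0 by Cayley–Hamilton, while f(cB) is invertible because no root of f is an eigenvalue of
  -- cB.
  have hpoly (f : Polynomial ℂ) :
      X * Polynomial.aeval (c • B) f = Polynomial.aeval A f * X := by
    induction f using Polynomial.induction_on' with
    | add f g hf hg => rw [map_add, map_add, Matrix.mul_add, Matrix.add_mul, hf, hg]
    | monomial k a =>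
      have hpow : X * (c • B) ^ k = A ^ k * X := by
        induction k with
        | zero => simp
        | succ k ih => rw [pow_succ, ← Matrix.mul_assoc, ih, Matrix.mul_assoc, hX',
            ← Matrix.mul_assoc, ← pow_succ]
      rw [Polynomial.aeval_monomial, Polynomial.aeval_monomial, ← Algebra.smul_def,
        ← Algebra.smul_def, Matrix.mul_smul, Matrix.smul_mul, hpow]
  have hunit : IsUnit (Polynomial.aeval (c • B) A.charpoly) := by
    by_contra hnu
    rw [(IsAlgClosed.splits A.charpoly).eq_prod_roots_of_monic A.charpoly_monic] at hnu
    obtain ⟨α, hα, hroot⟩ := spectrum.exists_mem_of_not_isUnit_aeval_prod hnu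
    have hαA : α ∈ spectrum ℂ A := Matrix.mem_spectrum_of_isRoot_charpoly hroot
    have hβ : (c⁻¹ : ℂˣ) • α ∈ spectrum ℂ B := by
      rw [← spectrum.smul_mem_smul_iff (r := c), smul_inv_smul]
      exact hα
    refine h α hαA _ hβ ?_
    rw [Units.smul_def, smul_eq_mul, ← mul_assoc, Units.mul_inv, one_mul]
  have h0 := hpoly A.charpoly
  rw [Matrix.aeval_self_charpoly, Matrix.zero_mul] at h0
  obtain ⟨u, hu⟩ := hunit
  calc X = X * (u * ↑u⁻¹ : Matrix (Fin p) (Fin p) ℂ) := by rw [Units.mul_inv, Matrix.mul_one]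
    _ = 0 := by rw [← Matrix.mul_assoc, hu, h0, Matrix.zero_mul]

/-- The operator `X ↦ P X Q`. -/
def sandwich {n' p' : ℕ} (P : Matrix (Fin n') (Fin n) ℂ) (Q : Matrix (Fin p) (Fin p') ℂ) :
    (Fin n → Fin p → ℂ) →L[ℂ] (Fin n' → Fin p' → ℂ) :=
  LinearMap.toContinuousLinearMap
    { toFun := fun X => Matrix.of.symm (P * Matrix.of X * Q)
      map_add' := fun X Y => by
        rw [← Matrix.of_add_of, Matrix.mul_add, Matrix.add_mul]; rfl
      map_smul' := fun c X => by
        rw [← Matrix.smul_of, Matrix.mul_smul, Matrix.smul_mul]; rfl }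

theorem of_sandwich {n' p' : ℕ} (P : Matrix (Fin n') (Fin n) ℂ) (Q : Matrix (Fin p) (Fin p') ℂ)
    (X : Fin n → Fin p → ℂ) : Matrix.of (sandwich P Q X) = P * Matrix.of X * Q := rfl

/-- The operator whose dilates govern `c X(qz) B = A X(z)`. -/
def sylvester (c : ℂ) (A : GL (Fin n) ℂ) (B : GL (Fin p) ℂ) :
    (Fin n → Fin p → ℂ) →L[ℂ] (Fin n → Fin p → ℂ) :=
  c • sandwich (↑A⁻¹ : Matrix (Fin n) (Fin n) ℂ) (B : Matrix (Fin p) (Fin p) ℂ)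

theorem mul_sylvester (c : ℂ) (A : GL (Fin n) ℂ) (B : GL (Fin p) ℂ)
    (X : Fin n → Fin p → ℂ) : (A : Matrix (Fin n) (Fin n) ℂ) * Matrix.of (sylvester c A B X) =
      c • (Matrix.of X * (B : Matrix (Fin p) (Fin p) ℂ)) := by
  rw [sylvester, smul_apply, ← Matrix.smul_of, of_sandwich, Matrix.mul_smul,
    Matrix.mul_assoc, ← Matrix.mul_assoc, Units.mul_inv, Matrix.one_mul]

theorem GL_mul_left_cancel {A : GL (Fin n) ℂ} {X Y : Matrix (Fin n) (Fin p) ℂ}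
    (h : (A : Matrix (Fin n) (Fin n) ℂ) * X = (A : Matrix (Fin n) (Fin n) ℂ) * Y) : X = Y := by
  have := congrArg (fun Z => (↑A⁻¹ : Matrix (Fin n) (Fin n) ℂ) * Z) h
  simpa only [← Matrix.mul_assoc, Units.inv_mul, Matrix.one_mul] using this

theorem GL_mul_right_cancel {B : GL (Fin p) ℂ} {X Y : Matrix (Fin n) (Fin p) ℂ}
    (h : X * (B : Matrix (Fin p) (Fin p) ℂ) = Y * (B : Matrix (Fin p) (Fin p) ℂ)) : X = Y := by
  have := congrArg (fun Z => Z * (↑B⁻¹ : Matrix (Fin p) (Fin p) ℂ)) h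
  simpa only [Matrix.mul_assoc, Units.mul_inv, Matrix.mul_one] using this

variable {q : ℂˣ}

/-- `‖Λ‖` is not congruent to a quotient of eigenvalues of `A` and `B`. -/
def IsNonresonant (Λ : Divisor q) (A : GL (Fin n) ℂ) (B : GL (Fin p) ℂ) : Prop :=
  ∀ α β : ℂˣ, (α : ℂ) ∈ spectrum ℂ (A : Matrix (Fin n) (Fin n) ℂ) →
    (β : ℂ) ∈ spectrum ℂ (B : Matrix (Fin p) (Fin p) ℂ) →
    weight Λ ≠ ((α / β : ℂˣ) : Torus q)

theorem ne_zero_of_mem_spectrum_GL (A : GL (Fin n) ℂ) {α : ℂ}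
    (h : α ∈ spectrum ℂ (A : Matrix (Fin n) (Fin n) ℂ)) : α ≠ 0 := by
  rintro rfl
  exact spectrum.zero_notMem ℂ A.isUnit h

variable {Λ : Divisor q} {A : GL (Fin n) ℂ} {B : GL (Fin p) ℂ}

theorem sylvester_injective {c : ℂ} (hc : c ≠ 0) (v : Fin n → Fin p → ℂ)
    (h : sylvester c A B v = 0) : v = 0 := by
  have h1 := mul_sylvester c A B v
  rw [h, Matrix.of_zero, Matrix.mul_zero, eq_comm, smul_eq_zero, or_iff_right hc] at h1
  exact Matrix.of.injective (GL_mul_right_cancel (B := B) (by rw [h1, Matrix.of_zero, Matrix.zero_mul]))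

/-- A kernel vector satisfies q^k κ⁻¹ v B = A v. By Sylvester it vanishes unless some α equals q^k
κ⁻¹ β, which would make α/β congruent to κ⁻¹, that is, to ‖Λ‖. -/
theorem IsNonresonant.sylvester (hΛ : IsNonresonant Λ A B) (k : ℤ) (v : Fin n → Fin p → ℂ)
    (h : (q : ℂ) ^ k • sylvester (thetaMultiplier Λ : ℂ)⁻¹ A B v - v = 0) : v = 0 := by
  refine Matrix.of.injective ?_
  refine sylvester_eq_zero (A : Matrix (Fin n) (Fin n) ℂ) (B : Matrix (Fin p) (Fin p) ℂ)
    (q ^ k * (thetaMultiplier Λ)⁻¹) (fun α hα β hβ hαβ => ?_) (Matrix.of v) ?_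
  · have hα0 := ne_zero_of_mem_spectrum_GL A hα
    have hβ0 := ne_zero_of_mem_spectrum_GL B hβ
    refine hΛ (Units.mk0 α hα0) (Units.mk0 β hβ0) hα hβ ?_
    rw [weight_eq]
    refine torus_coe_eq_iff.2 ⟨k, ?_⟩
    refine Units.ext ?_
    push_cast at hαβ ⊢
    rw [Units.val_mk0, Units.val_mk0, hαβ]
    field_simp
  · have h1 := congrArg (fun Z => (A : Matrix (Fin n) (Fin n) ℂ) * Matrix.of Z) (sub_eq_zero.1 h)
    simp only [← Matrix.smul_of, Matrix.mul_smul, mul_sylvester, smul_smul] at h1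
    push_cast
    exact h1

/-- Solving `z^{|Λ|} X(qz) B = A X(z) + W(z)` in multisummable functions. -/
theorem exists_multisummable_solution (hq : 1 < ‖(q : ℂ)‖) {L : List (Divisor q)}
    (hL : 1 ≤ degree L.sum) (hres : IsNonresonant L.sum A B)
    {W : ℂ → Fin n → Fin p → ℂ} (hW : IsMultisummable L W) :
    ∃ X : ℂ → Fin n → Fin p → ℂ, IsMultisummable L X ∧ ∀ z ∈ sector L.sum 0,
      z ^ degree L.sum • (Matrix.of (X ((q : ℂ) * z)) * (B : Matrix (Fin p) (Fin p) ℂ)) =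
        (A : Matrix (Fin n) (Fin n) ℂ) * Matrix.of (X z) + Matrix.of (W z) := by
  obtain ⟨⟨H, hH, hWH⟩, hWb⟩ := hW
  set κ := thetaMultiplier L.sum with hκ
  have hκ0 : (κ : ℂ)⁻¹ ≠ 0 := inv_ne_zero κ.ne_zero
  have hK := hH.clm (sandwich (↑A⁻¹ : Matrix (Fin n) (Fin n) ℂ) (1 : Matrix (Fin p) (Fin p) ℂ))
  -- For X = G/θ the multiplier κ z^{|Λ|} of θ cancels the power of z, leaving an equation with
  -- constant coefficients for G.
  obtain ⟨G, hG, heq⟩ := exists_solution hq (sylvester (κ : ℂ)⁻¹ A B)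
    (sylvester_injective hκ0) hres.sylvester hK.diff
  have heqX : ∀ z ∈ sector L.sum 0, z ^ degree L.sum •
      (Matrix.of ((thetaDiv L.sum ((q : ℂ) * z))⁻¹ • G ((q : ℂ) * z)) *
        (B : Matrix (Fin p) (Fin p) ℂ)) =
        (A : Matrix (Fin n) (Fin n) ℂ) * Matrix.of ((thetaDiv L.sum z)⁻¹ • G z) +
          Matrix.of (W z) := by
    intro z hz
    have h1 := congrArg (fun Z => (A : Matrix (Fin n) (Fin n) ℂ) * Matrix.of Z) (heq z hz.1)
    simp only [← Matrix.of_sub_of, Matrix.mul_sub, mul_sylvester, of_sandwich,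
      Matrix.mul_one] at h1
    rw [← Matrix.mul_assoc, Units.mul_inv, Matrix.one_mul, sub_eq_iff_eq_add'] at h1
    rw [hWH z hz, ← Matrix.smul_of, ← Matrix.smul_of, ← Matrix.smul_of, Matrix.mul_smul,
      ← smul_add, ← h1, Matrix.smul_mul, smul_smul, smul_smul, thetaDiv_mul hq _ hz.1, ← hκ]
    congr 1
    have hz0 : z ≠ 0 := hz.1
    have h2 := thetaDiv_ne_zero hq hz
    field_simp
  refine ⟨fun z => (thetaDiv L.sum z)⁻¹ • G z,
    ⟨⟨G, hK.of_equation hq hG _ heq, fun z _ => rfl⟩, ?_⟩, heqX⟩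
  have hsub : sector L.sum 0 ⊆ {0}ᶜ := fun z hz => hz.1
  -- The equation is solved for X(z), as z^{|Λ|} A⁻¹ X(qz) B - A⁻¹ W(z).
  refine isBoundedOut_of_equation hq (N := degree L.sum) ?_
    (hWb.clm (sandwich (↑A⁻¹ : Matrix (Fin n) (Fin n) ℂ) (1 : Matrix (Fin p) (Fin p) ℂ)))
    (sandwich (↑A⁻¹ : Matrix (Fin n) (Fin n) ℂ) (B : Matrix (Fin p) (Fin p) ℂ)) hL fun z hz => ?_
  · exact (((differentiableOn_thetaDiv hq _).continuousOn.mono hsub).inv₀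
      fun z hz => thetaDiv_ne_zero hq hz).smul (hG.continuousOn.mono hsub)
  · have h1 := heqX z hz
    generalize (thetaDiv L.sum z)⁻¹ • G z = Y at h1 ⊢
    generalize (thetaDiv L.sum ((q : ℂ) * z))⁻¹ • G ((q : ℂ) * z) = Y' at h1 ⊢
    refine Matrix.of.injective ?_
    rw [← Matrix.of_sub_of, ← Matrix.smul_of, of_sandwich, of_sandwich, Matrix.mul_one,
      Matrix.mul_assoc, ← Matrix.mul_smul, h1, Matrix.mul_add, ← Matrix.mul_assoc,
      Units.inv_mul, Matrix.one_mul, add_sub_cancel_right]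

/-- Uniqueness for the homogeneous equation. -/
theorem eq_zero_of_homogeneous_out (hq : 1 < ‖(q : ℂ)‖) {Λ' : Divisor q}
    (hsub : sector Λ' 0 ⊆ sector Λ 0) (hres : IsNonresonant Λ A B)
    {G : ℂ → Fin n → Fin p → ℂ} {R : ℝ} (hR : 0 < R)
    (hG : DifferentiableOn ℂ G (puncturedDisk R))
    (h : ∀ᶠ z in out Λ', z ^ degree Λ •
      (Matrix.of ((thetaDiv Λ ((q : ℂ) * z))⁻¹ • G ((q : ℂ) * z)) *
      (B : Matrix (Fin p) (Fin p) ℂ)) =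
        (A : Matrix (Fin n) (Fin n) ℂ) * Matrix.of ((thetaDiv Λ z)⁻¹ • G z)) :
    ∃ R' > 0, ∀ z ∈ puncturedDisk R', G z = 0 := by
  have hq0 : 0 < ‖(q : ℂ)‖ := zero_lt_one.trans hq
  rw [out, eventually_nhdsWithin_iff, Metric.eventually_nhds_iff] at h
  obtain ⟨δ, hδ, h⟩ := h
  -- If |z| < R₁/|q|, then |z| < δ, where the equation holds, and |qz| < R, where G is analytic.
  set R₁ := min R (δ * ‖(q : ℂ)‖) with hR₁
  have hR₁0 : 0 < R₁ := by positivity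
  have hG₁ : DifferentiableOn ℂ G (puncturedDisk R₁) :=
    hG.mono fun z hz => ⟨hz.1, hz.2.trans_le (min_le_left _ _)⟩
  set κ := thetaMultiplier Λ with hκ
  set T := sylvester (κ : ℂ)⁻¹ A B with hT
  have hsec : ∀ z ∈ puncturedDisk (R₁ / ‖(q : ℂ)‖) ∩ sector Λ' 0,
      T (G ((q : ℂ) * z)) - G z = 0 := by
    rintro z ⟨hz1, hz2⟩
    have hz := hsub hz2
    have h1 : ‖z‖ < δ := hz1.2.trans_le (by
      rw [div_le_iff₀ hq0]; exact min_le_right _ _)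
    have h2 := h (by simpa using h1) hz2
    have hz0 : z ≠ 0 := hz.1
    have h3 := thetaDiv_ne_zero hq hz
    rw [thetaDiv_mul hq _ hz0, ← hκ, ← Matrix.smul_of, ← Matrix.smul_of, Matrix.smul_mul, smul_smul, Matrix.mul_smul] at h2
    have h4 : z ^ degree Λ * ((κ : ℂ) * z ^ degree Λ * thetaDiv Λ z)⁻¹ =
        (thetaDiv Λ z)⁻¹ * (κ : ℂ)⁻¹ := by field_simp
    rw [h4, mul_smul] at h2
    have h5 := smul_right_injective _ (inv_ne_zero h3) h2
    rw [← mul_sylvester] at h5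
    rw [sub_eq_zero]
    exact Matrix.of.injective (GL_mul_left_cancel h5)
  refine ⟨R₁, hR₁0, eq_zero_of_homogeneous hq T hres.sylvester hR₁0 hG₁ fun z hz => ?_⟩
  have hcont : ContinuousOn (fun z => T (G ((q : ℂ) * z)) - G z)
      (puncturedDisk (R₁ / ‖(q : ℂ)‖)) := by
    refine (T.continuous.comp_continuousOn (hG₁.continuousOn.comp (by fun_prop) fun z hz => ?_)).sub
      (hG₁.continuousOn.mono fun z hz => ⟨hz.1, hz.2.trans_le (div_le_self hR₁0.le hq.le)⟩)
    have := hz.2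
    rw [lt_div_iff₀ hq0] at this
    rw [puncturedDisk, Set.mem_ofPred_eq, norm_mul]
    exact ⟨mul_pos hq0 hz.1, by linarith⟩
  have hopen := isOpen_puncturedDisk (R₁ / ‖(q : ℂ)‖)
  -- The equation for G no longer involves θ in a denominator, so continuity extends it from the
  -- dense sector to the whole punctured disk.
  have hdense : Dense (sector Λ' 0) := by
    have := (countable_compl_sector hq Λ').dense_compl ℂ
    rwa [compl_compl] at this
  have hcl : z ∈ closure (puncturedDisk (R₁ / ‖(q : ℂ)‖) ∩ sector Λ' 0) :=
    hdense.open_subset_closure_inter hopen hz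
  have hne : (𝓝[puncturedDisk (R₁ / ‖(q : ℂ)‖) ∩ sector Λ' 0] z).NeBot :=
    mem_closure_iff_nhdsWithin_neBot.1 hcl
  have ht : Tendsto (fun z => T (G ((q : ℂ) * z)) - G z)
      (𝓝[puncturedDisk (R₁ / ‖(q : ℂ)‖) ∩ sector Λ' 0] z) (𝓝 (T (G ((q : ℂ) * z)) - G z)) :=
    (hcont z hz).mono_left (nhdsWithin_mono _ Set.inter_subset_left)
  refine tendsto_nhds_unique ht (tendsto_const_nhds.congr' ?_)
  filter_upwards [self_mem_nhdsWithin] with w hw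
  exact (hsec w hw).symm

end MatrixEquation

/-! ### Segments of a partition -/

section Segments

/-- The condition `hR` forbids an element satisfying h before one satisfying g, so the disjunction
filters out a g-block followed by an h-block. -/
theorem filter_append_of_pairwise {α : Type*} {R : α → α → Prop} {s : List α} (hs : s.Pairwise R)
    {f g h : α → Bool} (hf : ∀ x, f x = (g x || h x)) (hgh : ∀ x, g x → h x → False)
    (hR : ∀ x y, R x y → h x → g y → False) : s.filter f = s.filter g ++ s.filter h := by
  induction s with
  | nil => rfl
  | cons x s ih =>
    rw [List.pairwise_cons] at hs
    rcases hgx : g x with _ | _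
    · rcases hhx : h x with _ | _
      · rw [List.filter_cons_of_neg (by simp [hf, hgx, hhx]),
          List.filter_cons_of_neg (by simp [hgx]), List.filter_cons_of_neg (by simp [hhx]), ih hs.2]
      · have hnil : s.filter g = [] :=
          List.filter_eq_nil_iff.2 fun y hy hgy => hR x y (hs.1 y hy) hhx hgy
        have := ih hs.2
        rw [hnil, List.nil_append] at this
        rw [List.filter_cons_of_pos (by simp [hf, hhx]), List.filter_cons_of_neg (by simp [hgx]),
          List.filter_cons_of_pos (by simp [hhx]), hnil, this, List.nil_append]
    · have hhx : ¬ h x = true := fun hhx => hgh x hgx hhx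
      rw [List.filter_cons_of_pos (by simp [hf, hgx]), List.filter_cons_of_pos (by simp [hgx]),
        List.filter_cons_of_neg hhx, ih hs.2, List.cons_append]

variable {q : ℂˣ} {m : ℕ} (P : Fin m → Divisor q)

/-- The splitting is needed for lists and not only for sums, because the Gevrey conditions depend on
the order: reversed, it exhibits the partition of F_{l,j} as an initial part of that of F_{i,j}. -/
theorem segment_append {i l j : Fin (m + 1)} (hil : i ≤ l) (hlj : l ≤ j) :
    segment P i j = segment P i l ++ segment P l j := by
  rw [segment, segment, segment, ← List.map_append]
  congr 1
  refine filter_append_of_pairwise (List.sortedLT_finRange m).pairwise (fun x => ?_)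
    (fun x => ?_) fun x y hxy => ?_
  · rw [Bool.eq_iff_iff]
    simp only [decide_eq_true_eq, Bool.or_eq_true]
    constructor
    · rintro ⟨h1, h2⟩
      exact (lt_or_ge x.castSucc l).imp (fun h => ⟨h1, h⟩) fun h => ⟨h, h2⟩
    · rintro (⟨h1, h2⟩ | ⟨h1, h2⟩)
      exacts [⟨h1, h2.trans_le hlj⟩, ⟨hil.trans h1, h2⟩]
  · simp only [decide_eq_true_eq]
    exact fun h1 h2 => absurd h1.2 (not_lt.2 h2.1)
  · simp only [decide_eq_true_eq]
    exact fun h1 h2 => absurd (h2.2.trans_le h1.1) (not_lt.2 (Fin.castSucc_le_castSucc_iff.2 hxy.le))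

theorem segment_self (i : Fin (m + 1)) : segment P i i = [] := by
  rw [segment, List.map_eq_nil_iff, List.filter_eq_nil_iff]
  simp only [decide_eq_true_eq]
  exact fun l _ h => absurd h.2 (not_lt.2 h.1)

theorem segmentSum_append {i l j : Fin (m + 1)} (hil : i ≤ l) (hlj : l ≤ j) :
    segmentSum P i j = segmentSum P i l + segmentSum P l j := by
  rw [segmentSum, segment_append P hil hlj, List.sum_append]; rfl

theorem sum_reverse_segment (i j : Fin (m + 1)) : (segment P i j).reverse.sum = segmentSum P i j :=
  List.sum_reverse _

theorem segmentSum_eq_sum (i j : Fin (m + 1)) :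
    segmentSum P i j = ∑ l : Fin m, if i ≤ l.castSucc ∧ l.castSucc < j then P l else 0 := by
  rw [segmentSum, segment, Fin.sum_univ_def]
  induction List.finRange m with
  | nil => rfl
  | cons l s ih =>
    rw [List.map_cons, List.sum_cons, ← ih]
    split_ifs with h
    · rw [List.filter_cons_of_pos (by simpa using h), List.map_cons, List.sum_cons]
    · rw [List.filter_cons_of_neg (by simpa using h), zero_add]

theorem segmentSum_castSucc_succ (l : Fin m) : segmentSum P l.castSucc l.succ = P l := by
  rw [segmentSum_eq_sum]
  have h (k : Fin m) : (l.castSucc ≤ k.castSucc ∧ k.castSucc < l.succ) ↔ k = l := by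
    rw [Fin.castSucc_lt_succ_iff, Fin.castSucc_le_castSucc_iff]
    exact ⟨fun h => le_antisymm h.2 h.1, fun h => h ▸ ⟨le_rfl, le_rfl⟩⟩
  simp only [h, Finset.sum_ite_eq', Finset.mem_univ, if_true]

theorem degree_segmentSum {μ : Fin (m + 1) → ℤ}
    (hP : ∀ l : Fin m, (degree (P l) : ℤ) = μ l.succ - μ l.castSucc) {i j : Fin (m + 1)}
    (hij : i ≤ j) : (degree (segmentSum P i j) : ℤ) = μ j - μ i := by
  induction j using Fin.induction with
  | zero =>
    have : i = 0 := le_antisymm hij (Fin.zero_le i)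
    subst this
    rw [segmentSum, segment_self, List.sum_nil, degree_zero]
    simp
  | succ l ih =>
    rcases hij.lt_or_eq with h | rfl
    · have hil : i ≤ l.castSucc := Fin.le_castSucc_iff.2 h
      rw [segmentSum_append P hil (Fin.castSucc_le_succ l), degree_add, segmentSum_castSucc_succ]
      push_cast
      rw [ih hil, hP]
      ring
    · rw [segmentSum, segment_self, List.sum_nil, degree_zero]
      simp

theorem sector_sum_subset (hq : 1 < ‖(q : ℂ)‖) {i j : Fin (m + 1)} (hij : i ≤ j) (ε : ℝ) :
    sector (∑ l, P l) ε ⊆ sector (segmentSum P i j) ε := by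
  have h : ∑ l, P l = segmentSum P 0 (Fin.last m) := by
    rw [segmentSum_eq_sum]
    refine Finset.sum_congr rfl fun l _ => (if_pos ⟨Fin.zero_le _, Fin.castSucc_lt_last l⟩).symm
  rw [h, segmentSum_append P (Fin.zero_le i) (Fin.le_last i),
    segmentSum_append P hij (Fin.le_last j)]
  exact (sector_add_subset_right hq _ _ _).trans (sector_add_subset_left hq _ _ _)

end Segments

/-! ### Blocks and germs -/

section BlockGerms

theorem exists_coeff_of_mem_normalSpace {μ ν : ℤ} {f : ℂ → ℂ} (hf : f ∈ normalSpace μ ν) :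
    ∃ c : ℤ → ℂ, ∀ z, f z = ∑ n ∈ Finset.Ico μ ν, z ^ n * c n := by
  induction hf using Submodule.span_induction with
  | mem f hf =>
    obtain ⟨n, hn, rfl⟩ := hf
    refine ⟨Pi.single n 1, fun z => ?_⟩
    rw [Finset.sum_eq_single_of_mem n (Finset.mem_Ico.2 hn)]
    · simp
    · intro k _ hk
      rw [Pi.single_eq_of_ne hk, mul_zero]
  | zero => exact ⟨0, fun z => by simp⟩
  | add f g _ _ hf hg =>
    obtain ⟨c, hc⟩ := hf
    obtain ⟨d, hd⟩ := hg
    exact ⟨c + d, fun z => by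
      simp only [Pi.add_apply, hc z, hd z, mul_add, Finset.sum_add_distrib]⟩
  | smul a f _ hf =>
    obtain ⟨c, hc⟩ := hf
    exact ⟨a • c, fun z => by
      simp only [Pi.smul_apply, hc z, smul_eq_mul, Finset.mul_sum]
      exact Finset.sum_congr rfl fun n _ => by ring⟩

variable {k : ℕ} {r : Fin k → ℕ}

/-- The value at `z` of the block `(i,j)` of a matrix of functions. -/
def blockAt (M : Matrix (Σ i, Fin (r i)) (Σ i, Fin (r i)) (ℂ → ℂ)) (i j : Fin k) (z : ℂ) :
    Matrix (Fin (r i)) (Fin (r j)) ℂ :=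
  Matrix.of fun a b => M ⟨i, a⟩ ⟨j, b⟩ z

theorem blockAt_mul (M N : Matrix (Σ i, Fin (r i)) (Σ i, Fin (r i)) (ℂ → ℂ)) (i j : Fin k)
    (z : ℂ) : blockAt (M * N) i j z = ∑ l, blockAt M i l z * blockAt N l j z := by
  ext a b
  rw [Matrix.sum_apply]
  simp only [blockAt, Matrix.of_apply, Matrix.mul_apply, Finset.sum_apply, Pi.mul_apply,
    Fintype.sum_sigma]

theorem blockAt_diagForm_self (μ : Fin k → ℤ) (B : ∀ i, GL (Fin (r i)) ℂ) (j : Fin k) (z : ℂ) :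
    blockAt (diagForm μ B) j j z = z ^ μ j • (B j : Matrix (Fin (r j)) (Fin (r j)) ℂ) := by
  ext a b
  rw [blockAt, Matrix.of_apply, diagForm, Matrix.blockDiagonal'_apply_eq]
  rfl

theorem blockAt_diagForm_ne (μ : Fin k → ℤ) (B : ∀ i, GL (Fin (r i)) ℂ) {i j : Fin k}
    (hij : i ≠ j) (z : ℂ) : blockAt (diagForm μ B) i j z = 0 := by
  ext a b
  rw [blockAt, Matrix.of_apply, diagForm, Matrix.blockDiagonal'_apply_ne _ _ _ hij]
  rfl

theorem blockAt_mul_diagForm (M : Matrix (Σ i, Fin (r i)) (Σ i, Fin (r i)) (ℂ → ℂ))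
    (μ : Fin k → ℤ) (B : ∀ i, GL (Fin (r i)) ℂ) (i j : Fin k) (z : ℂ) :
    blockAt (M * diagForm μ B) i j z =
      z ^ μ j • (blockAt M i j z * (B j : Matrix (Fin (r j)) (Fin (r j)) ℂ)) := by
  rw [blockAt_mul, Finset.sum_eq_single j, blockAt_diagForm_self, Matrix.mul_smul]
  · intro l _ hl
    rw [blockAt_diagForm_ne μ B hl, Matrix.mul_zero]
  · simp

variable {μ : Fin k → ℤ} {B : ∀ i, GL (Fin (r i)) ℂ}
  {A : Matrix (Σ i, Fin (r i)) (Σ i, Fin (r i)) (ℂ → ℂ)}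

theorem blockAt_self_of_mem (hA : A ∈ birkhoffGuenther μ B) (i : Fin k) (z : ℂ) :
    blockAt A i i z = z ^ μ i • (B i : Matrix (Fin (r i)) (Fin (r i)) ℂ) := by
  ext a b
  exact congrFun (congrFun (congrFun (hA.1 i) a) b) z

theorem blockAt_lower_of_mem (hA : A ∈ birkhoffGuenther μ B) {i j : Fin k} (h : j < i) (z : ℂ) :
    blockAt A i j z = 0 := by
  ext a b
  exact congrFun (congrFun (congrFun (hA.2.1 i j h) a) b) z

theorem exists_blockAt_eq_sum (hA : A ∈ birkhoffGuenther μ B) {i j : Fin k} (h : i < j) :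
    ∃ C : ℤ → Matrix (Fin (r i)) (Fin (r j)) ℂ, ∀ z,
      blockAt A i j z = ∑ n ∈ Finset.Ico (μ i) (μ j), z ^ n • C n := by
  choose c hc using fun a b => exists_coeff_of_mem_normalSpace (hA.2.2 i j h a b)
  refine ⟨fun n => Matrix.of fun a b => c a b n, fun z => ?_⟩
  ext a b
  rw [Matrix.sum_apply]
  exact hc a b z

variable {q : ℂˣ} {Λ : Divisor q}

theorem toGerm_eq_iff {M N : Matrix (Σ i, Fin (r i)) (Σ i, Fin (r i)) (ℂ → ℂ)} :
    toGerm Λ M = toGerm Λ N ↔ ∀ i j, ∀ᶠ z in out Λ, blockAt M i j z = blockAt N i j z := by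
  constructor
  · intro h i j
    have h1 (a b) : ∀ᶠ z in out Λ, M ⟨i, a⟩ ⟨j, b⟩ z = N ⟨i, a⟩ ⟨j, b⟩ z :=
      Germ.coe_eq.1 (congrFun (congrFun h ⟨i, a⟩) ⟨j, b⟩)
    filter_upwards [eventually_all.2 fun a => eventually_all.2 fun b => h1 a b] with z hz
    ext a b
    exact hz a b
  · intro h
    ext ⟨i, a⟩ ⟨j, b⟩
    refine Germ.coe_eq.2 ?_
    filter_upwards [h i j] with z hz
    exact congrFun (congrFun hz a) b

theorem toGerm_mul (M N : Matrix (Σ i, Fin (r i)) (Σ i, Fin (r i)) (ℂ → ℂ)) :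
    toGerm Λ (M * N) = toGerm Λ M * toGerm Λ N :=
  Matrix.map_mul (f := Germ.coeRingHom (out Λ) (R := ℂ))

theorem exists_toGerm_eq (F : Matrix (Σ i, Fin (r i)) (Σ i, Fin (r i)) (GermOut Λ)) :
    ∃ M : Matrix (Σ i, Fin (r i)) (Σ i, Fin (r i)) (ℂ → ℂ), toGerm Λ M = F := by
  have h (x y) : ∃ f : ℂ → ℂ, (f : GermOut Λ) = F x y := Quotient.exists_rep (F x y)
  choose f hf using h
  exact ⟨Matrix.of f, by ext x y; exact hf x y⟩

/-- The conjugacy equation for germs, in terms of representatives. -/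
theorem conjugacy_iff {M : Matrix (Σ i, Fin (r i)) (Σ i, Fin (r i)) (ℂ → ℂ)} :
    (toGerm Λ M).map (sigmaQ Λ) * toGerm Λ (diagForm μ B) = toGerm Λ A * toGerm Λ M ↔
      ∀ i j, ∀ᶠ z in out Λ,
        z ^ μ j • (blockAt M i j ((q : ℂ) * z) * (B j : Matrix (Fin (r j)) (Fin (r j)) ℂ)) =
          ∑ l, blockAt A i l z * blockAt M l j z := by
  have h : (toGerm Λ M).map (sigmaQ Λ) = toGerm Λ (M.map fun f z => f ((q : ℂ) * z)) := rfl
  rw [h, ← toGerm_mul, ← toGerm_mul, toGerm_eq_iff]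
  simp only [blockAt_mul_diagForm, blockAt_mul A]
  rfl

end BlockGerms

/-! ### Existence and uniqueness -/

section Main

variable {q : ℂˣ} {m : ℕ} {r : Fin (m + 1) → ℕ} {μ : Fin (m + 1) → ℤ}
  {B : ∀ i, GL (Fin (r i)) ℂ}
  {A : Matrix (Σ i, Fin (r i)) (Σ i, Fin (r i)) (ℂ → ℂ)}
  {Λ : Divisor q} {P : Fin m → Divisor q}

/-- Triangularity of A and of the column leaves i ≤ l ≤ j. The term l = i is set apart because it
carries the unknown block. -/
theorem sum_blockAt_mul {p : ℕ} (hA : A ∈ birkhoffGuenther μ B) {i j : Fin (m + 1)} (hij : i ≤ j)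
    {X : ∀ l, Fin (r l) → Fin p → ℂ} (hX : ∀ l, j < l → X l = 0) (z : ℂ) :
    ∑ l, blockAt A i l z * Matrix.of (X l) =
      z ^ μ i • ((B i : Matrix (Fin (r i)) (Fin (r i)) ℂ) * Matrix.of (X i)) +
        ∑ l ∈ Finset.Ioc i j, blockAt A i l z * Matrix.of (X l) := by
  rw [← Finset.sum_subset (Finset.subset_univ (Finset.Icc i j)),
    ← Finset.Ioc_insert_left hij, Finset.sum_insert Finset.left_notMem_Ioc,
    blockAt_self_of_mem hA, Matrix.smul_mul]
  intro l _ hl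
  rw [Finset.mem_Icc, not_and_or, not_le, not_le] at hl
  rcases hl with hl | hl
  · rw [blockAt_lower_of_mem hA hl, Matrix.zero_mul]
  · rw [hX l hl, Matrix.of_zero, Matrix.mul_zero]

theorem one_le_degree_segmentSum (hμ : StrictMono μ) (hP : IsGenericPartition μ B Λ P)
    {i j : Fin (m + 1)} (hij : i < j) : 1 ≤ degree (segmentSum P i j) := by
  have h1 := degree_segmentSum P hP.compatible hij.le
  have h2 := hμ hij
  omega

/-- The degree condition on the partition leaves, after division by z^{μ_i}, exactly the power of z
that the theta multiplier absorbs. -/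
theorem zpow_eq_mul_pow_degree (hP : IsGenericPartition μ B Λ P)
    {i j : Fin (m + 1)} (hij : i ≤ j) {z : ℂ} (hz : z ≠ 0) :
    z ^ μ j = z ^ μ i * z ^ degree (segmentSum P i j) := by
  rw [← zpow_natCast, ← zpow_add₀ hz, degree_segmentSum P hP.compatible hij]
  congr 1
  ring

/-- The right hand side of the equation for a block is multisummable if the lower blocks are. -/
theorem exists_multisummable_rhs (hq : 1 < ‖(q : ℂ)‖) (hA : A ∈ birkhoffGuenther μ B) {p : ℕ}
    {i j : Fin (m + 1)} {X : ∀ l, ℂ → Fin (r l) → Fin p → ℂ}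
    (hX : ∀ l, i < l → l ≤ j → IsMultisummable (segment P l j).reverse (X l)) :
    ∃ W : ℂ → Fin (r i) → Fin p → ℂ, IsMultisummable (segment P i j).reverse W ∧
      ∀ z ≠ 0, ∑ l ∈ Finset.Ioc i j, blockAt A i l z * Matrix.of (X l z) =
        z ^ μ i • Matrix.of (W z) := by
  have h (l : Fin (m + 1)) : ∃ C : ℤ → Matrix (Fin (r i)) (Fin (r l)) ℂ, i < l → ∀ z,
      blockAt A i l z = ∑ n ∈ Finset.Ico (μ i) (μ l), z ^ n • C n := by
    by_cases hl : i < l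
    · obtain ⟨C, hC⟩ := exists_blockAt_eq_sum hA hl
      exact ⟨C, fun _ => hC⟩
    · exact ⟨0, fun h => absurd h hl⟩
  choose C hC using h
  -- Exponents in the normal form are at least μ_i, so only nonnegative powers remain after division
  -- by z^{μ_i}, and boundedness at 0 is kept.
  refine ⟨fun z => ∑ l ∈ Finset.Ioc i j, ∑ n ∈ Finset.Ico (μ i) (μ l),
    z ^ (n - μ i).toNat • sandwich (C l n) (1 : Matrix (Fin p) (Fin p) ℂ) (X l z), ?_, ?_⟩
  · refine IsMultisummable.sum _ fun l hl => IsMultisummable.sum _ fun n _ => ?_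
    rw [Finset.mem_Ioc] at hl
    rw [segment_append P hl.1.le hl.2, List.reverse_append]
    exact (((hX l hl.1 hl.2).clm _).pow_smul hq _).append hq _
  · intro z hz
    have hof {ι : Type} (s : Finset ι) (Y : ι → Fin (r i) → Fin p → ℂ) :
        Matrix.of (∑ x ∈ s, Y x) = ∑ x ∈ s, Matrix.of (Y x) := map_sum Matrix.ofAddEquiv Y s
    rw [hof, Finset.smul_sum]
    refine Finset.sum_congr rfl fun l hl => ?_
    rw [Finset.mem_Ioc] at hl
    rw [hC l hl.1, hof, Finset.smul_sum, Matrix.sum_mul]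
    refine Finset.sum_congr rfl fun n hn => ?_
    rw [Finset.mem_Ico] at hn
    rw [← Matrix.smul_of, of_sandwich, Matrix.mul_one, Matrix.smul_mul, smul_smul, ← zpow_natCast,
      ← zpow_add₀ hz, Int.toNat_of_nonneg (by omega)]
    congr 2
    ring

/-- Existence of the columns of the solution. -/
theorem exists_column (hq : 1 < ‖(q : ℂ)‖) (hμ : StrictMono μ) (hA : A ∈ birkhoffGuenther μ B)
    (hP : IsGenericPartition μ B Λ P) (j : Fin (m + 1)) :
    ∃ X : ∀ i, ℂ → Fin (r i) → Fin (r j) → ℂ,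
      (∀ z, Matrix.of (X j z) = 1) ∧ (∀ i, j < i → ∀ z, X i z = 0) ∧
      ∀ i, i < j → IsMultisummable (segment P i j).reverse (X i) ∧
        ∀ z ∈ sector (segmentSum P i j) 0,
          z ^ μ j • (Matrix.of (X i ((q : ℂ) * z)) * (B j : Matrix (Fin (r j)) (Fin (r j)) ℂ)) =
            ∑ l, blockAt A i l z * Matrix.of (X l z) := by
  -- Induction on the height n above the diagonal: at stage n the rows i with j - i ≤ n are solved.
  suffices h : ∀ n : ℕ, ∃ X : ∀ i, ℂ → Fin (r i) → Fin (r j) → ℂ,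
      (∀ z, Matrix.of (X j z) = 1) ∧ (∀ i, j < i → ∀ z, X i z = 0) ∧
      ∀ i, i < j → j.val ≤ i.val + n → IsMultisummable (segment P i j).reverse (X i) ∧
        ∀ z ∈ sector (segmentSum P i j) 0,
          z ^ μ j • (Matrix.of (X i ((q : ℂ) * z)) * (B j : Matrix (Fin (r j)) (Fin (r j)) ℂ)) =
            ∑ l, blockAt A i l z * Matrix.of (X l z) by
    obtain ⟨X, h1, h2, h3⟩ := h j.val
    exact ⟨X, h1, h2, fun i hij => h3 i hij (by omega)⟩
  intro n
  induction n with
  | zero =>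
    -- Equality in the sigma type describes the column with 1 in row j and 0 elsewhere, without
    -- transporting between block sizes.
    refine ⟨fun i _ a b => if (⟨i, a⟩ : Σ i, Fin (r i)) = ⟨j, b⟩ then 1 else 0, fun z => ?_,
      fun i hi z => ?_, fun i hi hi' => absurd hi (by simpa using hi')⟩
    · ext a b
      simp [Matrix.one_apply]
    · funext a b
      refine if_neg fun h => hi.ne' (congrArg Sigma.fst h)
  | succ n ih =>
    obtain ⟨X, h1, h2, h3⟩ := ih
    by_cases hn : n + 1 ≤ j.val
    · let i₀ : Fin (m + 1) := ⟨j.val - (n + 1), by omega⟩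
      have hi₀ : i₀ < j := by rw [Fin.lt_def]; simp only [i₀]; omega
      obtain ⟨W, hW, hWeq⟩ := exists_multisummable_rhs hq hA (P := P) (i := i₀) (j := j) (X := X)
        fun l hl hlj => by
          rcases hlj.lt_or_eq with hlj | rfl
          · refine (h3 l hlj ?_).1
            rw [Fin.lt_def] at hl
            simp only [i₀] at hl
            omega
          · rw [segment_self, List.reverse_nil]
            refine (isMultisummable_const (Matrix.of.symm 1)).congr fun z _ => ?_
            exact Matrix.of.injective (h1 z)
      have hdeg : degree (segment P i₀ j).reverse.sum = degree (segmentSum P i₀ j) := by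
        rw [sum_reverse_segment]
      obtain ⟨Y, hY, hYeq⟩ := exists_multisummable_solution (A := B i₀) (B := B j) hq
        (by rw [hdeg]; exact one_le_degree_segmentSum hμ hP hi₀)
        (by rw [sum_reverse_segment]; exact hP.nonresonant i₀ j hi₀) hW
      rw [sum_reverse_segment] at hYeq
      have hne : ∀ i, i₀ < i → Function.update X i₀ Y i = X i := fun i hi =>
        Function.update_of_ne hi.ne' _ _
      have hzero : ∀ z, ∀ l, j < l → Function.update X i₀ Y l z = 0 := fun z l hl => by
        rw [hne l (hi₀.trans hl), h2 l hl]
      refine ⟨Function.update X i₀ Y, fun z => ?_, fun i hi z => hzero z i hi,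
        fun i hij hi => ?_⟩
      · rw [hne j hi₀, h1]
      · rcases lt_trichotomy i i₀ with hlt | rfl | hlt
        · rw [Fin.lt_def] at hlt
          simp only [i₀] at hlt
          omega
        · rw [Function.update_self]
          refine ⟨hY, fun z hz => ?_⟩
          have hz0 : z ≠ 0 := hz.1
          have hsum := sum_blockAt_mul hA hij.le (hzero z) z
          rw [Function.update_self] at hsum
          have hsum' : ∑ l ∈ Finset.Ioc i₀ j, blockAt A i₀ l z *
              Matrix.of (Function.update X i₀ Y l z) =
              ∑ l ∈ Finset.Ioc i₀ j, blockAt A i₀ l z * Matrix.of (X l z) :=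
            Finset.sum_congr rfl fun l hl => by rw [hne l (Finset.mem_Ioc.1 hl).1]
          rw [hsum, hsum', hWeq z hz0, ← smul_add, ← hYeq z hz, smul_smul,
            ← zpow_eq_mul_pow_degree hP hij.le hz0]
        · have hlt' := hlt
          rw [Fin.lt_def] at hlt'
          simp only [i₀] at hlt'
          obtain ⟨h4, h5⟩ := h3 i hij (by omega)
          rw [hne i hlt]
          refine ⟨h4, fun z hz => ?_⟩
          rw [h5 z hz]
          refine Finset.sum_congr rfl fun l _ => ?_
          rcases lt_or_ge i₀ l with hl | hl
          · rw [hne l hl]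
          -- Equations already solved in rows below i₀ do not see the new block, as A has no entries
          -- left of its diagonal blocks.
          · rw [blockAt_lower_of_mem hA (hl.trans_lt hlt), Matrix.zero_mul, Matrix.zero_mul]
    · exact ⟨X, h1, h2, fun i hij _ => h3 i hij (by omega)⟩

theorem eventually_mem_sector (hq : 1 < ‖(q : ℂ)‖) (hP : ∑ l, P l = Λ) {i j : Fin (m + 1)}
    (hij : i ≤ j) : ∀ᶠ z in out Λ, z ∈ sector (segmentSum P i j) 0 := by
  filter_upwards [self_mem_nhdsWithin] with z hz
  exact sector_sum_subset P hq hij 0 (hP ▸ hz)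

theorem exists_matrix (hq : 1 < ‖(q : ℂ)‖) (hμ : StrictMono μ) (hA : A ∈ birkhoffGuenther μ B)
    (hP : IsGenericPartition μ B Λ P) :
    ∃ F : Matrix (Σ i, Fin (r i)) (Σ i, Fin (r i)) (GermOut Λ),
      F ∈ unipotentBlock r (GermOut Λ) ∧
      F.map (sigmaQ Λ) * toGerm Λ (diagForm μ B) = toGerm Λ A * F ∧
      ∀ i j, i < j → ∀ a b, block F i j a b ∈ OOGerm Λ (segment P i j).reverse := by
  choose X h1 h2 h3 using exists_column hq hμ hA hP
  let M : Matrix (Σ i, Fin (r i)) (Σ i, Fin (r i)) (ℂ → ℂ) :=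
    Matrix.of fun x y z => X y.1 x.1 z x.2 y.2
  have hM (i j : Fin (m + 1)) (z : ℂ) : blockAt M i j z = Matrix.of (X j i z) := rfl
  refine ⟨toGerm Λ M, ⟨fun i => ?_, fun i j hij => ?_⟩, conjugacy_iff.2 fun i j => ?_,
    fun i j hij a b => ?_⟩
  · ext a b
    have h (z : ℂ) : X i i z a b = (1 : Matrix (Fin (r i)) (Fin (r i)) ℂ) a b :=
      congrFun (congrFun (h1 i z) a) b
    change ((fun z => X i i z a b : ℂ → ℂ) : GermOut Λ) = _
    simp only [h]
    rw [Matrix.one_apply, Matrix.one_apply]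
    split_ifs <;> rfl
  · ext a b
    change ((fun z => X j i z a b : ℂ → ℂ) : GermOut Λ) = _
    simp only [h2 j i hij]
    rfl
  · simp only [hM]
    rcases lt_trichotomy i j with hij | rfl | hij
    · filter_upwards [eventually_mem_sector hq hP.sum_eq hij.le] with z hz
      exact (h3 j i hij).2 z hz
    · refine .of_forall fun z => ?_
      rw [sum_blockAt_mul hA le_rfl (fun l hl => h2 i l hl z), h1, h1, Finset.Ioc_self,
        Finset.sum_empty, add_zero, Matrix.one_mul, Matrix.mul_one]
    · refine .of_forall fun z => ?_
      rw [h2 j i hij, Matrix.of_zero, Matrix.zero_mul, smul_zero]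
      refine (Finset.sum_eq_zero fun l _ => ?_).symm
      rcases lt_or_ge j l with hl | hl
      · rw [h2 j l hl, Matrix.of_zero, Matrix.mul_zero]
      · rw [blockAt_lower_of_mem hA (hl.trans_lt hij), Matrix.zero_mul]
  · have hsub : sector Λ 0 ⊆ sector (segment P i j).reverse.sum 0 := by
      rw [sum_reverse_segment, ← hP.sum_eq]
      exact sector_sum_subset P hq hij.le 0
    have hdeg : 1 ≤ degree (segment P i j).reverse.sum := by
      rw [sum_reverse_segment]
      exact one_le_degree_segmentSum hμ hP hij
    let T : (Fin (r i) → Fin (r j) → ℂ) →L[ℂ] ℂ :=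
      (ContinuousLinearMap.proj b : (Fin (r j) → ℂ) →L[ℂ] ℂ).comp (ContinuousLinearMap.proj a)
    exact ((h3 j i hij).1.clm T).germ_mem_OOGerm hq hdeg hsub

theorem exists_numerators {ι κ : Type*} [Finite ι] [Finite κ] {L : List (Divisor q)}
    {M : ι → κ → ℂ → ℂ} (hM : ∀ a b, (M a b : GermOut Λ) ∈ OOGerm Λ L)
    (hsub : sector Λ 0 ⊆ sector L.sum 0) :
    ∃ R > 0, ∃ G : ι → κ → ℂ → ℂ, (∀ a b, DifferentiableOn ℂ (G a b) (puncturedDisk R)) ∧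
      ∀ᶠ z in out Λ, ∀ a b, M a b z = (thetaDiv L.sum z)⁻¹ * G a b z := by
  have h (a b) : ∃ G : ℂ → ℂ, (∃ R > 0, DifferentiableOn ℂ G (puncturedDisk R)) ∧
      ∀ᶠ z in out Λ, M a b z = (thetaDiv L.sum z)⁻¹ * G z := by
    obtain ⟨f, ⟨-, G, ⟨⟨R, hR, hG, -⟩, -⟩, hf⟩, hMf⟩ := hM a b
    refine ⟨G, ⟨R, hR, hG.differentiableOn⟩, ?_⟩
    filter_upwards [Germ.coe_eq.1 hMf, nhdsWithin_mono _ hsub hf] with z h1 h2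
    rw [h1, h2, inv_mul_eq_div]
  choose G hG hGM using h
  choose R hR hGR using hG
  have hev : ∀ᶠ ρ : ℝ in 𝓝[>] 0, ∀ a b, ρ < R a b :=
    eventually_all.2 fun a => eventually_all.2 fun b =>
      nhdsWithin_le_nhds (eventually_lt_nhds (hR a b))
  obtain ⟨ρ, hρ, hρ0⟩ := (hev.and self_mem_nhdsWithin).exists
  exact ⟨ρ, hρ0, G, fun a b => (hGR a b).mono fun z hz => ⟨hz.1, hz.2.trans (hρ a b)⟩,
    eventually_all.2 fun a => eventually_all.2 fun b => hGM a b⟩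

/-- The inhomogeneous terms cancel because the lower blocks agree, so the difference θ⁻¹(G - G')
solves the homogeneous equation and its numerator vanishes near 0. -/
theorem block_unique (hq : 1 < ‖(q : ℂ)‖) (hA : A ∈ birkhoffGuenther μ B)
    (hP : IsGenericPartition μ B Λ P)
    {M N : Matrix (Σ i, Fin (r i)) (Σ i, Fin (r i)) (ℂ → ℂ)} {i j : Fin (m + 1)} (hij : i < j)
    (hM : ∀ a b, block (toGerm Λ M) i j a b ∈ OOGerm Λ (segment P i j).reverse)
    (hN : ∀ a b, block (toGerm Λ N) i j a b ∈ OOGerm Λ (segment P i j).reverse)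
    (hMeq : ∀ᶠ z in out Λ,
      z ^ μ j • (blockAt M i j ((q : ℂ) * z) * (B j : Matrix (Fin (r j)) (Fin (r j)) ℂ)) =
        ∑ l, blockAt A i l z * blockAt M l j z)
    (hNeq : ∀ᶠ z in out Λ,
      z ^ μ j • (blockAt N i j ((q : ℂ) * z) * (B j : Matrix (Fin (r j)) (Fin (r j)) ℂ)) =
        ∑ l, blockAt A i l z * blockAt N l j z)
    (hMN : ∀ l, i < l → ∀ᶠ z in out Λ, blockAt M l j z = blockAt N l j z) :
    ∀ᶠ z in out Λ, blockAt M i j z = blockAt N i j z := by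
  have hsub : sector Λ 0 ⊆ sector (segmentSum P i j) 0 := by
    rw [← hP.sum_eq]
    exact sector_sum_subset P hq hij.le 0
  obtain ⟨R, hR, G, hG, hMG⟩ := exists_numerators hM (by rwa [sum_reverse_segment])
  obtain ⟨R', hR', G', hG', hNG⟩ := exists_numerators hN (by rwa [sum_reverse_segment])
  rw [sum_reverse_segment] at hMG hNG
  have hMN' : ∀ᶠ z in out Λ, ∀ l, i < l → blockAt M l j z = blockAt N l j z :=
    eventually_all.2 fun l => by
      by_cases hl : i < l
      · filter_upwards [hMN l hl] with z hz _ using hz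
      · exact .of_forall fun z h => absurd h hl
  let E : ℂ → Fin (r i) → Fin (r j) → ℂ := fun z a b => G a b z - G' a b z
  have hE : DifferentiableOn ℂ E (puncturedDisk (min R R')) := by
    refine differentiableOn_pi.2 fun a => differentiableOn_pi.2 fun b => ?_
    exact ((hG a b).mono fun z hz => ⟨hz.1, hz.2.trans_le (min_le_left _ _)⟩).sub
      ((hG' a b).mono fun z hz => ⟨hz.1, hz.2.trans_le (min_le_right _ _)⟩)
  have hdiff : ∀ᶠ z in out Λ, blockAt M i j z - blockAt N i j z =
      Matrix.of ((thetaDiv (segmentSum P i j) z)⁻¹ • E z) := by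
    filter_upwards [hMG, hNG] with z h1 h2
    ext a b
    have h3 : M ⟨i, a⟩ ⟨j, b⟩ z = _ := h1 a b
    have h4 : N ⟨i, a⟩ ⟨j, b⟩ z = _ := h2 a b
    change M ⟨i, a⟩ ⟨j, b⟩ z - N ⟨i, a⟩ ⟨j, b⟩ z =
      (thetaDiv (segmentSum P i j) z)⁻¹ * (G a b z - G' a b z)
    rw [h3, h4, mul_sub]
  obtain ⟨ρ, hρ, h0⟩ := eq_zero_of_homogeneous_out (A := B i) (B := B j) hq hsub
    (hP.nonresonant i j hij) (lt_min hR hR') hE (by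
      filter_upwards [hMeq, hNeq, hMN', hdiff, (tendsto_out Λ).eventually hdiff,
        self_mem_nhdsWithin] with z h1 h2 h3 h4 h5 hz
      have hz0 : z ≠ 0 := hz.1
      have h6 : ∑ l, blockAt A i l z * blockAt M l j z - ∑ l, blockAt A i l z * blockAt N l j z =
          z ^ μ i • ((B i : Matrix (Fin (r i)) (Fin (r i)) ℂ) *
            (blockAt M i j z - blockAt N i j z)) := by
        rw [← Finset.sum_sub_distrib, Finset.sum_eq_single i, blockAt_self_of_mem hA,
          ← Matrix.mul_sub, Matrix.smul_mul]
        · intro l _ hl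
          rcases hl.lt_or_gt with hl | hl
          · rw [blockAt_lower_of_mem hA hl, Matrix.zero_mul, Matrix.zero_mul, sub_zero]
          · rw [h3 l hl, sub_self]
        · simp
      rw [← h1, ← h2, ← smul_sub, ← Matrix.sub_mul, h4, h5, zpow_eq_mul_pow_degree hP hij.le hz0,
        mul_smul] at h6
      exact smul_right_injective _ (zpow_ne_zero _ hz0) h6)
  have hρ' : ∀ᶠ z in out Λ, ‖z‖ < ρ := by
    refine nhdsWithin_le_nhds ?_
    filter_upwards [Metric.ball_mem_nhds (0 : ℂ) hρ] with z hz
    simpa using hz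
  filter_upwards [hdiff, hρ', self_mem_nhdsWithin] with z h1 h2 hz
  rw [h0 z ⟨norm_pos_iff.2 hz.1, h2⟩, smul_zero, Matrix.of_zero, sub_eq_zero] at h1
  exact h1

theorem matrix_unique (hq : 1 < ‖(q : ℂ)‖) (hA : A ∈ birkhoffGuenther μ B)
    (hP : IsGenericPartition μ B Λ P)
    {F F' : Matrix (Σ i, Fin (r i)) (Σ i, Fin (r i)) (GermOut Λ)}
    (hF : F ∈ unipotentBlock r (GermOut Λ) ∧
      F.map (sigmaQ Λ) * toGerm Λ (diagForm μ B) = toGerm Λ A * F ∧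
      ∀ i j, i < j → ∀ a b, block F i j a b ∈ OOGerm Λ (segment P i j).reverse)
    (hF' : F' ∈ unipotentBlock r (GermOut Λ) ∧
      F'.map (sigmaQ Λ) * toGerm Λ (diagForm μ B) = toGerm Λ A * F' ∧
      ∀ i j, i < j → ∀ a b, block F' i j a b ∈ OOGerm Λ (segment P i j).reverse) :
    F = F' := by
  obtain ⟨M, rfl⟩ := exists_toGerm_eq F
  obtain ⟨N, rfl⟩ := exists_toGerm_eq F'
  obtain ⟨hM1, hM2, hM3⟩ := hF
  obtain ⟨hN1, hN2, hN3⟩ := hF'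
  have hge {i j : Fin (m + 1)} (h : block (toGerm Λ M) i j = block (toGerm Λ N) i j) :
      ∀ᶠ z in out Λ, blockAt M i j z = blockAt N i j z := by
    have h1 (a b) : ∀ᶠ z in out Λ, M ⟨i, a⟩ ⟨j, b⟩ z = N ⟨i, a⟩ ⟨j, b⟩ z :=
      Germ.coe_eq.1 (congrFun (congrFun h a) b)
    filter_upwards [eventually_all.2 fun a => eventually_all.2 fun b => h1 a b] with z hz
    ext a b
    exact hz a b
  refine toGerm_eq_iff.2 fun i j => ?_
  -- Within a column, row i involves only rows l ≥ i, so the induction runs from the largest row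
  -- index down.
  induction i using WellFoundedGT.induction with
  | ind i ih =>
    rcases lt_trichotomy i j with hij | rfl | hij
    · exact block_unique hq hA hP hij (hM3 i j hij) (hN3 i j hij) (conjugacy_iff.1 hM2 i j)
        (conjugacy_iff.1 hN2 i j) ih
    · exact hge ((hM1.1 i).trans (hN1.1 i).symm)
    · exact hge ((hM1.2 i j hij).trans (hN1.2 i j hij).symm)

end Main

end QDiff

end

theorem mainTheorem5 (q : ℂˣ) (hq : 1 < ‖(q : ℂ)‖) (m : ℕ)
    (r : Fin (m + 1) → ℕ) (μ : Fin (m + 1) → ℤ) (hμ : StrictMono μ)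
    (B : ∀ i, GL (Fin (r i)) ℂ)
    (A : Matrix (Σ i, Fin (r i)) (Σ i, Fin (r i)) (ℂ → ℂ))
    (hA : A ∈ QDiff.birkhoffGuenther μ B)
    (Λ : QDiff.Divisor q) (P : Fin m → QDiff.Divisor q)
    (hP : QDiff.IsGenericPartition μ B Λ P) :
    ∃! F : Matrix (Σ i, Fin (r i)) (Σ i, Fin (r i)) (QDiff.GermOut Λ),
      F ∈ QDiff.unipotentBlock r (QDiff.GermOut Λ) ∧
      F.map (QDiff.sigmaQ Λ) * QDiff.toGerm Λ (QDiff.diagForm μ B) = QDiff.toGerm Λ A * F ∧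
      ∀ i j, i < j → ∀ a b,
        QDiff.block F i j a b ∈ QDiff.OOGerm Λ (QDiff.segment P i j).reverse := by
  obtain ⟨F, hF⟩ := QDiff.exists_matrix hq hμ hA hP
  exact ⟨F, hF, fun F' hF' => QDiff.matrix_unique hq hA hP hF' hF⟩
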